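/- **Model.** There are one target task ($k=0$) and $K\ge 1$ source tasks ($k=1,\dots,K$), with sample sizes $n_0=n_T$ and $n_k=n_S\ge n_T$ for $k\ge 1$; put $N=Kn_S+n_T$. We observe $y^{(k)}_i=(X^{(k)}_i)^\top\beta^{(k)}+\epsilon^{(k)}_i$, $1\le i\le n_k$, with $\beta^{(k)}\in\mathbb R^p$, $\|\beta^{(0)}\|_0\le s$ (where $s\ge 1$) and $\|\beta^{(k)}-\beta^{(0)}\|_1\le h_k$ for $1\le k\le K$; put $\bar h=\frac{n_S}{N}\sum_{k=1}^K h_k$. For each $k$ the rows $X^{(k)}_i\in\mathbb R^p$ are independent, centered and sub-Gaussian with a common variance proxy $L$ (that is, $\mathbb E\,e^{t\langle X^{(k)}_i,u\rangle}\le e^{Lt^2/2}$ for all $t\in\mathbb R$ and all unit vectors $u$), with covariance matrix $\Sigma^{(k)}$ whose eigenvalues lie in $[1/c,c]$. The errors $\epsilon^{(k)}_i$ are independent (over all $k$ and $i$) centered Gaussian variables with variances at most $\sigma^2$, and are independent of the designs. **Methods.** *First step* with tuning parameters $\lambda_0$ and $a_k$: take any $$(\hat\beta^{(k)})_{k=0}^K\in\arg\min_{b}\Big\{\frac1{2N}\sum_{k=0}^K\sum_{i=1}^{n_k}\big(y^{(k)}_i-(X^{(k)}_i)^\top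 b^{(k)}\big)^2+\lambda_0\Big(\|b^{(0)}\|_1+\sum_{k=1}^Ka_k\|b^{(k)}-b^{(0)}\|_1\Big)\Big\}$$ and $\hat w=\frac{n_S}{N}\sum_{k=1}^K\hat\beta^{(k)}+\frac{n_T}{N}\hat\beta^{(0)}$. *One-step method*: the estimator is $\hat w$ with $\lambda_0=c_0\sqrt{\log p/N}$ and $a_k=8\sqrt{n_S/N}$. *Two-step method*: the estimator is $\hat w+\hat\delta$, where $\hat w$ is computed with $\lambda_0=c_0\sqrt{\log p/N}$, $a_k=8\sqrt{n_S/N}$ if $s\log p/n_S\ge\bar h\sqrt{\log p/n_T}$, and with $\lambda_0=c_0\sqrt{\log p/n_S}$, $a_k=8n_S/N$ otherwise, and where $$\hat\delta\in\arg\min_{\delta\in\mathbb R^p}\Big\{\frac1{2n_T}\sum_{i=1}^{n_T}\big(y^{(0)}_i-(X^{(0)}_i)^\top\hat w-(X^{(0)}_i)^\top\delta\big)^2+\tilde\lambda\|\delta\|_1\Big\},\qquad \tilde\lambda=c_1\sqrt{\log p/n_T}.$$ *Combined method* with threshold constant $\kappa>0$: use the one-step method if $n_T\bar h^2\le\kappa\log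 p$ (that is, $n_T\lesssim\log p/\bar h^2$), and the two-step method otherwise. Let $\hat\beta$ be the resulting estimator. **Claim.** Let $L,\sigma^2,c$ and constants $C_T,C_S$ be given. There are constants $c_0,c_1>0$ such that for every $\kappa>0$ there are constants $C,c_2,c_3>0$ with the following property. For every sequence of problems as above (all of $K,n_T,n_S,p,s,h_k$, the parameters and the distributions may vary along the sequence) with $$\frac{s\log p}{n_S}\to 0,\qquad s\log p\le C_Tn_T,\qquad K^2s\log p\le C_Sn_S,\qquad \bar h\sqrt{\frac{\log p}{n_T}}+\frac{Ks\log p}{n_S}\to 0,$$ it holds, for all sufficiently late members of the sequence, with probability at least $1-c_2\exp(-c_3\log p)$, that $$\|\hat\beta-\beta^{(0)}\|_2^2\le C\Big(\frac{s\log p}{N}+\Big(\bar h\sqrt{\frac{\log p}{n_T}}\wedge\bar h^2\Big)\Big),$$ whichever minimizers are chosen. -/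

import Mathlib

open Filter Topology MeasureTheory ProbabilityTheory
open scoped NNReal Matrix

universe u

/-- `‖v‖₁ = ∑ⱼ |vⱼ|`. -/
def l1Norm {p : ℕ} (v : Fin p → ℝ) : ℝ := ∑ j, |v j|

/-- `‖v‖₂² = ∑ⱼ vⱼ²`. -/
def l2NormSq {p : ℕ} (v : Fin p → ℝ) : ℝ := ∑ j, v j ^ 2

/-- `‖v‖₀`, the number of nonzero entries. -/
noncomputable def l0Norm {p : ℕ} (v : Fin p → ℝ) : ℕ := Set.ncard {j | v j ≠ 0}

/-- Sample size of task `k`: `nT` for the target task `0`, `nS` for each source task `1, …, K`. -/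
def sampleSize {K : ℕ} (nT nS : ℕ) (k : Fin (K + 1)) : ℕ := if k = 0 then nT else nS

/-- The data of a transfer learning problem: one target task (index `0`) and `K` source tasks, all of
them linear models in dimension `p`. No property is assumed here. -/
structure TransferProblem where
  /-- number of source tasks -/
  K : ℕ
  /-- target sample size -/
  nT : ℕ
  /-- common sample size of the source tasks -/
  nS : ℕ
  /-- dimension -/
  p : ℕ
  /-- sparsity level -/
  s : ℕ
  /-- levels of the model shifts -/
  h : Fin K → ℝ
  /-- sample space -/
  Ω : Type u
  /-- its σ-algebra -/
  mΩ : MeasurableSpace Ω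
  /-- its probability -/
  μ : Measure Ω
  /-- rows of the design matrices -/
  X : (k : Fin (K + 1)) → Fin (sampleSize nT nS k) → Ω → (Fin p → ℝ)
  /-- observation noises -/
  ε : (k : Fin (K + 1)) → Fin (sampleSize nT nS k) → Ω → ℝ
  /-- covariance matrices of the designs -/
  cov : Fin (K + 1) → Matrix (Fin p) (Fin p) ℝ
  /-- true regression parameters -/
  β : Fin (K + 1) → Fin p → ℝ

attribute [instance] TransferProblem.mΩ

noncomputable section

namespace TransferProblem

variable (P : TransferProblem.{u})

/-- Total sample size `N = K nS + nT`, as a real number. -/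
def N : ℝ := (P.K : ℝ) * P.nS + P.nT

/-- `h̄ = (nS / N) ∑ₖ hₖ`. -/
def hbar : ℝ := (P.nS : ℝ) / P.N * ∑ k, P.h k

/-- `log p`. -/
def logp : ℝ := Real.log P.p

/-- The responses `yᵢ⁽ᵏ⁾ = (Xᵢ⁽ᵏ⁾)ᵀ β⁽ᵏ⁾ + εᵢ⁽ᵏ⁾`. -/
def y (k : Fin (P.K + 1)) (i : Fin (sampleSize P.nT P.nS k)) (ω : P.Ω) : ℝ :=
  P.X k i ω ⬝ᵥ P.β k + P.ε k i ω

/-- The parameter space `Θ(s, h)`: `‖β⁽⁰⁾‖₀ ≤ s` and `‖β⁽ᵏ⁾ - β⁽⁰⁾‖₁ ≤ hₖ` for `1 ≤ k ≤ K`. -/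
def InParameterSpace : Prop :=
  l0Norm (P.β 0) ≤ P.s ∧ ∀ k : Fin P.K, l1Norm (P.β k.succ - P.β 0) ≤ P.h k

/-- Sub-Gaussian designs: in each task the rows are independent, centered, sub-Gaussian (every
one-dimensional marginal in a unit direction has variance proxy `L`), with covariance matrix `cov k`
whose eigenvalues lie in `[1/c, c]`. -/
structure SubGaussianDesign (L : ℝ≥0) (c : ℝ) : Prop where
  measurable : ∀ k i, Measurable (P.X k i)
  indep : ∀ k, iIndepFun (P.X k) P.μ
  mean_zero : ∀ k i j, ∫ ω, P.X k i ω j ∂P.μ = 0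
  covariance : ∀ k i j l,
    ProbabilityTheory.covariance (fun ω => P.X k i ω j) (fun ω => P.X k i ω l) P.μ = P.cov k j l
  subGaussian : ∀ k i (u : Fin P.p → ℝ), l2NormSq u = 1 →
    HasSubgaussianMGF (fun ω => P.X k i ω ⬝ᵥ u) L P.μ
  eigenvalues : ∀ k, ∃ hk : (P.cov k).IsHermitian,
    ∀ j, 1 / c ≤ hk.eigenvalues j ∧ hk.eigenvalues j ≤ c

/-- Gaussian errors: all the noises are independent, centered Gaussian with variances at most `σsq`,
and the noises are independent of the designs. -/
structure GaussianErrors (σsq : ℝ≥0) : Prop where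
  measurable : ∀ k i, Measurable (P.ε k i)
  gaussian : ∀ k i, ∃ v : ℝ≥0, v ≤ σsq ∧ P.μ.map (P.ε k i) = gaussianReal 0 v
  indep : iIndepFun
    (fun q : (k : Fin (P.K + 1)) × Fin (sampleSize P.nT P.nS k) => P.ε q.1 q.2) P.μ
  indep_design : IndepFun (fun ω k i => P.X k i ω) (fun ω k i => P.ε k i ω) P.μ

/-- The co-training objective
`(1/2N) ∑ₖ ‖y⁽ᵏ⁾ - X⁽ᵏ⁾ b⁽ᵏ⁾‖₂² + lam0 (‖b⁽⁰⁾‖₁ + ∑ₖ aₖ ‖b⁽ᵏ⁾ - b⁽⁰⁾‖₁)`. -/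
def coTrainingObjective (lam0 : ℝ) (a : Fin P.K → ℝ) (ω : P.Ω)
    (b : Fin (P.K + 1) → Fin P.p → ℝ) : ℝ :=
  1 / (2 * P.N) * ∑ k, ∑ i, (P.y k i ω - P.X k i ω ⬝ᵥ b k) ^ 2
    + lam0 * (l1Norm (b 0) + ∑ k : Fin P.K, a k * l1Norm (b k.succ - b 0))

/-- The weighted average `(nS / N) ∑ₖ b⁽ᵏ⁾ + (nT / N) b⁽⁰⁾`. -/
def average (b : Fin (P.K + 1) → Fin P.p → ℝ) : Fin P.p → ℝ :=
  ((P.nS : ℝ) / P.N) • (∑ k : Fin P.K, b k.succ) + ((P.nT : ℝ) / P.N) • b 0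

/-- `w` is a first-step estimator with tuning parameters `lam0` and `a`: the weighted average of a
global minimizer of the co-training objective. -/
def IsFirstStep (lam0 : ℝ) (a : Fin P.K → ℝ) (ω : P.Ω) (w : Fin P.p → ℝ) : Prop :=
  ∃ b, IsMinOn (P.coTrainingObjective lam0 a ω) Set.univ b ∧ w = P.average b

/-- The local debiasing objective `(1/2nT) ‖y⁽⁰⁾ - X⁽⁰⁾ w - X⁽⁰⁾ δ‖₂² + lamT ‖δ‖₁`. -/
def debiasObjective (lamT : ℝ) (ω : P.Ω) (w δ : Fin P.p → ℝ) : ℝ :=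
  1 / (2 * (P.nT : ℝ)) * ∑ i, (P.y 0 i ω - P.X 0 i ω ⬝ᵥ w - P.X 0 i ω ⬝ᵥ δ) ^ 2
    + lamT * l1Norm δ

/-- The condition `s log p / nS ≥ h̄ √(log p / nT)`. -/
def CondA : Prop := P.hbar * √(P.logp / P.nT) ≤ P.s * P.logp / P.nS

open Classical in
/-- `lam0` of the two-step method: `c0 √(log p / N)` under condition `A`, else `c0 √(log p / nS)`. -/
def lam0TwoStep (c0 : ℝ) : ℝ :=
  if P.CondA then c0 * √(P.logp / P.N) else c0 * √(P.logp / P.nS)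

open Classical in
/-- `aₖ` of the two-step method: `8 √(nS / N)` under condition `A`, else `8 nS / N`. -/
def weightTwoStep : ℝ :=
  if P.CondA then 8 * √(P.nS / P.N) else 8 * (P.nS / P.N)

/-- `b` is an outcome of the one-step method, run with `lam0 = c0 √(log p / N)`,
`aₖ = 8 √(nS / N)`. -/
def IsOneStep (c0 : ℝ) (ω : P.Ω) (b : Fin P.p → ℝ) : Prop :=
  P.IsFirstStep (c0 * √(P.logp / P.N)) (fun _ => 8 * √(P.nS / P.N)) ω b

/-- `b` is an outcome of the two-step method: a first-step estimator `w` plus a global minimizer `δ`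
of the debiasing objective with tuning parameter `c1 √(log p / nT)`. -/
def IsTwoStep (c0 c1 : ℝ) (ω : P.Ω) (b : Fin P.p → ℝ) : Prop :=
  ∃ w δ, P.IsFirstStep (P.lam0TwoStep c0) (fun _ => P.weightTwoStep) ω w ∧
    IsMinOn (P.debiasObjective (c1 * √(P.logp / P.nT)) ω w) Set.univ δ ∧ b = w + δ

/-- `b` is an outcome of the combined method: one step if `nT ≤ κ log p / h̄²` (always, if `h̄ = 0`),
two steps otherwise. -/
def IsCombined (κ c0 c1 : ℝ) (ω : P.Ω) (b : Fin P.p → ℝ) : Prop :=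
  (P.nT * P.hbar ^ 2 ≤ κ * P.logp ∧ P.IsOneStep c0 ω b) ∨
    (κ * P.logp < P.nT * P.hbar ^ 2 ∧ P.IsTwoStep c0 c1 ω b)

end TransferProblem

end

/-! Write w_k = n_k/N and τ = √(log p / n_S), and let Q_k be the Gram form and z_k = Xᵀε/n_k the
score of task k. Up to a constant, the co-training objective is Σ w_k(½Q_k(b_k − β_k, b_k − β_k) −
z_k·(b_k − β_k)), plus the penalty c0 τ g on ‖b_0‖₁ and the penalty 8 c0 τ on the weighted mean of
‖b_k − b_0‖₁. The two tunings are g = √(n_S/N) and g = 1, so both are covered by one analysis with g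
in [√(n_S/N), 1].

Deterministic part. Suppose the pooled score is at most half the penalty on b_0 and each z_k at most
half the penalty on b_k − b_0. Comparing the minimizer with the truth (`basic_inequality`) controls
the prediction error, the heterogeneity Σ w_k‖(b_k − β_k) − (b_0 − β_0)‖₁ and the off-support part
of b_0 − β_0 by its on-support part and h̄. If the support part dominates, the ℓ₂ rate is τ g √s;
otherwise it is √(τ h̄) + τ h̄/g (`average_rate`). For the one-step method the second rate is too
weak. Comparing the minimizer with its joint translate by β_0 − b_0 does not involve h̄, since all
b_k − b_0 are kept (`translation_inequality`), and the rate improves to h̄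
(`average_rate_of_small_shift`). The second step of the two-step method is a lasso on the target
sample whose coefficient −Σ w_k(β_k − β_0) has ℓ₁ norm at most h̄ (`debias_rate`). The threshold on
n_T h̄² decides which of h̄² and h̄√(log p / n_T) is the minimum up to a constant
(`combined_bound`).

The difficulty is that the failure probability must be O(1/p) although K may be far larger than p,
so a union bound over all scores is not always available. It is if K ≤ p. If K > p, then K² s log p
≤ C_S n_S forces p² log p ≤ C_S n_S: the source tasks are low-dimensional, with well-conditioned
Gram matrices. For a task whose score exceeds the penalty, the center β_k is replaced with β_k +
o_k, where o_k is the lasso solution for pure noise; the residual score z_k − Q_k o_k is then a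
subgradient of the penalty, hence dominated by it. This has two costs. Such tasks give no control of
their heterogeneity, but their total weight is small by Markov's inequality, and comparing two lasso
programs bounds their share (`bad_contribution`). Moreover Σ w_k o_k and Σ w_k Q_k o_k must be
small: o_k is an odd function of the noise of task k, so different tasks are uncorrelated, and o_k
vanishes outside an event of probability of order p⁻⁷, so Chebyshev's inequality suffices
(`measureReal_lt_abs_sum_odd_le`).

Restricted eigenvalues with slack (log p / n)‖u‖₁² come from a union bound over sums of about n /
log p signed basis vectors and Maurey's empirical method (`exists_regular_designs`). The scores are
treated by freezing the designs, which leaves Gaussian linear forms. -/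

/-! ### Norms on `Fin p → ℝ` -/

section Norms

variable {p : ℕ}

/-- `‖v‖₂`. -/
noncomputable def l2Norm (v : Fin p → ℝ) : ℝ := √(l2NormSq v)

/-- `‖v_S‖₁`. -/
def l1On (S : Finset (Fin p)) (v : Fin p → ℝ) : ℝ := ∑ j ∈ S, |v j|

lemma l1Norm_nonneg (v : Fin p → ℝ) : 0 ≤ l1Norm v :=
  Finset.sum_nonneg fun _ _ => abs_nonneg _

lemma l1On_nonneg (S : Finset (Fin p)) (v : Fin p → ℝ) : 0 ≤ l1On S v :=
  Finset.sum_nonneg fun _ _ => abs_nonneg _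

lemma l1Norm_zero : l1Norm (0 : Fin p → ℝ) = 0 := by simp [l1Norm]

lemma l1Norm_neg (v : Fin p → ℝ) : l1Norm (-v) = l1Norm v := by simp [l1Norm]

lemma l1Norm_add_le (u v : Fin p → ℝ) : l1Norm (u + v) ≤ l1Norm u + l1Norm v := by
  unfold l1Norm
  rw [← Finset.sum_add_distrib]
  exact Finset.sum_le_sum fun j _ => abs_add_le _ _

lemma l1Norm_sub_le (u v : Fin p → ℝ) : l1Norm (u - v) ≤ l1Norm u + l1Norm v := by
  rw [sub_eq_add_neg, ← l1Norm_neg v]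
  exact l1Norm_add_le _ _

lemma l1Norm_smul (t : ℝ) (v : Fin p → ℝ) : l1Norm (t • v) = |t| * l1Norm v := by
  simp [l1Norm, abs_mul, Finset.mul_sum]

lemma l1Norm_sum_le {ι : Type*} (s : Finset ι) (f : ι → Fin p → ℝ) :
    l1Norm (∑ i ∈ s, f i) ≤ ∑ i ∈ s, l1Norm (f i) :=
  Finset.le_sum_of_subadditive _ l1Norm_zero.le l1Norm_add_le _ _

lemma l1On_add_l1On_compl (S : Finset (Fin p)) (v : Fin p → ℝ) :
    l1On S v + l1On Sᶜ v = l1Norm v :=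
  Finset.sum_add_sum_compl S _

lemma l1On_le_l1Norm (S : Finset (Fin p)) (v : Fin p → ℝ) : l1On S v ≤ l1Norm v := by
  have := l1On_add_l1On_compl S v
  have := l1On_nonneg Sᶜ v
  linarith

lemma l1On_add_le (S : Finset (Fin p)) (u v : Fin p → ℝ) :
    l1On S (u + v) ≤ l1On S u + l1On S v := by
  unfold l1On
  rw [← Finset.sum_add_distrib]
  exact Finset.sum_le_sum fun j _ => abs_add_le _ _

lemma l2NormSq_nonneg (v : Fin p → ℝ) : 0 ≤ l2NormSq v :=
  Finset.sum_nonneg fun _ _ => sq_nonneg _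

lemma l2Norm_nonneg (v : Fin p → ℝ) : 0 ≤ l2Norm v := Real.sqrt_nonneg _

lemma l2Norm_sq (v : Fin p → ℝ) : l2Norm v ^ 2 = l2NormSq v := Real.sq_sqrt (l2NormSq_nonneg v)

lemma l2Norm_eq (v : Fin p → ℝ) : l2Norm v = ‖WithLp.toLp 2 v‖ := by
  simp [l2Norm, l2NormSq, EuclideanSpace.norm_eq]

lemma l2Norm_zero : l2Norm (0 : Fin p → ℝ) = 0 := by simp [l2Norm, l2NormSq]

lemma l2Norm_add_le (u v : Fin p → ℝ) : l2Norm (u + v) ≤ l2Norm u + l2Norm v := by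
  simp only [l2Norm_eq, WithLp.toLp_add]
  exact norm_add_le _ _

lemma l2Norm_neg (v : Fin p → ℝ) : l2Norm (-v) = l2Norm v := by simp [l2Norm, l2NormSq]

lemma l2Norm_sub_le (u v : Fin p → ℝ) : l2Norm (u - v) ≤ l2Norm u + l2Norm v := by
  rw [sub_eq_add_neg, ← l2Norm_neg v]
  exact l2Norm_add_le _ _

lemma l2Norm_smul (t : ℝ) (v : Fin p → ℝ) : l2Norm (t • v) = |t| * l2Norm v := by
  simp only [l2Norm_eq, WithLp.toLp_smul, norm_smul, Real.norm_eq_abs]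

lemma l2Norm_sum_le {ι : Type*} (s : Finset ι) (f : ι → Fin p → ℝ) :
    l2Norm (∑ i ∈ s, f i) ≤ ∑ i ∈ s, l2Norm (f i) :=
  Finset.le_sum_of_subadditive _ l2Norm_zero.le l2Norm_add_le _ _

lemma l2NormSq_smul (t : ℝ) (v : Fin p → ℝ) : l2NormSq (t • v) = t ^ 2 * l2NormSq v := by
  simp [l2NormSq, mul_pow, Finset.mul_sum]

lemma l2NormSq_eq_dotProduct (v : Fin p → ℝ) : l2NormSq v = v ⬝ᵥ v := by
  simp [l2NormSq, dotProduct, sq]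

lemma l2NormSq_add_le (u v : Fin p → ℝ) :
    l2NormSq (u + v) ≤ 2 * l2NormSq u + 2 * l2NormSq v := by
  simp only [l2NormSq, Finset.mul_sum, ← Finset.sum_add_distrib]
  refine Finset.sum_le_sum fun j _ => ?_
  simp only [Pi.add_apply]
  nlinarith [sq_nonneg (u j - v j)]

lemma l2NormSq_le_l1Norm_sq (v : Fin p → ℝ) : l2NormSq v ≤ l1Norm v ^ 2 := by
  have : l2NormSq v = ∑ j, |v j| ^ 2 := by simp [l2NormSq]
  rw [this]
  exact Finset.sum_sq_le_sq_sum_of_nonneg fun _ _ => abs_nonneg _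

lemma l2Norm_le_l1Norm (v : Fin p → ℝ) : l2Norm v ≤ l1Norm v :=
  Real.sqrt_le_iff.2 ⟨l1Norm_nonneg v, l2NormSq_le_l1Norm_sq v⟩

lemma l1On_le_sqrt_card_mul (S : Finset (Fin p)) {s : ℝ} (hs : (S.card : ℝ) ≤ s)
    (v : Fin p → ℝ) : l1On S v ≤ √s * l2Norm v := by
  have h1 : l1On S v ^ 2 ≤ S.card * ∑ j ∈ S, |v j| ^ 2 := sq_sum_le_card_mul_sum_sq
  have h2 : ∑ j ∈ S, |v j| ^ 2 ≤ l2NormSq v := by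
    simp only [sq_abs]
    exact Finset.sum_le_sum_of_subset_of_nonneg (Finset.subset_univ _) fun _ _ _ => sq_nonneg _
  have h3 : l1On S v ^ 2 ≤ s * l2NormSq v := by
    refine h1.trans (mul_le_mul hs h2 (Finset.sum_nonneg fun _ _ => sq_nonneg _) ?_)
    exact (Nat.cast_nonneg _).trans hs
  rw [l2Norm, ← Real.sqrt_mul ((Nat.cast_nonneg _).trans hs)]
  exact Real.le_sqrt_of_sq_le h3

lemma l1Norm_le_sqrt_mul (v : Fin p → ℝ) : l1Norm v ≤ √p * l2Norm v := by
  have := l1On_le_sqrt_card_mul Finset.univ (s := p) (by simp) v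
  simpa [l1On, l1Norm] using this

lemma abs_dotProduct_le {t : ℝ} {z : Fin p → ℝ} (hz : ∀ j, |z j| ≤ t) (v : Fin p → ℝ) :
    |z ⬝ᵥ v| ≤ t * l1Norm v := by
  unfold dotProduct l1Norm
  refine (Finset.abs_sum_le_sum_abs _ _).trans ?_
  rw [Finset.mul_sum]
  refine Finset.sum_le_sum fun j _ => ?_
  rw [abs_mul]
  exact mul_le_mul_of_nonneg_right (hz j) (abs_nonneg _)

lemma dotProduct_le {t : ℝ} {z : Fin p → ℝ} (hz : ∀ j, |z j| ≤ t) (v : Fin p → ℝ) :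
    z ⬝ᵥ v ≤ t * l1Norm v := (le_abs_self _).trans (abs_dotProduct_le hz v)

lemma abs_apply_le_l2Norm (v : Fin p → ℝ) (j : Fin p) : |v j| ≤ l2Norm v := by
  refine Real.abs_le_sqrt ?_
  exact Finset.single_le_sum (f := fun j => v j ^ 2) (fun _ _ => sq_nonneg _) (Finset.mem_univ j)

lemma abs_dotProduct_le_l2Norm (u v : Fin p → ℝ) : |u ⬝ᵥ v| ≤ l2Norm u * l2Norm v := by
  rw [l2Norm, l2Norm, ← Real.sqrt_mul (l2NormSq_nonneg u)]
  refine Real.abs_le_sqrt ?_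
  exact Finset.sum_mul_sq_le_sq_mul_sq _ _ _

/-- The gain in the `ℓ₁` norm when one moves away from a vector supported in `S`. -/
lemma l1Norm_sub_l1Norm_add_le {S : Finset (Fin p)} {β : Fin p → ℝ} (hβ : ∀ j ∉ S, β j = 0)
    (v : Fin p → ℝ) : l1Norm β - l1Norm (β + v) ≤ l1On S v - l1On Sᶜ v := by
  rw [← l1On_add_l1On_compl S β, ← l1On_add_l1On_compl S (β + v)]
  have h1 : l1On S β ≤ l1On S (β + v) + l1On S v := by
    unfold l1On
    rw [← Finset.sum_add_distrib]
    refine Finset.sum_le_sum fun j _ => ?_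
    have := abs_sub (β j + v j) (v j)
    simpa using this
  have h2 : l1On Sᶜ (β + v) = l1On Sᶜ v :=
    Finset.sum_congr rfl fun j hj => by simp [hβ j (by simpa using hj)]
  have h3 : l1On Sᶜ β = 0 :=
    Finset.sum_eq_zero fun j hj => by simp [hβ j (by simpa using hj)]
  linarith

lemma exists_support_finset (β : Fin p → ℝ) :
    ∃ S : Finset (Fin p), S.card = l0Norm β ∧ ∀ j ∉ S, β j = 0 := by
  classical
  refine ⟨Finset.univ.filter fun j => β j ≠ 0, ?_, fun j hj => by simpa using hj⟩
  rw [l0Norm, ← Set.ncard_coe_finset]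
  simp

end Norms

/-! ### First-order conditions for penalized quadratic programs -/

section FirstOrder

variable {p : ℕ}

/-- Variational inequality satisfied by a minimizer of a convex penalized quadratic function. -/
lemma dotProduct_sub_le_of_isMin {Q : LinearMap.BilinForm ℝ (Fin p → ℝ)}
    (hs : ∀ u v, Q u v = Q v u) {z o : Fin p → ℝ} {R : (Fin p → ℝ) → ℝ}
    (hR : ∀ x v, ∀ t : ℝ, 0 < t → t ≤ 1 → R (x + t • v) ≤ (1 - t) * R x + t * R (x + v))
    (hmin : ∀ w, 1 / 2 * Q o o - z ⬝ᵥ o + R o ≤ 1 / 2 * Q w w - z ⬝ᵥ w + R w)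
    (v : Fin p → ℝ) : z ⬝ᵥ v - Q o v ≤ R (o + v) - R o := by
  -- Minimality at o + t v, divided by t, leaves a defect of order t, which a small explicit t
  -- contradicts below.
  have key : ∀ t : ℝ, 0 < t → t ≤ 1 →
      z ⬝ᵥ v - Q o v - (R (o + v) - R o) ≤ t * (1 / 2 * Q v v) := by
    intro t ht ht1
    have h1 := hmin (o + t • v)
    have h2 := hR o v t ht ht1
    simp only [map_add, map_smul, LinearMap.add_apply, LinearMap.smul_apply, smul_eq_mul,
      dotProduct_add, dotProduct_smul, hs v o] at h1
    have h3 : t * (z ⬝ᵥ v - Q o v - (R (o + v) - R o)) ≤ t * (t * (1 / 2 * Q v v)) := by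
      nlinarith
    exact le_of_mul_le_mul_left h3 ht
  by_contra hcon
  push Not at hcon
  set d := z ⬝ᵥ v - Q o v - (R (o + v) - R o) with hd
  have hd0 : 0 < d := by rw [hd]; linarith
  rcases le_or_gt (1 / 2 * Q v v) 0 with hq | hq
  · have := key 1 one_pos le_rfl
    linarith
  · have hm : 0 < min 1 (d / (2 * (1 / 2 * Q v v))) := by positivity
    have := key _ hm (min_le_left _ _)
    have h4 : min 1 (d / (2 * (1 / 2 * Q v v))) * (1 / 2 * Q v v) ≤ d / 2 := by
      refine (mul_le_mul_of_nonneg_right (min_le_right _ _) hq.le).trans (le_of_eq ?_)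
      have hq0 : Q v v ≠ 0 := by intro h; simp [h] at hq
      field_simp
    linarith

lemma l1Norm_add_smul_le (x v : Fin p → ℝ) {t : ℝ} (ht : 0 < t) (ht1 : t ≤ 1) :
    l1Norm (x + t • v) ≤ (1 - t) * l1Norm x + t * l1Norm (x + v) := by
  have h : x + t • v = (1 - t) • x + t • (x + v) := by
    ext j; simp only [Pi.add_apply, Pi.smul_apply, smul_eq_mul]; ring
  rw [h]
  refine (l1Norm_add_le _ _).trans (le_of_eq ?_)
  rw [l1Norm_smul, l1Norm_smul, abs_of_nonneg (by linarith), abs_of_pos ht]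

/-- Two solutions of shifted lasso programs with the same data differ by at most the shift. -/
lemma quadratic_sub_le_of_variational {Q : LinearMap.BilinForm ℝ (Fin p → ℝ)}
    (hs : ∀ u v, Q u v = Q v u) (hn : ∀ u, 0 ≤ Q u u) {z o x γ : Fin p → ℝ}
    {lam : ℝ} (ho : ∀ v, z ⬝ᵥ v - Q o v ≤ lam * (l1Norm (o + v) - l1Norm o))
    (hx : ∀ v, z ⬝ᵥ v - Q x v ≤ lam * (l1Norm (x + γ + v) - l1Norm (x + γ))) :
    Q (x - o) (x - o) ≤ Q γ γ := by
  -- Each program is tested at the other's solution. With d = x - o the penalties cancel in the sum,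
  -- leaving Q(d, d + γ) ≤ 0; then Q(d + γ, d + γ) ≥ 0 gives Q(d, d) ≤ Q(γ, γ).
  have h1 := ho (x + γ - o)
  have h2 := hx (o - (x + γ))
  have h3 := hn (x - o + γ)
  rw [show o + (x + γ - o) = x + γ by abel] at h1
  rw [show x + γ + (o - (x + γ)) = o by abel] at h2
  simp only [map_add, map_sub, LinearMap.add_apply, LinearMap.sub_apply, dotProduct_add,
    dotProduct_sub, hs x o, hs γ o, hs γ x] at *
  linarith

end FirstOrder

/-! ### Restricted eigenvalues -/

section RestrictedEigenvalue

variable {p : ℕ}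

/-- Two-sided restricted eigenvalue condition with constant `A ^ 2` and slack `t ^ 2 ‖u‖₁²`. -/
def RestrictedEigenvalue (A t : ℝ) (Q : LinearMap.BilinForm ℝ (Fin p → ℝ)) : Prop :=
  ∀ u, l2NormSq u ≤ A ^ 2 * (Q u u + t ^ 2 * l1Norm u ^ 2) ∧
    Q u u ≤ A ^ 2 * (l2NormSq u + t ^ 2 * l1Norm u ^ 2)

lemma sqrt_add_sq_le {x y : ℝ} (hx : 0 ≤ x) (hy : 0 ≤ y) : √(x + y ^ 2) ≤ √x + y := by
  refine Real.sqrt_le_iff.2 ⟨by positivity, ?_⟩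
  nlinarith [Real.sq_sqrt hx, Real.sqrt_nonneg x, mul_nonneg (Real.sqrt_nonneg x) hy]

variable {A t : ℝ} {Q : LinearMap.BilinForm ℝ (Fin p → ℝ)}

lemma RestrictedEigenvalue.l2Norm_le (h : RestrictedEigenvalue A t Q) (hA : 0 ≤ A) (ht : 0 ≤ t)
    (hn : ∀ u, 0 ≤ Q u u) (u : Fin p → ℝ) : l2Norm u ≤ A * (√(Q u u) + t * l1Norm u) := by
  have h0 := mul_nonneg ht (l1Norm_nonneg u)
  calc l2Norm u ≤ √(A ^ 2 * (Q u u + (t * l1Norm u) ^ 2)) :=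
        Real.sqrt_le_sqrt (by rw [mul_pow]; exact (h u).1)
    _ = A * √(Q u u + (t * l1Norm u) ^ 2) := by
        rw [Real.sqrt_mul (sq_nonneg _), Real.sqrt_sq hA]
    _ ≤ _ := mul_le_mul_of_nonneg_left (sqrt_add_sq_le (hn u) h0) hA

lemma RestrictedEigenvalue.sqrt_le (h : RestrictedEigenvalue A t Q) (hA : 0 ≤ A) (ht : 0 ≤ t)
    (u : Fin p → ℝ) : √(Q u u) ≤ A * (l2Norm u + t * l1Norm u) := by
  have h0 := mul_nonneg ht (l1Norm_nonneg u)
  calc √(Q u u) ≤ √(A ^ 2 * (l2NormSq u + (t * l1Norm u) ^ 2)) :=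
        Real.sqrt_le_sqrt (by rw [mul_pow]; exact (h u).2)
    _ = A * √(l2NormSq u + (t * l1Norm u) ^ 2) := by
        rw [Real.sqrt_mul (sq_nonneg _), Real.sqrt_sq hA]
    _ ≤ _ := mul_le_mul_of_nonneg_left (sqrt_add_sq_le (l2NormSq_nonneg u) h0) hA

/-- Cauchy–Schwarz for a semidefinite form, from the discriminant of x ↦ Q(u + x v, u + x v). -/
lemma abs_bilin_le_sqrt_mul_sqrt (hs : ∀ u v, Q u v = Q v u) (hn : ∀ u, 0 ≤ Q u u)
    (u v : Fin p → ℝ) : |Q u v| ≤ √(Q u u) * √(Q v v) := by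
  rw [← Real.sqrt_mul (hn u)]
  refine Real.abs_le_sqrt ?_
  have h : ∀ x : ℝ, 0 ≤ Q v v * (x * x) + 2 * Q u v * x + Q u u := by
    intro x
    have := hn (u + x • v)
    simp only [map_add, map_smul, LinearMap.add_apply, LinearMap.smul_apply, smul_eq_mul,
      hs v u] at this
    linarith
  have := discrim_le_zero h
  unfold discrim at this
  nlinarith

lemma abs_bilin_le_l1Norm_mul {B : ℝ} (v w : Fin p → ℝ)
    (hB : ∀ j, |Q (Pi.single j 1) w| ≤ B) : |Q v w| ≤ l1Norm v * B := by
  have h1 : Q v w = ∑ j, v j * Q (Pi.single j 1) w := by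
    conv_lhs => rw [pi_eq_sum_univ' v]
    simp [map_sum, LinearMap.sum_apply]
  rw [h1, l1Norm, Finset.sum_mul]
  refine (Finset.abs_sum_le_sum_abs _ _).trans (Finset.sum_le_sum fun j _ => ?_)
  rw [abs_mul]
  exact mul_le_mul_of_nonneg_left (hB j) (abs_nonneg _)

lemma l1Norm_single (j : Fin p) (x : ℝ) : l1Norm (Pi.single j x) = |x| := by
  unfold l1Norm
  rw [Finset.sum_eq_single j (fun i _ h => by simp [h]) (by simp)]
  simp

lemma l2NormSq_single (j : Fin p) (x : ℝ) : l2NormSq (Pi.single j x) = x ^ 2 := by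
  unfold l2NormSq
  rw [Finset.sum_eq_single j (fun i _ h => by simp [h]) (by simp)]
  simp

/-- Expand v in coordinates and apply Cauchy–Schwarz to each Q(e_j, w), where √Q(e_j, e_j) ≤ 2A.
Only the ℓ₁ norm of v enters, which is all that is known about the heterogeneity of the tasks. -/
lemma RestrictedEigenvalue.abs_bilin_le (h : RestrictedEigenvalue A t Q) (hA : 0 ≤ A)
    (ht : 0 ≤ t) (ht1 : t ≤ 1) (hs : ∀ u v, Q u v = Q v u) (hn : ∀ u, 0 ≤ Q u u)
    (v w : Fin p → ℝ) :
    |Q v w| ≤ l1Norm v * (2 * A ^ 2 * (l2Norm w + t * l1Norm w)) := by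
  refine abs_bilin_le_l1Norm_mul v w fun j => ?_
  refine (abs_bilin_le_sqrt_mul_sqrt hs hn _ _).trans ?_
  have h1 := h.sqrt_le hA ht (Pi.single j 1)
  have h2 := h.sqrt_le hA ht w
  have h3 : l2Norm (Pi.single j (1 : ℝ) : Fin p → ℝ) = 1 := by simp [l2Norm, l2NormSq_single]
  rw [h3, l1Norm_single, abs_one, mul_one] at h1
  have h4 := mul_nonneg ht (l1Norm_nonneg w)
  have h5 := l2Norm_nonneg w
  have h6 : √(Q (Pi.single j 1) (Pi.single j 1)) ≤ 2 * A := by nlinarith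
  calc _ ≤ (2 * A) * (A * (l2Norm w + t * l1Norm w)) :=
        mul_le_mul h6 h2 (Real.sqrt_nonneg _) (by positivity)
    _ = _ := by ring

end RestrictedEigenvalue

/-! ### Deterministic analysis of the co-training program -/

section CoTraining

variable {p K : ℕ}

/-- The co-training objective, up to an additive constant, in terms of Gram forms `Q`, score
vectors `z` and centers `β`. -/
noncomputable def recenteredObjective (Q : Fin (K + 1) → LinearMap.BilinForm ℝ (Fin p → ℝ))
    (z β : Fin (K + 1) → Fin p → ℝ) (wt : Fin (K + 1) → ℝ) (lam0 lam : ℝ)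
    (b : Fin (K + 1) → Fin p → ℝ) : ℝ :=
  ∑ k, wt k * (1 / 2 * Q k (b k - β k) (b k - β k) - z k ⬝ᵥ (b k - β k))
    + lam0 * l1Norm (b 0) + ∑ k, wt k * (lam * l1Norm (b k - b 0))

/-- A minimizer `b` of the recentered objective on the event where the scores are dominated by the
penalty. The tasks in `G` satisfy the penalty domination with a margin. -/
structure RecenteredMinimizer (Q : Fin (K + 1) → LinearMap.BilinForm ℝ (Fin p → ℝ))
    (z β : Fin (K + 1) → Fin p → ℝ) (wt h : Fin (K + 1) → ℝ) (lam0 lam : ℝ)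
    (S : Finset (Fin p)) (G : Finset (Fin (K + 1))) (b : Fin (K + 1) → Fin p → ℝ) : Prop where
  symm : ∀ k u v, Q k u v = Q k v u
  nonneg : ∀ k u, 0 ≤ Q k u u
  wt_nonneg : ∀ k, 0 ≤ wt k
  wt_sum : ∑ k, wt k = 1
  h_nonneg : ∀ k, 0 ≤ h k
  support : ∀ j ∉ S, β 0 j = 0
  lam0_nonneg : 0 ≤ lam0
  score : ∀ j, |(∑ k, wt k • z k) j| ≤ lam0 / 2
  penalty : ∀ k, z k ⬝ᵥ (b k - β k - (b 0 - β 0)) +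
    lam * (l1Norm (β k - β 0) - l1Norm (b k - b 0)) ≤ 2 * lam * h k -
      if k ∈ G then lam / 2 * l1Norm (b k - β k - (b 0 - β 0)) else 0
  isMin : ∀ b', recenteredObjective Q z β wt lam0 lam b ≤ recenteredObjective Q z β wt lam0 lam b'

namespace RecenteredMinimizer

variable {Q : Fin (K + 1) → LinearMap.BilinForm ℝ (Fin p → ℝ)}
  {z β : Fin (K + 1) → Fin p → ℝ} {wt h : Fin (K + 1) → ℝ} {lam0 lam : ℝ}
  {S : Finset (Fin p)} {G : Finset (Fin (K + 1))} {b : Fin (K + 1) → Fin p → ℝ}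

lemma score_le (H : RecenteredMinimizer Q z β wt h lam0 lam S G b) (u : Fin p → ℝ) :
    ∑ k, wt k * (z k ⬝ᵥ u) ≤ lam0 / 2 * (l1On S u + l1On Sᶜ u) := by
  rw [l1On_add_l1On_compl]
  refine le_trans (le_of_eq ?_) (dotProduct_le H.score u)
  rw [sum_dotProduct]
  simp [smul_dotProduct]

/-- Comparison of the minimizer with the centers. -/
lemma basic_inequality (H : RecenteredMinimizer Q z β wt h lam0 lam S G b) :
    1 / 2 * ∑ k, wt k * Q k (b k - β k) (b k - β k)
      + lam / 2 * ∑ k ∈ G, wt k * l1Norm (b k - β k - (b 0 - β 0))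
      + lam0 / 2 * l1On Sᶜ (b 0 - β 0)
    ≤ 3 / 2 * lam0 * l1On S (b 0 - β 0) + 2 * lam * ∑ k, wt k * h k := by
  have h1 := H.isMin β
  simp only [recenteredObjective, sub_self, map_zero, dotProduct_zero, mul_zero,
    Finset.sum_const_zero, zero_add] at h1
  have h2 := l1Norm_sub_l1Norm_add_le H.support (b 0 - β 0)
  rw [add_sub_cancel] at h2
  have h3 := H.score_le (b 0 - β 0)
  -- Each z k is tested on the deviation of its task from b 0 - β 0, where the heterogeneity penalty
  -- absorbs it; b 0 - β 0 itself meets only the pooled score.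
  have h4 : ∑ k, wt k * (z k ⬝ᵥ (b k - β k - (b 0 - β 0)) +
      lam * (l1Norm (β k - β 0) - l1Norm (b k - b 0))) ≤ ∑ k, wt k * (2 * lam * h k -
      if k ∈ G then lam / 2 * l1Norm (b k - β k - (b 0 - β 0)) else 0) :=
    Finset.sum_le_sum fun k _ => mul_le_mul_of_nonneg_left (H.penalty k) (H.wt_nonneg k)
  have h5 : ∑ k, wt k * (2 * lam * h k -
      if k ∈ G then lam / 2 * l1Norm (b k - β k - (b 0 - β 0)) else 0) =
      2 * lam * ∑ k, wt k * h k
        - lam / 2 * ∑ k ∈ G, wt k * l1Norm (b k - β k - (b 0 - β 0)) := by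
    simp only [mul_sub, Finset.sum_sub_distrib, mul_ite, mul_zero, Finset.sum_ite_mem,
      Finset.univ_inter, Finset.mul_sum]
    congr 1 <;> exact Finset.sum_congr rfl fun k _ => by ring
  have h6 : ∑ k, wt k * (z k ⬝ᵥ (b k - β k - (b 0 - β 0)) +
      lam * (l1Norm (β k - β 0) - l1Norm (b k - b 0))) =
      ∑ k, wt k * (z k ⬝ᵥ (b k - β k)) - ∑ k, wt k * (z k ⬝ᵥ (b 0 - β 0))
      + ∑ k, wt k * (lam * l1Norm (β k - β 0)) - ∑ k, wt k * (lam * l1Norm (b k - b 0)) := by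
    rw [← Finset.sum_sub_distrib, ← Finset.sum_add_distrib, ← Finset.sum_sub_distrib]
    refine Finset.sum_congr rfl fun k _ => ?_
    rw [dotProduct_sub (z k) (b k - β k)]
    ring
  have h7 : ∑ k, wt k * (1 / 2 * Q k (b k - β k) (b k - β k) - z k ⬝ᵥ (b k - β k)) =
      1 / 2 * ∑ k, wt k * Q k (b k - β k) (b k - β k) - ∑ k, wt k * (z k ⬝ᵥ (b k - β k)) := by
    rw [Finset.mul_sum, ← Finset.sum_sub_distrib]
    exact Finset.sum_congr rfl fun k _ => by ring
  have h8 := mul_le_mul_of_nonneg_left h2 H.lam0_nonneg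
  linarith

/-- Comparison of the minimizer with its translate by `-(b 0 - β 0)`. -/
lemma translation_inequality (H : RecenteredMinimizer Q z β wt h lam0 lam S G b) :
    1 / 2 * ∑ k, wt k * Q k (b 0 - β 0) (b 0 - β 0)
      + ∑ k, wt k * Q k (b k - β k - (b 0 - β 0)) (b 0 - β 0)
    ≤ 3 / 2 * lam0 * l1On S (b 0 - β 0) := by
  -- A common translation keeps every b k - b 0, so the heterogeneity penalty, and with it h, drops
  -- out of the comparison.
  have h1 := H.isMin fun k => b k - (b 0 - β 0)
  simp only [recenteredObjective] at h1
  have h2 := l1Norm_sub_l1Norm_add_le H.support (b 0 - β 0)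
  rw [add_sub_cancel] at h2
  have h3 := H.score_le (b 0 - β 0)
  have h4 : ∀ k, b k - (b 0 - β 0) - β 0 = b k - b 0 := fun k => by abel
  have h5 : b 0 - (b 0 - β 0) = β 0 := by abel
  simp only [h5, h4] at h1
  have h7 : ∑ k, wt k * (1 / 2 * Q k (b k - β k) (b k - β k) - z k ⬝ᵥ (b k - β k))
      - ∑ k, wt k * (1 / 2 * Q k (b k - (b 0 - β 0) - β k) (b k - (b 0 - β 0) - β k)
          - z k ⬝ᵥ (b k - (b 0 - β 0) - β k)) =
      1 / 2 * ∑ k, wt k * Q k (b 0 - β 0) (b 0 - β 0)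
      + ∑ k, wt k * Q k (b k - β k - (b 0 - β 0)) (b 0 - β 0)
      - ∑ k, wt k * (z k ⬝ᵥ (b 0 - β 0)) := by
    rw [Finset.mul_sum, ← Finset.sum_sub_distrib, ← Finset.sum_add_distrib,
      ← Finset.sum_sub_distrib]
    refine Finset.sum_congr rfl fun k _ => ?_
    rw [show b k - (b 0 - β 0) - β k = b k - β k - (b 0 - β 0) by abel]
    generalize b 0 - β 0 = x
    generalize b k - β k = y
    simp only [map_sub, LinearMap.sub_apply, dotProduct_sub, H.symm k x y]
    ring
  have h8 := mul_le_mul_of_nonneg_left h2 H.lam0_nonneg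
  have h9 := mul_nonneg H.lam0_nonneg (l1On_nonneg Sᶜ (b 0 - β 0))
  linarith

end RecenteredMinimizer

end CoTraining

/-! ### Restricted eigenvalues averaged over the tasks -/

section CoTrainingBounds

variable {p K : ℕ}

/-- Jensen's inequality for the square root, in the form of Cauchy–Schwarz. -/
lemma sum_mul_sqrt_le {ι : Type*} [Fintype ι] {w q : ι → ℝ} (hw : ∀ k, 0 ≤ w k)
    (hsum : ∑ k, w k = 1) (hq : ∀ k, 0 ≤ q k) : ∑ k, w k * √(q k) ≤ √(∑ k, w k * q k) := by
  refine Real.le_sqrt_of_sq_le ?_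
  have h := Finset.sum_sq_le_sum_mul_sum_of_sq_le_mul Finset.univ (r := fun k => w k * √(q k))
    (f := w) (g := fun k => w k * q k) (fun k _ => hw k) (fun k _ => mul_nonneg (hw k) (hq k))
    (fun k _ => le_of_eq (by rw [mul_pow, Real.sq_sqrt (hq k)]; ring))
  rwa [hsum, one_mul] at h

namespace RecenteredMinimizer

variable {Q : Fin (K + 1) → LinearMap.BilinForm ℝ (Fin p → ℝ)}
  {z β : Fin (K + 1) → Fin p → ℝ} {wt h : Fin (K + 1) → ℝ} {lam0 lam : ℝ}
  {S : Finset (Fin p)} {G : Finset (Fin (K + 1))} {b : Fin (K + 1) → Fin p → ℝ}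

lemma sum_smul_sub (H : RecenteredMinimizer Q z β wt h lam0 lam S G b) :
    ∑ k, wt k • (b k - β k) = (b 0 - β 0) + ∑ k, wt k • (b k - β k - (b 0 - β 0)) := by
  have : ∑ k, wt k • (b k - β k) = ∑ k, (wt k • (b 0 - β 0)
      + wt k • (b k - β k - (b 0 - β 0))) :=
    Finset.sum_congr rfl fun k _ => by rw [← smul_add, add_sub_cancel]
  rw [this, Finset.sum_add_distrib, ← Finset.sum_smul, H.wt_sum, one_smul]

lemma l1Norm_sum_smul_le (H : RecenteredMinimizer Q z β wt h lam0 lam S G b)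
    (v : Fin (K + 1) → Fin p → ℝ) :
    l1Norm (∑ k, wt k • v k) ≤ ∑ k, wt k * l1Norm (v k) := by
  refine (l1Norm_sum_le _ _).trans (le_of_eq (Finset.sum_congr rfl fun k _ => ?_))
  rw [l1Norm_smul, abs_of_nonneg (H.wt_nonneg k)]

lemma l2Norm_sum_smul_le (H : RecenteredMinimizer Q z β wt h lam0 lam S G b)
    (v : Fin (K + 1) → Fin p → ℝ) :
    l2Norm (∑ k, wt k • v k) ≤ ∑ k, wt k * l2Norm (v k) := by
  refine (l2Norm_sum_le _ _).trans (le_of_eq (Finset.sum_congr rfl fun k _ => ?_))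
  rw [l2Norm_smul, abs_of_nonneg (H.wt_nonneg k)]

lemma sum_compl_split (wt : Fin (K + 1) → ℝ) (G : Finset (Fin (K + 1)))
    (v : Fin (K + 1) → Fin p → ℝ) :
    ∑ k, wt k * l1Norm (v k) =
      ∑ k ∈ G, wt k * l1Norm (v k) + ∑ k ∈ Gᶜ, wt k * l1Norm (v k) :=
  (Finset.sum_add_sum_compl G _).symm

section

variable {A τ : ℝ} {t : Fin (K + 1) → ℝ}

/-- The slack of the target task may exceed τ, but it enters only multiplied by the target weight.
-/
lemma sum_mul_slack_le (H : RecenteredMinimizer Q z β wt h lam0 lam S G b)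
    (ht : ∀ k, k ≠ 0 → t k = τ) (ht0 : wt 0 * t 0 ≤ τ) (hτ : 0 ≤ τ) :
    ∑ k, wt k * t k ≤ 2 * τ := by
  have h1 : ∀ k, wt k * t k ≤ wt k * τ + if k = 0 then τ else 0 := by
    intro k
    by_cases hk : k = 0
    · subst hk
      have := mul_nonneg (H.wt_nonneg 0) hτ
      simp only [if_true]; linarith
    · simp [hk, ht k hk]
  refine (Finset.sum_le_sum fun k _ => h1 k).trans (le_of_eq ?_)
  rw [Finset.sum_add_distrib, ← Finset.sum_mul, H.wt_sum]
  simp; ring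

/-- Deviations from task 0 vanish at task 0, so the possibly larger slack of the target plays no
role. -/
lemma sum_mul_slack_l1Norm_le
    (ht : ∀ k, k ≠ 0 → t k = τ) {v : Fin (K + 1) → Fin p → ℝ} (hv : v 0 = 0) :
    ∑ k, wt k * (t k * l1Norm (v k)) = τ * ∑ k, wt k * l1Norm (v k) := by
  rw [Finset.mul_sum]
  refine Finset.sum_congr rfl fun k _ => ?_
  by_cases hk : k = 0
  · subst hk; simp [hv, l1Norm_zero]
  · rw [ht k hk]; ring

/-- Restricted eigenvalues turn the prediction error into an `ℓ₂` bound for the average. -/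
lemma l2Norm_average_le (H : RecenteredMinimizer Q z β wt h lam0 lam S G b) (hA : 0 ≤ A)
    (hτ : 0 ≤ τ) (ht_nonneg : ∀ k, 0 ≤ t k) (ht : ∀ k, k ≠ 0 → t k = τ) (ht0 : wt 0 * t 0 ≤ τ)
    (hRE : ∀ k, RestrictedEigenvalue A (t k) (Q k)) :
    l2Norm (∑ k, wt k • (b k - β k)) ≤ A * (√(∑ k, wt k * Q k (b k - β k) (b k - β k))
      + τ * (2 * l1Norm (b 0 - β 0) + ∑ k, wt k * l1Norm (b k - β k - (b 0 - β 0)))) := by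
  have h1 : ∀ k, wt k * l2Norm (b k - β k) ≤
      A * (wt k * √(Q k (b k - β k) (b k - β k)) + (wt k * t k * l1Norm (b 0 - β 0)
        + wt k * (t k * l1Norm (b k - β k - (b 0 - β 0))))) := by
    intro k
    have h2 := (hRE k).l2Norm_le hA (ht_nonneg k) (H.nonneg k) (b k - β k)
    have h3 := l1Norm_add_le (b 0 - β 0) (b k - β k - (b 0 - β 0))
    rw [add_sub_cancel] at h3
    have h4 := mul_le_mul_of_nonneg_left h3 (ht_nonneg k)
    have h5 : l2Norm (b k - β k) ≤ A * (√(Q k (b k - β k) (b k - β k)) +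
        t k * (l1Norm (b 0 - β 0) + l1Norm (b k - β k - (b 0 - β 0)))) := by
      refine h2.trans (mul_le_mul_of_nonneg_left ?_ hA)
      linarith
    refine (mul_le_mul_of_nonneg_left h5 (H.wt_nonneg k)).trans (le_of_eq ?_)
    ring
  refine (H.l2Norm_sum_smul_le _).trans ((Finset.sum_le_sum fun k _ => h1 k).trans ?_)
  rw [← Finset.mul_sum, Finset.sum_add_distrib, Finset.sum_add_distrib, ← Finset.sum_mul,
    sum_mul_slack_l1Norm_le ht (by simp)]
  refine mul_le_mul_of_nonneg_left ?_ hA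
  have h6 := sum_mul_sqrt_le H.wt_nonneg H.wt_sum
    (fun k => H.nonneg k (b k - β k))
  have h7 := mul_le_mul_of_nonneg_right (H.sum_mul_slack_le ht ht0 hτ) (l1Norm_nonneg (b 0 - β 0))
  linarith

/-- For a vector common to all tasks, the restricted eigenvalue conditions average to one for the
pooled form, with slack 2τ. -/
lemma l2Norm_target_le (H : RecenteredMinimizer Q z β wt h lam0 lam S G b) (hA : 0 ≤ A)
    (hτ : 0 ≤ τ) (ht_nonneg : ∀ k, 0 ≤ t k) (ht : ∀ k, k ≠ 0 → t k = τ) (ht0 : wt 0 * t 0 ≤ τ)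
    (hRE : ∀ k, RestrictedEigenvalue A (t k) (Q k)) (u : Fin p → ℝ) :
    l2Norm u ≤ A * (√(∑ k, wt k * Q k u u) + 2 * τ * l1Norm u) := by
  have h1 : ∀ k, wt k * l2Norm u ≤ A * (wt k * √(Q k u u) + wt k * t k * l1Norm u) := by
    intro k
    have h2 := (hRE k).l2Norm_le hA (ht_nonneg k) (H.nonneg k) u
    refine (mul_le_mul_of_nonneg_left h2 (H.wt_nonneg k)).trans (le_of_eq ?_)
    ring
  have h2 := Finset.sum_le_sum fun k (_ : k ∈ Finset.univ) => h1 k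
  rw [← Finset.sum_mul, H.wt_sum, one_mul, ← Finset.mul_sum, Finset.sum_add_distrib,
    ← Finset.sum_mul] at h2
  refine h2.trans (mul_le_mul_of_nonneg_left ?_ hA)
  have h6 := sum_mul_sqrt_le H.wt_nonneg H.wt_sum (fun k => H.nonneg k u)
  have h7 := mul_le_mul_of_nonneg_right (H.sum_mul_slack_le ht ht0 hτ) (l1Norm_nonneg u)
  linarith

/-- Controls the mixed terms of `translation_inequality` when the deviations v k are known only in
ℓ₁ norm. -/
lemma cross_term_ge (H : RecenteredMinimizer Q z β wt h lam0 lam S G b) (hA : 0 ≤ A)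
    (hτ : 0 ≤ τ) (hτ1 : τ ≤ 1) (ht : ∀ k, k ≠ 0 → t k = τ)
    (hRE : ∀ k, RestrictedEigenvalue A (t k) (Q k)) {v : Fin (K + 1) → Fin p → ℝ} (hv : v 0 = 0)
    (u : Fin p → ℝ) :
    -((∑ k, wt k * l1Norm (v k)) * (2 * A ^ 2 * (l2Norm u + τ * l1Norm u)))
      ≤ ∑ k, wt k * Q k (v k) u := by
  rw [Finset.sum_mul, ← Finset.sum_neg_distrib]
  refine Finset.sum_le_sum fun k _ => ?_
  by_cases hk : k = 0
  · subst hk; simp [hv, l1Norm_zero]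
  · have h1 := hRE k
    rw [ht k hk] at h1
    have h2 := h1.abs_bilin_le hA hτ hτ1 (H.symm k) (H.nonneg k) (v k) u
    have h3 := (abs_le.1 h2).1
    have h4 := mul_le_mul_of_nonneg_left h3 (H.wt_nonneg k)
    linarith

end

end RecenteredMinimizer

end CoTrainingBounds

/-! ### Scalar inequalities behind the rates -/

section RateArithmetic

variable {c0 τ g A s x y hb P aG aB N2 R1 R2 ρ : ℝ}

/-- Dictionary: x and y are the ℓ₁ norms of b 0 - β 0 on and off S, N2 is its ℓ₂ norm, P the
averaged prediction error, aG and aB the weighted heterogeneity on G and off G, hb the mean shift,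
R1 and R2 the ℓ₁ and ℓ₂ errors of the average. When the support term beats the shift, all other
terms are multiples of x, and the loop P ≲ τ g x, x ≲ √s R2, R2 ≲ √P closes to √P ≲ τ g √s. -/
lemma rate_of_sparse_dominant (hc0 : 0 < c0) (hτ : 0 < τ) (hg : 0 < g) (hg1 : g ≤ 1)
    (hA : 1 ≤ A) (hx : 0 ≤ x) (hP : 0 ≤ P) (hy : 0 ≤ y)
    (haG : 0 ≤ aG) (hρ0 : 0 ≤ ρ) (hρ : ρ ≤ 1 / 24)
    (h1 : 1 / 2 * P + 4 * c0 * τ * aG + 1 / 2 * (c0 * τ * g) * y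
      ≤ 3 / 2 * (c0 * τ * g) * x + 16 * c0 * τ * hb)
    (h2 : aB ≤ ρ * (hb + N2)) (hN : N2 ≤ x + y)
    (h3 : x ≤ √s * R2 + (aG + aB))
    (h4 : R2 ≤ A * (√P + τ * (2 * (x + y) + (aG + aB))))
    (h5 : 88 * A * √s * τ ≤ 1) (hR1 : R1 ≤ x + y + (aG + aB)) (hcase : 32 * hb ≤ g * x) :
    R2 ≤ 64 * c0 * A ^ 2 * (τ * g * √s) ∧ R1 ≤ 1536 * c0 * A ^ 2 * (τ * g * √s ^ 2) := by
  have hcτ : 0 < c0 * τ := mul_pos hc0 hτ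
  have hcτg : 0 < c0 * τ * g := mul_pos hcτ hg
  have hss := Real.sqrt_nonneg s
  have hPs := Real.sqrt_nonneg P
  have hsP := Real.sq_sqrt hP
  have hhb2 : 16 * c0 * τ * hb ≤ 1 / 2 * (c0 * τ * g) * x := by
    have := mul_le_mul_of_nonneg_left hcase hcτ.le
    nlinarith
  have h4A : 0 ≤ 4 * c0 * τ * aG := by positivity
  have h4y : 0 ≤ 1 / 2 * (c0 * τ * g) * y := by positivity
  have hy4 : y ≤ 4 * x := by
    refine le_of_mul_le_mul_left ?_ hcτg
    linarith
  have haGx : aG ≤ x / 2 := by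
    have : aG ≤ g * x / 2 := by
      refine le_of_mul_le_mul_left ?_ hcτ
      linarith
    nlinarith
  have hP4 : P ≤ 4 * (c0 * τ * g) * x := by linarith
  have hbx : hb ≤ x / 32 := by nlinarith
  have haB : aB ≤ x / 4 := by
    have : ρ * (hb + N2) ≤ 1 / 24 * (x / 32 + 5 * x) := by
      calc ρ * (hb + N2) ≤ ρ * (x / 32 + 5 * x) :=
            mul_le_mul_of_nonneg_left (by linarith) hρ0
        _ ≤ _ := mul_le_mul_of_nonneg_right hρ (by linarith)
    linarith
  have hR2 : R2 ≤ A * √P + 11 * A * τ * x := by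
    refine h4.trans ?_
    have : A * τ * (2 * (x + y) + (aG + aB)) ≤ A * τ * (11 * x) :=
      mul_le_mul_of_nonneg_left (by linarith) (by positivity)
    linarith
  have hxs : x / 4 ≤ √s * R2 := by linarith
  -- The slack 11 A τ x, multiplied by √s, uses x/8 of the available x/4; this is the origin of 88 =
  -- 8 · 11.
  have hx8 : x ≤ 8 * A * √s * √P := by
    have h6 := mul_le_mul_of_nonneg_left hR2 hss
    have h7 : 88 * A * √s * τ * x ≤ 1 * x := mul_le_mul_of_nonneg_right h5 hx
    nlinarith
  have hPr : √P ≤ 32 * c0 * A * (τ * g * √s) := by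
    rcases hPs.eq_or_lt with h0 | h0
    · rw [← h0]; positivity
    · have h6 := mul_le_mul_of_nonneg_left hx8 (by positivity : 0 ≤ 4 * (c0 * τ * g))
      refine le_of_mul_le_mul_right ?_ h0
      nlinarith
  have hR2' : R2 ≤ 2 * A * √P := by
    have h6 := mul_le_mul_of_nonneg_left hx8 (by positivity : 0 ≤ 11 * A * τ)
    have h7 := mul_le_mul_of_nonneg_right h5 (by positivity : 0 ≤ A * √P)
    nlinarith
  constructor
  · have := mul_le_mul_of_nonneg_left hPr (by positivity : 0 ≤ 2 * A)
    linarith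
  · have h6 := mul_le_mul_of_nonneg_left hPr (by positivity : 0 ≤ 48 * A * √s)
    have h7 : R1 ≤ 6 * x := by linarith
    calc R1 ≤ 48 * A * √s * √P := by linarith
      _ ≤ 48 * A * √s * (32 * c0 * A * (τ * g * √s)) := h6
      _ = _ := by ring

/-- Here the right-hand side of `h1` is of order τ hb. The bound on x + y pays a factor 1/g because
the penalty on the target is smaller by the factor g. -/
lemma rate_of_shift_dominant (hc0 : 0 < c0) (hτ : 0 < τ) (hg : 0 < g) (hP : 0 ≤ P) (hy : 0 ≤ y)
    (haG : 0 ≤ aG)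
    (h1 : 1 / 2 * P + 4 * c0 * τ * aG + 1 / 2 * (c0 * τ * g) * y
      ≤ 3 / 2 * (c0 * τ * g) * x + 16 * c0 * τ * hb)
    (hcase : g * x ≤ 32 * hb) :
    P ≤ 128 * c0 * (τ * hb) ∧ aG ≤ 16 * hb ∧ x + y ≤ 160 * (hb / g) := by
  have hcτ : 0 < c0 * τ := mul_pos hc0 hτ
  have hcτg : 0 < c0 * τ * g := mul_pos hcτ hg
  have hhb2 : 3 / 2 * (c0 * τ * g) * x ≤ 48 * (c0 * τ) * hb := by
    have := mul_le_mul_of_nonneg_left hcase hcτ.le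
    nlinarith
  have h4A : 0 ≤ 4 * c0 * τ * aG := by positivity
  have h4y : 0 ≤ 1 / 2 * (c0 * τ * g) * y := by positivity
  refine ⟨by linarith, ?_, ?_⟩
  · refine le_of_mul_le_mul_left ?_ hcτ
    linarith
  · have hy4 : g * y ≤ 128 * hb := by
      refine le_of_mul_le_mul_left ?_ hcτ
      linarith
    rw [← mul_div_assoc, le_div_iff₀ hg]
    linarith

lemma rate_two_step_of_shift_dominant (hτ : 0 < τ) (hg : 0 < g) (hg1 : g ≤ 1)
    (hA : 1 ≤ A) (hhb : 0 ≤ hb) (hρ0 : 0 ≤ ρ) (hρ : ρ ≤ 1 / 24)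
    (hP : P ≤ 128 * c0 * (τ * hb)) (haG : aG ≤ 16 * hb) (hxy : x + y ≤ 160 * (hb / g))
    (h2 : aB ≤ ρ * (hb + N2)) (hN : N2 ≤ x + y)
    (h4 : R2 ≤ A * (√P + τ * (2 * (x + y) + (aG + aB))))
    (hR1 : R1 ≤ x + y + (aG + aB)) :
    R2 ≤ A * (√(128 * c0 * (τ * hb)) + 500 * (τ * (hb / g))) ∧ R1 ≤ 340 * (hb / g) := by
  have h0 : hb ≤ hb / g := by rw [le_div_iff₀ hg]; nlinarith
  have haB : aB ≤ hb / g * 7 := by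
    have h6 : ρ * (hb + N2) ≤ ρ * (hb / g + 160 * (hb / g)) :=
      mul_le_mul_of_nonneg_left (by linarith) hρ0
    have h7 : ρ * (hb / g + 160 * (hb / g)) ≤ 1 / 24 * (hb / g + 160 * (hb / g)) :=
      mul_le_mul_of_nonneg_right hρ (by positivity)
    have : 0 ≤ hb / g := by positivity
    linarith
  have : 0 ≤ hb / g := by positivity
  refine ⟨h4.trans (mul_le_mul_of_nonneg_left ?_ (by linarith)), by linarith⟩
  have h8 := Real.sqrt_le_sqrt hP
  have h9 : τ * (2 * (x + y) + (aG + aB)) ≤ τ * (500 * (hb / g)) :=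
    mul_le_mul_of_nonneg_left (by linarith) hτ.le
  linarith

/-- By 32 k ρ ≤ 1 the quadratic part of the ρ term is at most N²/4 and is absorbed on the left; what
remains is a quadratic inequality whose root is of order a + k hb. -/
lemma le_of_quadratic_inequality {N a k : ℝ} (hN : 0 ≤ N) (ha : 0 ≤ a) (hk : 1 ≤ k)
    (hhb : 0 ≤ hb) (hρk : 32 * k * ρ ≤ 1)
    (h : N ^ 2 ≤ 6 * a * N + 8 * k * ((17 * hb + ρ * N) * (N + 160 * hb))
      + 204800 * (k * hb ^ 2)) :
    N ≤ 12 * a + 1500 * (k * hb) := by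
  have e1 : 32 * k * ρ * (1 / 4 * N * (N + 160 * hb)) ≤ 1 * (1 / 4 * N * (N + 160 * hb)) :=
    mul_le_mul_of_nonneg_right hρk (by positivity)
  have e2 : hb * N ≤ k * (hb * N) := le_mul_of_one_le_left (by positivity) hk
  have e3 : k * hb ^ 2 ≤ (k * hb) ^ 2 := by
    have : k * hb ^ 2 ≤ k * (k * hb ^ 2) := le_mul_of_one_le_left (by positivity) hk
    linarith [show (k * hb) ^ 2 = k * (k * hb ^ 2) by ring]
  have he0 : 0 ≤ k * hb := by positivity
  have e4 : 3 / 4 * N ^ 2 ≤ N * (6 * a + 176 * (k * hb)) + 226560 * (k * hb) ^ 2 := by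
    linarith
  generalize k * hb = e at *
  by_contra hcon
  push Not at hcon
  have e5 : N * (3 * a + 949 * e) ≤ N * (3 / 4 * N - (6 * a + 176 * e)) :=
    mul_le_mul_of_nonneg_left (by linarith) hN
  have e6 : (12 * a + 1500 * e) * (3 * a + 949 * e) ≤ N * (3 * a + 949 * e) :=
    mul_le_mul_of_nonneg_right hcon.le (by positivity)
  have e7 : 0 ≤ a * e := by positivity
  have e8 : e ^ 2 ≤ 0 := by nlinarith
  have e9 : e = 0 := by nlinarith
  subst e9
  nlinarith

/-- The pooled prediction error P0 of the common vector is bounded by τ g rs N2 plus a cross term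
that is quadratic in hb and N2. With N2² ≲ P0 + hb² this is a quadratic inequality for N2 whose root
is linear in hb, with no term √(τ hb). -/
lemma rate_one_step_of_shift_dominant {P0 rs : ℝ} (hc0 : 0 < c0) (hτ : 0 < τ) (hg : 0 < g)
    (hA : 1 ≤ A) (hhb : 0 ≤ hb) (hτg : τ ≤ g) (hρ0 : 0 ≤ ρ) (hρ : ρ ≤ 1 / 24)
    (hρA : 32 * A ^ 4 * ρ ≤ 1) (hN0 : 0 ≤ N2) (hrs : 0 ≤ rs)
    (haG : aG ≤ 16 * hb) (hxy : x + y ≤ 160 * (hb / g)) (hx0 : 0 ≤ x) (hy0 : 0 ≤ y)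
    (h2 : aB ≤ ρ * (hb + N2)) (hP0 : 0 ≤ P0)
    (hxs : x ≤ rs * N2)
    (h4 : N2 ≤ A * (√P0 + 2 * τ * (x + y)))
    (h5 : 1 / 2 * P0 - (aG + aB) * (2 * A ^ 2 * (N2 + τ * (x + y))) ≤ 3 / 2 * (c0 * τ * g) * x)
    (hR2 : R2 ≤ N2 + (aG + aB)) :
    R2 ≤ 30 * A ^ 2 * c0 * (τ * g * rs) + 3000 * A ^ 4 * hb := by
  -- The assumption τ ≤ g turns the ℓ₁ bound of order hb / g into a slack of order hb.
  have hτh : τ * (x + y) ≤ 160 * hb := by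
    have h6 : τ * (x + y) ≤ g * (160 * (hb / g)) :=
      mul_le_mul hτg hxy (by linarith) hg.le
    refine h6.trans (le_of_eq ?_)
    field_simp
  have ha : aG + aB ≤ 17 * hb + ρ * N2 := by
    have := mul_le_mul_of_nonneg_right hρ hhb
    nlinarith
  have hA2 : 1 ≤ A ^ 2 := one_le_pow₀ hA
  have hA4 : A ^ 2 ≤ A ^ 4 := pow_le_pow_right₀ hA (by norm_num)
  have hcr : (aG + aB) * (2 * A ^ 2 * (N2 + τ * (x + y))) ≤
      (17 * hb + ρ * N2) * (2 * A ^ 2 * (N2 + 160 * hb)) := by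
    refine mul_le_mul ha ?_ ?_ (by positivity)
    · exact mul_le_mul_of_nonneg_left (by linarith) (by positivity)
    · have : 0 ≤ τ * (x + y) := by positivity
      positivity
  have hx3 : 3 / 2 * (c0 * τ * g) * x ≤ 3 / 2 * (c0 * τ * g) * (rs * N2) :=
    mul_le_mul_of_nonneg_left hxs (by positivity)
  have hP0' : P0 ≤ 3 * c0 * (τ * g * rs) * N2 +
      4 * A ^ 2 * ((17 * hb + ρ * N2) * (N2 + 160 * hb)) := by
    linarith
  have hN2 : N2 ^ 2 ≤ 2 * A ^ 2 * P0 + 2 * A ^ 2 * (320 * hb) ^ 2 := by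
    have h7 : N2 ≤ A * (√P0 + 320 * hb) :=
      h4.trans (mul_le_mul_of_nonneg_left (by linarith) (by linarith))
    have h8 : N2 ^ 2 ≤ (A * (√P0 + 320 * hb)) ^ 2 := pow_le_pow_left₀ hN0 h7 2
    have h9 := Real.sq_sqrt hP0
    have h10 : (√P0 + 320 * hb) ^ 2 ≤ 2 * P0 + 2 * (320 * hb) ^ 2 := by
      nlinarith [sq_nonneg (√P0 - 320 * hb)]
    have h11 := mul_le_mul_of_nonneg_left h10 (by positivity : 0 ≤ A ^ 2)
    rw [mul_pow] at h8
    linarith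
  have e1 := mul_le_mul_of_nonneg_left hP0' (by positivity : 0 ≤ 2 * A ^ 2)
  have e4 := mul_le_mul_of_nonneg_right hA4 (by positivity : 0 ≤ hb ^ 2)
  have hN := le_of_quadratic_inequality (N := N2) (a := A ^ 2 * c0 * (τ * g * rs)) (k := A ^ 4)
    (ρ := ρ) (hb := hb) hN0 (by positivity) (one_le_pow₀ hA) hhb hρA (by
      refine hN2.trans ?_
      linarith [show 2 * A ^ 2 * (4 * A ^ 2 * ((17 * hb + ρ * N2) * (N2 + 160 * hb))) =
        8 * A ^ 4 * ((17 * hb + ρ * N2) * (N2 + 160 * hb)) by ring])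
  have hρN : ρ * N2 ≤ 1 / 24 * N2 := mul_le_mul_of_nonneg_right hρ hN0
  have hk : hb ≤ A ^ 4 * hb := le_mul_of_one_le_left hhb (one_le_pow₀ hA)
  have : 0 ≤ A ^ 2 * c0 * (τ * g * rs) := by positivity
  linarith

end RateArithmetic

/-! ### Rates for the weighted average and for the debiasing lasso -/

section CoTrainingRates

variable {p K : ℕ}

namespace RecenteredMinimizer

variable {Q : Fin (K + 1) → LinearMap.BilinForm ℝ (Fin p → ℝ)}
  {z β : Fin (K + 1) → Fin p → ℝ} {wt h : Fin (K + 1) → ℝ}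
  {S : Finset (Fin p)} {G : Finset (Fin (K + 1))} {b : Fin (K + 1) → Fin p → ℝ}
  {A c0 τ g s ρ : ℝ} {t : Fin (K + 1) → ℝ}

lemma scaled_basic_inequality
    (H : RecenteredMinimizer Q z β wt h (c0 * τ * g) (8 * c0 * τ) S G b) :
    1 / 2 * ∑ k, wt k * Q k (b k - β k) (b k - β k)
      + 4 * c0 * τ * ∑ k ∈ G, wt k * l1Norm (b k - β k - (b 0 - β 0))
      + 1 / 2 * (c0 * τ * g) * l1On Sᶜ (b 0 - β 0)
    ≤ 3 / 2 * (c0 * τ * g) * l1On S (b 0 - β 0) + 16 * c0 * τ * ∑ k, wt k * h k := by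
  have := H.basic_inequality
  linarith

/-- Restricted eigenvalues bound the ℓ₂ error of the weighted average, so the support part of b 0 -
β 0 is read off the average at the price of the heterogeneity. -/
lemma l1On_average_ge {lam0 lam : ℝ} (H : RecenteredMinimizer Q z β wt h lam0 lam S G b)
    (hs : (S.card : ℝ) ≤ s) :
    l1On S (b 0 - β 0) ≤ √s * l2Norm (∑ k, wt k • (b k - β k))
      + ∑ k, wt k * l1Norm (b k - β k - (b 0 - β 0)) := by
  have h1 := l1On_le_sqrt_card_mul S hs (∑ k, wt k • (b k - β k))
  have h2 : b 0 - β 0 = ∑ k, wt k • (b k - β k)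
      + -(∑ k, wt k • (b k - β k - (b 0 - β 0))) := by
    rw [H.sum_smul_sub]; abel
  have h3 := l1On_add_le S (∑ k, wt k • (b k - β k))
    (-(∑ k, wt k • (b k - β k - (b 0 - β 0))))
  rw [← h2] at h3
  have h4 := l1On_le_l1Norm S (-(∑ k, wt k • (b k - β k - (b 0 - β 0))))
  rw [l1Norm_neg] at h4
  have h5 := H.l1Norm_sum_smul_le fun k => b k - β k - (b 0 - β 0)
  linarith

/-- `ℓ₂` and `ℓ₁` rates of the weighted average of a co-training minimizer. -/
theorem average_rate (H : RecenteredMinimizer Q z β wt h (c0 * τ * g) (8 * c0 * τ) S G b)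
    (hc0 : 0 < c0) (hτ : 0 < τ) (hg : 0 < g) (hg1 : g ≤ 1) (hA : 1 ≤ A)
    (hρ0 : 0 ≤ ρ) (hρ : ρ ≤ 1 / 24) (ht_nonneg : ∀ k, 0 ≤ t k) (ht : ∀ k, k ≠ 0 → t k = τ)
    (ht0 : wt 0 * t 0 ≤ τ) (hRE : ∀ k, RestrictedEigenvalue A (t k) (Q k))
    (hs : (S.card : ℝ) ≤ s) (hsτ : 88 * A * √s * τ ≤ 1)
    (hbad : ∑ k ∈ Gᶜ, wt k * l1Norm (b k - β k - (b 0 - β 0))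
      ≤ ρ * (∑ k, wt k * h k + l2Norm (b 0 - β 0))) :
    l2Norm (∑ k, wt k • (b k - β k)) ≤ 64 * c0 * A ^ 2 * (τ * g * √s)
        + A * (√(128 * c0 * (τ * ∑ k, wt k * h k)) + 500 * (τ * ((∑ k, wt k * h k) / g)))
      ∧ l1Norm (∑ k, wt k • (b k - β k)) ≤ 1536 * c0 * A ^ 2 * (τ * g * √s ^ 2)
        + 340 * ((∑ k, wt k * h k) / g) := by
  have h1 := H.scaled_basic_inequality
  have hxy := l1On_add_l1On_compl S (b 0 - β 0)
  have hN := l2Norm_le_l1Norm (b 0 - β 0)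
  have h3 := H.l1On_average_ge hs
  have h4 := H.l2Norm_average_le (A := A) (by linarith) hτ.le ht_nonneg ht ht0 hRE
  have hR1 : l1Norm (∑ k, wt k • (b k - β k)) ≤ l1Norm (b 0 - β 0)
      + ∑ k, wt k * l1Norm (b k - β k - (b 0 - β 0)) := by
    rw [H.sum_smul_sub]
    refine (l1Norm_add_le _ _).trans ?_
    have := H.l1Norm_sum_smul_le fun k => b k - β k - (b 0 - β 0)
    linarith
  rw [sum_compl_split wt G] at h3 h4 hR1
  rw [← hxy] at h4 hR1 hN
  have hhb : 0 ≤ ∑ k, wt k * h k :=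
    Finset.sum_nonneg fun k _ => mul_nonneg (H.wt_nonneg k) (H.h_nonneg k)
  have hP : 0 ≤ ∑ k, wt k * Q k (b k - β k) (b k - β k) :=
    Finset.sum_nonneg fun k _ => mul_nonneg (H.wt_nonneg k) (H.nonneg k _)
  have haG : 0 ≤ ∑ k ∈ G, wt k * l1Norm (b k - β k - (b 0 - β 0)) :=
    Finset.sum_nonneg fun k _ => mul_nonneg (H.wt_nonneg k) (l1Norm_nonneg _)
  have hx := l1On_nonneg S (b 0 - β 0)
  have hy := l1On_nonneg Sᶜ (b 0 - β 0)
  -- With the factor 32 the shift term 16 c0 τ h̄ is at most ½ c0 τ g times the support term.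
  rcases le_total (32 * ∑ k, wt k * h k) (g * l1On S (b 0 - β 0)) with hcase | hcase
  · obtain ⟨r1, r2⟩ := rate_of_sparse_dominant hc0 hτ hg hg1 hA hx hP hy haG hρ0 hρ h1 hbad hN
      h3 h4 hsτ hR1 hcase
    have e1 : 0 ≤ A * (√(128 * c0 * (τ * ∑ k, wt k * h k))
        + 500 * (τ * ((∑ k, wt k * h k) / g))) := by positivity
    have e2 : 0 ≤ 340 * ((∑ k, wt k * h k) / g) := by positivity
    exact ⟨by linarith, by linarith⟩
  · obtain ⟨q1, q2, q3⟩ := rate_of_shift_dominant hc0 hτ hg hP hy haG h1 hcase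
    obtain ⟨r1, r2⟩ := rate_two_step_of_shift_dominant hτ hg hg1 hA hhb hρ0 hρ q1 q2 q3 hbad
      hN h4 hR1
    have e1 : 0 ≤ 64 * c0 * A ^ 2 * (τ * g * √s) := by positivity
    have e2 : 0 ≤ 1536 * c0 * A ^ 2 * (τ * g * √s ^ 2) := by positivity
    exact ⟨by linarith, by linarith⟩

/-- Sharper `ℓ₂` rate of the weighted average for small model shifts. -/
theorem average_rate_of_small_shift
    (H : RecenteredMinimizer Q z β wt h (c0 * τ * g) (8 * c0 * τ) S G b)
    (hc0 : 0 < c0) (hτ : 0 < τ) (hg : 0 < g) (hg1 : g ≤ 1) (hτg : τ ≤ g) (hA : 1 ≤ A)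
    (hρ0 : 0 ≤ ρ) (hρ : ρ ≤ 1 / 24) (hρA : 32 * A ^ 4 * ρ ≤ 1)
    (ht_nonneg : ∀ k, 0 ≤ t k) (ht : ∀ k, k ≠ 0 → t k = τ)
    (ht0 : wt 0 * t 0 ≤ τ) (hRE : ∀ k, RestrictedEigenvalue A (t k) (Q k))
    (hs : (S.card : ℝ) ≤ s) (hsτ : 88 * A * √s * τ ≤ 1)
    (hbad : ∑ k ∈ Gᶜ, wt k * l1Norm (b k - β k - (b 0 - β 0))
      ≤ ρ * (∑ k, wt k * h k + l2Norm (b 0 - β 0))) :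
    l2Norm (∑ k, wt k • (b k - β k)) ≤ 94 * c0 * A ^ 2 * (τ * g * √s)
        + 3000 * A ^ 4 * ∑ k, wt k * h k := by
  have h1 := H.scaled_basic_inequality
  have hxy := l1On_add_l1On_compl S (b 0 - β 0)
  have hN := l2Norm_le_l1Norm (b 0 - β 0)
  have h3 := H.l1On_average_ge hs
  have h4 := H.l2Norm_average_le (A := A) (by linarith) hτ.le ht_nonneg ht ht0 hRE
  have h5 := H.l2Norm_target_le (A := A) (by linarith) hτ.le ht_nonneg ht ht0 hRE (b 0 - β 0)
  have h6 := H.cross_term_ge (A := A) (v := fun k => b k - β k - (b 0 - β 0)) (by linarith)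
    hτ.le (hτg.trans hg1) ht hRE (by simp) (b 0 - β 0)
  have h7 := H.translation_inequality
  have hR1 : l1Norm (∑ k, wt k • (b k - β k)) ≤ l1Norm (b 0 - β 0)
      + ∑ k, wt k * l1Norm (b k - β k - (b 0 - β 0)) := by
    rw [H.sum_smul_sub]
    refine (l1Norm_add_le _ _).trans ?_
    have := H.l1Norm_sum_smul_le fun k => b k - β k - (b 0 - β 0)
    linarith
  have hR2 : l2Norm (∑ k, wt k • (b k - β k)) ≤ l2Norm (b 0 - β 0)
      + ∑ k, wt k * l1Norm (b k - β k - (b 0 - β 0)) := by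
    rw [H.sum_smul_sub]
    refine (l2Norm_add_le _ _).trans ?_
    have e1 := H.l1Norm_sum_smul_le fun k => b k - β k - (b 0 - β 0)
    have e2 := l2Norm_le_l1Norm (∑ k, wt k • (b k - β k - (b 0 - β 0)))
    linarith
  simp only [sum_compl_split wt G] at h3 h4 h6 hR1 hR2
  rw [← hxy] at h4 h5 h6 hR1 hN
  have hhb : 0 ≤ ∑ k, wt k * h k :=
    Finset.sum_nonneg fun k _ => mul_nonneg (H.wt_nonneg k) (H.h_nonneg k)
  have hP : 0 ≤ ∑ k, wt k * Q k (b k - β k) (b k - β k) :=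
    Finset.sum_nonneg fun k _ => mul_nonneg (H.wt_nonneg k) (H.nonneg k _)
  have hP0 : 0 ≤ ∑ k, wt k * Q k (b 0 - β 0) (b 0 - β 0) :=
    Finset.sum_nonneg fun k _ => mul_nonneg (H.wt_nonneg k) (H.nonneg k _)
  have haG : 0 ≤ ∑ k ∈ G, wt k * l1Norm (b k - β k - (b 0 - β 0)) :=
    Finset.sum_nonneg fun k _ => mul_nonneg (H.wt_nonneg k) (l1Norm_nonneg _)
  have hx := l1On_nonneg S (b 0 - β 0)
  have hy := l1On_nonneg Sᶜ (b 0 - β 0)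
  rcases le_total (32 * ∑ k, wt k * h k) (g * l1On S (b 0 - β 0)) with hcase | hcase
  · obtain ⟨r1, -⟩ := rate_of_sparse_dominant hc0 hτ hg hg1 hA hx hP hy haG hρ0 hρ h1 hbad hN
      h3 h4 hsτ hR1 hcase
    have e1 : 0 ≤ c0 * A ^ 2 * (τ * g * √s) := by positivity
    have e2 : 0 ≤ 3000 * A ^ 4 * ∑ k, wt k * h k := by positivity
    linarith
  · obtain ⟨q1, q2, q3⟩ := rate_of_shift_dominant hc0 hτ hg hP hy haG h1 hcase
    have := rate_one_step_of_shift_dominant hc0 hτ hg hA hhb hτg hρ0 hρ hρA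
      (l2Norm_nonneg _) (Real.sqrt_nonneg s) q2 q3 hx hy hbad hP0
      (l1On_le_sqrt_card_mul S hs _) h5 (by linarith) hR2
    have e1 : 0 ≤ c0 * A ^ 2 * (τ * g * √s) := by positivity
    linarith

end RecenteredMinimizer

/-- Analysis of a lasso program whose target is `δ₀ + r`, with `r` unpenalized misspecification. -/
lemma debias_rate {Q : LinearMap.BilinForm ℝ (Fin p → ℝ)} (hsy : ∀ u v, Q u v = Q v u)
    (hn : ∀ u, 0 ≤ Q u u) {z δ δ₀ r : Fin p → ℝ} {lam A t hb : ℝ} (hlam : 0 < lam) (hA : 0 ≤ A)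
    (ht : 0 ≤ t) (hRE : RestrictedEigenvalue A t Q) (hz : ∀ j, |z j| ≤ lam / 2)
    (hδ₀ : l1Norm δ₀ ≤ hb)
    (hmin : 1 / 2 * Q (δ - δ₀ + r) (δ - δ₀ + r) - z ⬝ᵥ (δ - δ₀) + lam * l1Norm δ
      ≤ 1 / 2 * Q r r + lam * l1Norm δ₀) :
    l2Norm (δ - δ₀) ≤ A * (√(4 * Q r r + 8 * (lam * hb)) + t * (Q r r / lam + 4 * hb)) := by
  -- Slow-rate lasso argument: no sparsity is used, the ℓ₁ bound on δ₀ takes its place and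
  -- contributes lam · hb, while r contributes Q r r.
  have h1 := dotProduct_le hz (δ - δ₀)
  have h2 : l1Norm (δ - δ₀) ≤ l1Norm δ + l1Norm δ₀ := l1Norm_sub_le _ _
  have h3 : lam * l1Norm (δ - δ₀) ≤ lam * (l1Norm δ + l1Norm δ₀) :=
    mul_le_mul_of_nonneg_left h2 hlam.le
  have h4 : lam * l1Norm δ₀ ≤ lam * hb := mul_le_mul_of_nonneg_left hδ₀ hlam.le
  have h5 := hn (δ - δ₀ + r)
  have h6 := hn (δ - δ₀ + r + r)
  have h6' : Q (δ - δ₀) (δ - δ₀) ≤ 2 * Q (δ - δ₀ + r) (δ - δ₀ + r) + 2 * Q r r := by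
    generalize δ - δ₀ = x at *
    simp only [map_add, LinearMap.add_apply, hsy r x] at *
    linarith
  have h0 := mul_nonneg hlam.le (l1Norm_nonneg (δ - δ₀))
  have h7 : Q (δ - δ₀) (δ - δ₀) ≤ 4 * Q r r + 8 * (lam * hb) := by linarith
  have h8 : l1Norm (δ - δ₀) ≤ Q r r / lam + 4 * hb := by
    refine le_of_mul_le_mul_left ?_ hlam
    rw [mul_add, mul_div_cancel₀ _ hlam.ne']
    linarith
  refine (hRE.l2Norm_le hA ht hn _).trans (mul_le_mul_of_nonneg_left ?_ hA)
  exact add_le_add (Real.sqrt_le_sqrt h7) (mul_le_mul_of_nonneg_left h8 ht)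

end CoTrainingRates

/-! ### Gram matrices and scores -/

section Gram

variable {n p : ℕ}

/-- The Gram matrix `XᵀX / n` of a design with rows `x i`. -/
noncomputable def gramMatrix (x : Fin n → Fin p → ℝ) : Matrix (Fin p) (Fin p) ℝ :=
  fun j l => (∑ i, x i j * x i l) / n

/-- The score `Xᵀe / n`. -/
noncomputable def scoreVec (x : Fin n → Fin p → ℝ) (e : Fin n → ℝ) : Fin p → ℝ :=
  fun j => (∑ i, x i j * e i) / n

lemma toBilin'_gramMatrix (x : Fin n → Fin p → ℝ) (u v : Fin p → ℝ) :
    Matrix.toBilin' (gramMatrix x) u v = (∑ i, (x i ⬝ᵥ u) * (x i ⬝ᵥ v)) / n := by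
  rw [Matrix.toBilin'_apply]
  simp only [gramMatrix, dotProduct, Finset.sum_div, Finset.mul_sum,
    Finset.sum_mul]
  rw [Finset.sum_comm' (t' := Finset.univ) (s' := fun _ => Finset.univ) (by simp)]
  rw [Finset.sum_comm]
  conv_rhs => rw [Finset.sum_comm]
  rw [Finset.sum_comm]
  refine Finset.sum_congr rfl fun j _ => ?_
  rw [Finset.sum_comm]
  refine Finset.sum_congr rfl fun i _ => Finset.sum_congr rfl fun l _ => ?_
  ring

lemma toBilin'_gramMatrix_symm (x : Fin n → Fin p → ℝ) (u v : Fin p → ℝ) :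
    Matrix.toBilin' (gramMatrix x) u v = Matrix.toBilin' (gramMatrix x) v u := by
  simp only [toBilin'_gramMatrix, mul_comm]

lemma toBilin'_gramMatrix_nonneg (x : Fin n → Fin p → ℝ) (u : Fin p → ℝ) :
    0 ≤ Matrix.toBilin' (gramMatrix x) u u := by
  rw [toBilin'_gramMatrix]
  exact div_nonneg (Finset.sum_nonneg fun i _ => mul_self_nonneg _) (Nat.cast_nonneg _)

lemma scoreVec_dotProduct (x : Fin n → Fin p → ℝ) (e : Fin n → ℝ) (u : Fin p → ℝ) :
    scoreVec x e ⬝ᵥ u = (∑ i, e i * (x i ⬝ᵥ u)) / n := by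
  simp only [scoreVec, dotProduct, Finset.sum_div, Finset.mul_sum, Finset.sum_mul]
  rw [Finset.sum_comm]
  exact Finset.sum_congr rfl fun i _ => Finset.sum_congr rfl fun j _ => by ring

lemma sum_residual_sq (x : Fin n → Fin p → ℝ) (e : Fin n → ℝ) (u : Fin p → ℝ) :
    ∑ i, (e i - x i ⬝ᵥ u) ^ 2 = ∑ i, e i ^ 2 +
      n * (Matrix.toBilin' (gramMatrix x) u u - 2 * (scoreVec x e ⬝ᵥ u)) := by
  rw [toBilin'_gramMatrix, scoreVec_dotProduct]
  rcases Nat.eq_zero_or_pos n with rfl | hn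
  · simp
  · have : (n : ℝ) ≠ 0 := by positivity
    field_simp
    rw [Finset.mul_sum, ← Finset.sum_sub_distrib, ← Finset.sum_add_distrib]
    exact Finset.sum_congr rfl fun i _ => by ring

end Gram

/-! ### Recentering the objective and blockwise optimality -/

section Recentering

variable {p K : ℕ}

lemma Matrix.toBilin'_eq_mulVec_dotProduct (M : Matrix (Fin p) (Fin p) ℝ)
    (hs : ∀ u v, Matrix.toBilin' M u v = Matrix.toBilin' M v u) (o v : Fin p → ℝ) :
    (M *ᵥ o) ⬝ᵥ v = Matrix.toBilin' M o v := by
  rw [hs, Matrix.toBilin'_apply', dotProduct_comm]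

/-- Moving the centers by `o` changes the recentered objective by a constant, if the scores are
replaced with the residual scores. -/
lemma recenteredObjective_shift (M : Fin (K + 1) → Matrix (Fin p) (Fin p) ℝ)
    (hs : ∀ k u v, Matrix.toBilin' (M k) u v = Matrix.toBilin' (M k) v u)
    (z β o : Fin (K + 1) → Fin p → ℝ) (wt : Fin (K + 1) → ℝ) (lam0 lam : ℝ)
    (b : Fin (K + 1) → Fin p → ℝ) :
    recenteredObjective (fun k => Matrix.toBilin' (M k)) z β wt lam0 lam b =
      recenteredObjective (fun k => Matrix.toBilin' (M k)) (fun k => z k - M k *ᵥ o k)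
        (fun k => β k + o k) wt lam0 lam b
        + ∑ k, wt k * (1 / 2 * Matrix.toBilin' (M k) (o k) (o k) - z k ⬝ᵥ o k) := by
  unfold recenteredObjective
  have : ∑ k, wt k * (1 / 2 * Matrix.toBilin' (M k) (b k - β k) (b k - β k)
      - z k ⬝ᵥ (b k - β k)) =
      ∑ k, wt k * (1 / 2 * Matrix.toBilin' (M k) (b k - (β k + o k)) (b k - (β k + o k))
      - (z k - M k *ᵥ o k) ⬝ᵥ (b k - (β k + o k)))
      + ∑ k, wt k * (1 / 2 * Matrix.toBilin' (M k) (o k) (o k) - z k ⬝ᵥ o k) := by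
    rw [← Finset.sum_add_distrib]
    refine Finset.sum_congr rfl fun k _ => ?_
    rw [show b k - β k = (b k - (β k + o k)) + o k by abel, sub_dotProduct,
      Matrix.toBilin'_eq_mulVec_dotProduct _ (hs k)]
    generalize b k - (β k + o k) = x
    simp only [map_add, LinearMap.add_apply, dotProduct_add, hs k x (o k)]
    ring
  rw [this]
  ring

/-- Variational inequality for one block of a minimizer of the recentered objective. -/
lemma block_variational {Q : Fin (K + 1) → LinearMap.BilinForm ℝ (Fin p → ℝ)}
    (hs : ∀ k u v, Q k u v = Q k v u) {z β : Fin (K + 1) → Fin p → ℝ} {wt : Fin (K + 1) → ℝ}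
    {lam0 lam : ℝ} (hlam : 0 ≤ lam) {b : Fin (K + 1) → Fin p → ℝ}
    (hmin : ∀ b', recenteredObjective Q z β wt lam0 lam b
      ≤ recenteredObjective Q z β wt lam0 lam b')
    {k : Fin (K + 1)} (hk : k ≠ 0) (hwt : 0 < wt k) (v : Fin p → ℝ) :
    z k ⬝ᵥ v - Q k (b k - β k) v ≤ lam * (l1Norm (b k - b 0 + v) - l1Norm (b k - b 0)) := by
  have key : ∀ w, 1 / 2 * Q k (b k - β k) (b k - β k) - z k ⬝ᵥ (b k - β k)
        + lam * l1Norm (b k - β k + (β k - b 0))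
      ≤ 1 / 2 * Q k w w - z k ⬝ᵥ w + lam * l1Norm (w + (β k - b 0)) := by
    intro w
    -- Only block k moves. As k ≠ 0, the block b 0 in the penalties stays fixed and all other terms
    -- cancel.
    have h1 := hmin (Function.update b k (β k + w))
    unfold recenteredObjective at h1
    rw [Function.update_of_ne hk.symm] at h1
    have h2 : ∀ F : Fin (K + 1) → (Fin p → ℝ) → ℝ,
        ∑ i, F i (Function.update b k (β k + w) i) =
          ∑ i, F i (b i) + (F k (β k + w) - F k (b k)) := by
      intro F
      rw [← Finset.add_sum_erase _ _ (Finset.mem_univ k),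
        ← Finset.add_sum_erase _ (fun i => F i (b i)) (Finset.mem_univ k),
        Finset.sum_congr (g := fun i => F i (b i)) rfl fun i hi => by
          rw [Function.update_of_ne (Finset.ne_of_mem_erase hi)]]
      simp only [Function.update_self]
      ring
    rw [h2 fun i x => wt i * (1 / 2 * Q i (x - β i) (x - β i) - z i ⬝ᵥ (x - β i)),
      h2 fun i x => wt i * (lam * l1Norm (x - b 0))] at h1
    simp only [add_sub_cancel_left] at h1
    rw [sub_add_sub_cancel, show w + (β k - b 0) = β k + w - b 0 by abel]
    refine le_of_mul_le_mul_left ?_ hwt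
    linarith
  have h := dotProduct_sub_le_of_isMin (hs k) (R := fun w => lam * l1Norm (w + (β k - b 0)))
    (fun x v t ht ht1 => by
      have h3 := mul_le_mul_of_nonneg_left (l1Norm_add_smul_le (x + (β k - b 0)) v ht ht1) hlam
      rw [show x + t • v + (β k - b 0) = x + (β k - b 0) + t • v by abel,
        show x + v + (β k - b 0) = x + (β k - b 0) + v by abel]
      linarith) key v
  rw [show b k - β k + v + (β k - b 0) = b k - b 0 + v by abel,
    show b k - β k + (β k - b 0) = b k - b 0 by abel] at h
  linarith

end Recentering

/-! ### Gram matrices, scores and weights of a transfer problem -/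

namespace TransferProblem

variable (P : TransferProblem.{u})

/-- The Gram matrix of task `k`. -/
noncomputable def gram (k : Fin (P.K + 1)) (ω : P.Ω) : Matrix (Fin P.p) (Fin P.p) ℝ :=
  gramMatrix fun i => P.X k i ω

/-- The score of task `k`. -/
noncomputable def score (k : Fin (P.K + 1)) (ω : P.Ω) : Fin P.p → ℝ :=
  scoreVec (fun i => P.X k i ω) fun i => P.ε k i ω

/-- The share of task `k` in the total sample. -/
noncomputable def wt (k : Fin (P.K + 1)) : ℝ := (sampleSize P.nT P.nS k : ℝ) / P.N

/-- The level of the model shift, `0` for the target task. -/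
def shift (k : Fin (P.K + 1)) : ℝ := Fin.cases 0 P.h k

lemma wt_zero : P.wt 0 = P.nT / P.N := by simp [wt, sampleSize]

lemma wt_of_ne {k : Fin (P.K + 1)} (hk : k ≠ 0) : P.wt k = P.nS / P.N := by
  simp [wt, sampleSize, hk]

lemma wt_succ (k : Fin P.K) : P.wt k.succ = P.nS / P.N := P.wt_of_ne (Fin.succ_ne_zero k)

lemma average_eq (b : Fin (P.K + 1) → Fin P.p → ℝ) : P.average b = ∑ k, P.wt k • b k := by
  rw [Fin.sum_univ_succ, average, add_comm, Finset.smul_sum]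
  simp only [wt_zero, wt_succ]

lemma sum_wt_mul_shift : ∑ k, P.wt k * P.shift k = P.hbar := by
  rw [Fin.sum_univ_succ]
  simp [shift, hbar, wt_succ, Finset.mul_sum]

lemma sum_wt (hN : 0 < P.N) : ∑ k, P.wt k = 1 := by
  rw [Fin.sum_univ_succ]
  simp only [wt_zero, wt_succ, Finset.sum_const, Finset.card_univ, Fintype.card_fin, nsmul_eq_mul]
  rw [N] at *
  field_simp
  ring

/-- Pulling the weight n_S/N out of the penalty on b k - b 0 leaves `lam`, which is the same for
both tunings of the method. -/
lemma coTrainingObjective_eq (hN : 0 < P.N) {lam0 a lam : ℝ} (hlam : lam0 * a = P.nS / P.N * lam)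
    (ω : P.Ω) (b : Fin (P.K + 1) → Fin P.p → ℝ) :
    P.coTrainingObjective lam0 (fun _ => a) ω b =
      recenteredObjective (fun k => Matrix.toBilin' (P.gram k ω)) (fun k => P.score k ω) P.β P.wt
        lam0 lam b + 1 / (2 * P.N) * ∑ k, ∑ i, P.ε k i ω ^ 2 := by
  unfold coTrainingObjective recenteredObjective
  have h1 : 1 / (2 * P.N) * ∑ k, ∑ i, (P.y k i ω - P.X k i ω ⬝ᵥ b k) ^ 2 =
      ∑ k, P.wt k * (1 / 2 * Matrix.toBilin' (P.gram k ω) (b k - P.β k) (b k - P.β k)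
        - P.score k ω ⬝ᵥ (b k - P.β k)) + 1 / (2 * P.N) * ∑ k, ∑ i, P.ε k i ω ^ 2 := by
    rw [Finset.mul_sum, Finset.mul_sum, ← Finset.sum_add_distrib]
    refine Finset.sum_congr rfl fun k _ => ?_
    have h2 : ∀ i, P.y k i ω - P.X k i ω ⬝ᵥ b k = P.ε k i ω - P.X k i ω ⬝ᵥ (b k - P.β k) := by
      intro i; rw [y, dotProduct_sub]; ring
    simp only [h2]
    rw [sum_residual_sq (fun i => P.X k i ω) (fun i => P.ε k i ω), wt, gram, score]
    field_simp
    ring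
  have h3 : lam0 * ∑ k : Fin P.K, a * l1Norm (b k.succ - b 0) =
      ∑ k, P.wt k * (lam * l1Norm (b k - b 0)) := by
    rw [Fin.sum_univ_succ (fun k => P.wt k * (lam * l1Norm (b k - b 0))), Finset.mul_sum]
    simp only [sub_self, l1Norm_zero, mul_zero, zero_add, wt_succ]
    refine Finset.sum_congr rfl fun k _ => ?_
    rw [← mul_assoc, hlam]
    ring
  rw [h1, mul_add, h3]
  ring

lemma gram_symm (k : Fin (P.K + 1)) (ω : P.Ω) (u v : Fin P.p → ℝ) :
    Matrix.toBilin' (P.gram k ω) u v = Matrix.toBilin' (P.gram k ω) v u :=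
  toBilin'_gramMatrix_symm _ u v

lemma gram_nonneg (k : Fin (P.K + 1)) (ω : P.Ω) (u : Fin P.p → ℝ) :
    0 ≤ Matrix.toBilin' (P.gram k ω) u u :=
  toBilin'_gramMatrix_nonneg _ u

end TransferProblem

/-! ### Restricted eigenvalues in low dimension -/

section

variable {p : ℕ} {A t : ℝ} {Q : LinearMap.BilinForm ℝ (Fin p → ℝ)}

/-- In low dimension, restricted eigenvalues are eigenvalues. -/
lemma RestrictedEigenvalue.l2NormSq_le_of_low_dim (h : RestrictedEigenvalue A t Q)
    (hdim : 2 * A ^ 2 * t ^ 2 * p ≤ 1) (u : Fin p → ℝ) : l2NormSq u ≤ 2 * A ^ 2 * Q u u := by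
  have h1 := (h u).1
  have h2 : l1Norm u ^ 2 ≤ p * l2NormSq u := by
    have := pow_le_pow_left₀ (l1Norm_nonneg u) (l1Norm_le_sqrt_mul u) 2
    rwa [mul_pow, Real.sq_sqrt (Nat.cast_nonneg _), l2Norm_sq] at this
  have h3 := mul_le_mul_of_nonneg_left h2 (by positivity : 0 ≤ A ^ 2 * t ^ 2)
  have h4 := mul_le_mul_of_nonneg_right hdim (l2NormSq_nonneg u)
  nlinarith

lemma RestrictedEigenvalue.le_of_low_dim (h : RestrictedEigenvalue A t Q) (hA : 1 ≤ A)
    (hdim : 2 * A ^ 2 * t ^ 2 * p ≤ 1) (u : Fin p → ℝ) : Q u u ≤ 2 * A ^ 2 * l2NormSq u := by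
  have h1 := (h u).2
  have h2 : l1Norm u ^ 2 ≤ p * l2NormSq u := by
    have := pow_le_pow_left₀ (l1Norm_nonneg u) (l1Norm_le_sqrt_mul u) 2
    rwa [mul_pow, Real.sq_sqrt (Nat.cast_nonneg _), l2Norm_sq] at this
  have h3 := mul_le_mul_of_nonneg_left h2 (by positivity : 0 ≤ A ^ 2 * t ^ 2)
  have h4 := mul_le_mul_of_nonneg_right hdim (l2NormSq_nonneg u)
  have h5 := mul_le_mul_of_nonneg_right (one_le_pow₀ hA : 1 ≤ A ^ 2) (l2NormSq_nonneg u)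
  have h6 := l2NormSq_nonneg u
  linarith

lemma l2Norm_le_of_quadratic_le (h : RestrictedEigenvalue A t Q) (hA : 1 ≤ A)
    (hdim : 2 * A ^ 2 * t ^ 2 * p ≤ 1) {u γ : Fin p → ℝ} (huγ : Q u u ≤ Q γ γ) :
    l2Norm u ≤ 2 * A ^ 2 * l2Norm γ := by
  have h1 := h.l2NormSq_le_of_low_dim hdim u
  have h2 := h.le_of_low_dim hA hdim γ
  refine abs_le_of_sq_le_sq' ?_ (by have := l2Norm_nonneg γ; positivity) |>.2
  rw [mul_pow, l2Norm_sq, l2Norm_sq]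
  have h3 : 2 * A ^ 2 * Q u u ≤ 2 * A ^ 2 * (2 * A ^ 2 * l2NormSq γ) :=
    mul_le_mul_of_nonneg_left (huγ.trans h2) (by positivity)
  linarith

end

/-! ### The good event and the size conditions -/

namespace TransferProblem

variable (P : TransferProblem.{u})

/-- The event on which the estimators obey the claimed rate. On the tasks outside `G` the score is
not dominated by the penalty, and the centers are shifted by the lasso solutions `o`. -/
structure GoodEvent (A c0 c1 η : ℝ) (ω : P.Ω) (o : Fin (P.K + 1) → Fin P.p → ℝ)
    (G : Finset (Fin (P.K + 1))) : Prop where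
  restricted : ∀ k, RestrictedEigenvalue A (√(P.logp / sampleSize P.nT P.nS k))
    (Matrix.toBilin' (P.gram k ω))
  zero_mem : 0 ∈ G
  good_zero : ∀ k ∈ G, o k = 0
  good_score : ∀ k ∈ G, k ≠ 0 → ∀ j, |P.score k ω j| ≤ 4 * c0 * √(P.logp / P.nS)
  bad_variational : ∀ k ∉ G, ∀ v, P.score k ω ⬝ᵥ v - Matrix.toBilin' (P.gram k ω) (o k) v
    ≤ 8 * c0 * √(P.logp / P.nS) * (l1Norm (o k + v) - l1Norm (o k))
  bad_dim : ∀ k ∉ G, 2 * A ^ 2 * (P.logp / P.nS) * P.p ≤ 1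
  bad_wt : ∑ k ∈ Gᶜ, P.wt k ≤ η
  bad_shift : ∑ k ∈ Gᶜ, P.wt k * P.shift k ≤ η * P.hbar
  total_score : ∀ j, |(∑ k, P.wt k • (P.score k ω - P.gram k ω *ᵥ o k)) j|
    ≤ c0 / 2 * √(P.logp / P.N)
  correction : l2NormSq (∑ k, P.wt k • o k) ≤ 1 / (P.p * P.N)
  target_score : ∀ j, |P.score 0 ω j| ≤ c1 / 2 * √(P.logp / P.nT)

/-- Size conditions on a problem that hold late in the sequence. -/
structure SizeConditions (A C_T : ℝ) : Prop where
  one_le_logp : 1 ≤ P.logp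
  nT_pos : 0 < P.nT
  nT_le : P.nT ≤ P.nS
  one_le_K : 1 ≤ P.K
  one_le_s : 1 ≤ P.s
  small : 88 * A * √P.s * √(P.logp / P.nS) ≤ 1
  small_K : 2 * (P.K * P.s * P.logp / P.nS) ≤ 1
  target : P.s * P.logp ≤ C_T * P.nT
  small_shift : P.hbar * √(P.logp / P.nT) ≤ 1

variable {P}

namespace SizeConditions

variable {A C_T : ℝ} (hS : P.SizeConditions A C_T)

include hS

lemma nS_pos : (0 : ℝ) < P.nS := by
  have h1 := hS.nT_pos
  have h2 := hS.nT_le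
  have : 0 < P.nS := by omega
  exact_mod_cast this

lemma nT_pos' : (0 : ℝ) < P.nT := by exact_mod_cast hS.nT_pos

lemma logp_pos : 0 < P.logp := one_pos.trans_le hS.one_le_logp

lemma nS_le_N : (P.nS : ℝ) ≤ P.N := by
  have h1 : (1 : ℝ) ≤ P.K := by exact_mod_cast hS.one_le_K
  have h2 := hS.nS_pos
  have h3 := hS.nT_pos'
  unfold N
  nlinarith

lemma N_pos : 0 < P.N := hS.nS_pos.trans_le hS.nS_le_N

lemma N_le : P.N ≤ 2 * P.K * P.nS := by
  have h1 : (1 : ℝ) ≤ P.K := by exact_mod_cast hS.one_le_K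
  have h2 := hS.nS_pos
  have h3 : (P.nT : ℝ) ≤ P.nS := by exact_mod_cast hS.nT_le
  unfold N
  nlinarith

lemma tau_pos : 0 < √(P.logp / P.nS) :=
  Real.sqrt_pos.2 (div_pos hS.logp_pos hS.nS_pos)

lemma tauT_pos : 0 < √(P.logp / P.nT) :=
  Real.sqrt_pos.2 (div_pos hS.logp_pos hS.nT_pos')

lemma tau_sq : √(P.logp / P.nS) ^ 2 = P.logp / P.nS :=
  Real.sq_sqrt (div_pos hS.logp_pos hS.nS_pos).le

lemma tauT_sq : √(P.logp / P.nT) ^ 2 = P.logp / P.nT :=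
  Real.sq_sqrt (div_pos hS.logp_pos hS.nT_pos').le

lemma share_pos : 0 < √(P.nS / P.N) := Real.sqrt_pos.2 (div_pos hS.nS_pos hS.N_pos)

lemma share_sq : √(P.nS / P.N) ^ 2 = P.nS / P.N :=
  Real.sq_sqrt (div_pos hS.nS_pos hS.N_pos).le

lemma share_le_one : √(P.nS / P.N) ≤ 1 :=
  Real.sqrt_le_one.2 ((div_le_one hS.N_pos).2 hS.nS_le_N)

lemma sqrt_logp_div_N : √(P.logp / P.N) = √(P.logp / P.nS) * √(P.nS / P.N) := by
  rw [← Real.sqrt_mul (div_pos hS.logp_pos hS.nS_pos).le]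
  congr 1
  have := hS.nS_pos.ne'
  field_simp

lemma tau_le_tauT : √(P.logp / P.nS) ≤ √(P.logp / P.nT) :=
  Real.sqrt_le_sqrt (div_le_div_of_nonneg_left hS.logp_pos.le hS.nT_pos'
    (by exact_mod_cast hS.nT_le))

lemma one_le_s' : (1 : ℝ) ≤ P.s := by exact_mod_cast hS.one_le_s

lemma one_le_K' : (1 : ℝ) ≤ P.K := by exact_mod_cast hS.one_le_K

/-- From N ≤ 2 K n_S and 2 K s log p ≤ n_S one gets N log p ≤ n_S². This is the condition τ ≤ g of
`average_rate_of_small_shift`. -/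
lemma tau_le_share : √(P.logp / P.nS) ≤ √(P.nS / P.N) := by
  refine Real.sqrt_le_sqrt ?_
  have h1 := hS.small_K
  have h2 := hS.nS_pos
  have h3 : P.K * P.logp ≤ P.K * P.s * P.logp := by
    have := mul_le_mul_of_nonneg_left hS.one_le_s'
      (mul_nonneg (Nat.cast_nonneg P.K) hS.logp_pos.le)
    linarith
  rw [div_le_div_iff₀ h2 hS.N_pos]
  have h4 : 2 * (P.K * P.s * P.logp) ≤ P.nS := by
    rw [← mul_div_assoc, div_le_one h2] at h1
    exact h1
  have h5 := mul_le_mul_of_nonneg_left hS.N_le hS.logp_pos.le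
  nlinarith

lemma wt_pos (k : Fin (P.K + 1)) : 0 < P.wt k := by
  by_cases hk : k = 0
  · subst hk; rw [P.wt_zero]; exact div_pos hS.nT_pos' hS.N_pos
  · rw [P.wt_of_ne hk]; exact div_pos hS.nS_pos hS.N_pos

/-- n √(log p / n) = √(n log p) increases with n, so the small weight of the target makes up for its
larger slack. -/
lemma wt_zero_mul_le : P.wt 0 * √(P.logp / P.nT) ≤ √(P.logp / P.nS) := by
  have h1 : P.nT / √P.nT ≤ P.nS / √P.nS := by
    rw [Real.div_sqrt, Real.div_sqrt]
    exact Real.sqrt_le_sqrt (by exact_mod_cast hS.nT_le)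
  have h2 := hS.logp_pos
  rw [P.wt_zero, Real.sqrt_div h2.le, Real.sqrt_div h2.le]
  have h3 : √P.logp * (P.nT / √P.nT) ≤ √P.logp * (P.nS / √P.nS) :=
    mul_le_mul_of_nonneg_left h1 (Real.sqrt_nonneg _)
  have h4 : √P.logp * (P.nS / √P.nS) ≤ √P.logp / √P.nS * P.N := by
    have := mul_le_mul_of_nonneg_left hS.nS_le_N
      (div_nonneg (Real.sqrt_nonneg P.logp) (Real.sqrt_nonneg P.nS))
    calc _ = √P.logp / √P.nS * P.nS := by ring
      _ ≤ _ := this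
  rw [div_mul_eq_mul_div, div_le_iff₀ hS.N_pos]
  calc _ = √P.logp * (P.nT / √P.nT) := by ring
    _ ≤ _ := h3.trans h4

lemma hbar_nonneg (hΘ : P.InParameterSpace) : 0 ≤ P.hbar := by
  unfold hbar
  exact mul_nonneg (div_pos hS.nS_pos hS.N_pos).le
    (Finset.sum_nonneg fun k _ => (l1Norm_nonneg _).trans (hΘ.2 k))

lemma logp_div_nT_le : P.logp / P.nT ≤ C_T := by
  rw [div_le_iff₀ hS.nT_pos']
  have := mul_le_mul_of_nonneg_right hS.one_le_s' hS.logp_pos.le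
  linarith [hS.target]

lemma p_pos : 0 < P.p := by
  rcases Nat.eq_zero_or_pos P.p with h | h
  · have := hS.one_le_logp
    simp [logp, h] at this
    linarith
  · exact h

end SizeConditions

lemma shift_nonneg (hΘ : P.InParameterSpace) (k : Fin (P.K + 1)) : 0 ≤ P.shift k := by
  cases k using Fin.cases with
  | zero => exact le_rfl
  | succ k => exact (l1Norm_nonneg _).trans (hΘ.2 k)

lemma l1Norm_sub_le_shift (hΘ : P.InParameterSpace) (k : Fin (P.K + 1)) :
    l1Norm (P.β k - P.β 0) ≤ P.shift k := by
  cases k using Fin.cases with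
  | zero => simp [shift, l1Norm_zero]
  | succ k => exact hΘ.2 k

namespace GoodEvent

variable {A C_T c0 c1 η : ℝ} {ω : P.Ω} {o : Fin (P.K + 1) → Fin P.p → ℝ}
  {G : Finset (Fin (P.K + 1))}

/-- A co-training minimizer is a minimizer of the objective recentered at `β + o`. -/
lemma recenteredMinimizer (hE : P.GoodEvent A c0 c1 η ω o G) (hS : P.SizeConditions A C_T)
    (hΘ : P.InParameterSpace) (hc0 : 0 < c0) {g : ℝ} (hg : √(P.nS / P.N) ≤ g)
    {S : Finset (Fin P.p)} (hsupp : ∀ j ∉ S, P.β 0 j = 0) {b : Fin (P.K + 1) → Fin P.p → ℝ}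
    (hb : IsMinOn (P.coTrainingObjective (c0 * √(P.logp / P.nS) * g)
      (fun _ => 8 * (P.nS / P.N) / g) ω) Set.univ b) :
    RecenteredMinimizer (fun k => Matrix.toBilin' (P.gram k ω))
      (fun k => P.score k ω - P.gram k ω *ᵥ o k) (fun k => P.β k + o k) P.wt P.shift
      (c0 * √(P.logp / P.nS) * g) (8 * c0 * √(P.logp / P.nS)) S G b := by
  have hgpos : 0 < g := hS.share_pos.trans_le hg
  have hτ := hS.tau_pos
  have ho0 : o 0 = 0 := hE.good_zero 0 hE.zero_mem
  have hlam : c0 * √(P.logp / P.nS) * g * (8 * (P.nS / P.N) / g)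
      = P.nS / P.N * (8 * c0 * √(P.logp / P.nS)) := by
    field_simp
  refine ⟨fun k => P.gram_symm k ω, fun k => P.gram_nonneg k ω, fun k => (hS.wt_pos k).le,
    P.sum_wt hS.N_pos, shift_nonneg hΘ, ?_, by positivity, ?_, ?_, ?_⟩
  · intro j hj
    simp [ho0, hsupp j hj]
  · intro j
    refine (hE.total_score j).trans ?_
    rw [hS.sqrt_logp_div_N]
    have := mul_le_mul_of_nonneg_left hg (by positivity : 0 ≤ c0 / 2 * √(P.logp / P.nS))
    linarith
  · intro k
    simp only [ho0, add_zero]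
    set v := b k - (P.β k + o k) - (b 0 - P.β 0) with hv
    have hbv : b k - b 0 = (P.β k - P.β 0) + (o k + v) := by rw [hv]; abel
    have hbv' : P.β k + o k - P.β 0 = (P.β k - P.β 0) + o k := by abel
    rw [hbv, hbv']
    have hΔ := l1Norm_sub_le_shift hΘ k
    set Δ := P.β k - P.β 0
    -- The shift Δ is removed from both penalty terms, which is why it is paid twice.
    have h1 : l1Norm (o k + v) ≤ l1Norm (Δ + (o k + v)) + l1Norm Δ := by
      have := l1Norm_sub_le (Δ + (o k + v)) Δ
      rwa [add_sub_cancel_left] at this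
    have h2 := l1Norm_add_le Δ (o k)
    have hlam0 : 0 ≤ 8 * c0 * √(P.logp / P.nS) := by positivity
    by_cases hk : k ∈ G
    · have hok := hE.good_zero k hk
      rw [if_pos hk]
      simp only [hok, Matrix.mulVec_zero, sub_zero, zero_add, add_zero] at h1 h2 ⊢
      by_cases hk0 : k = 0
      · have hv0 : v = 0 := by rw [hv, hk0, ho0]; abel
        rw [hv0]
        simp only [dotProduct_zero, add_zero, l1Norm_zero, sub_self, mul_zero, sub_zero]
        have := shift_nonneg hΘ k
        positivity
      -- The score is at most 4 c0 τ, half of the penalty 8 c0 τ; the other half is the margin.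
      · have h3 := dotProduct_le (hE.good_score k hk hk0) v
        have h4 : l1Norm Δ - l1Norm (Δ + v) ≤ 2 * P.shift k - l1Norm v := by linarith
        have h5 := mul_le_mul_of_nonneg_left h4 hlam0
        linarith
    -- Outside G the residual score is a subgradient of the penalty at o k, so it is dominated, but
    -- without margin.
    · have h3 := hE.bad_variational k hk v
      rw [if_neg hk, sub_dotProduct, Matrix.toBilin'_eq_mulVec_dotProduct _ (P.gram_symm k ω)]
      have h4 : l1Norm (Δ + o k) - l1Norm (Δ + (o k + v)) ≤
          2 * P.shift k + (l1Norm (o k) - l1Norm (o k + v)) := by linarith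
      have h5 := mul_le_mul_of_nonneg_left h4 hlam0
      linarith
  · intro b'
    have h1 := isMinOn_univ_iff.1 hb b'
    rw [P.coTrainingObjective_eq hS.N_pos hlam, P.coTrainingObjective_eq hS.N_pos hlam,
      recenteredObjective_shift (fun k => P.gram k ω) (fun k => P.gram_symm k ω) _ _ o _ _ _ b,
      recenteredObjective_shift (fun k => P.gram k ω) (fun k => P.gram_symm k ω) _ _ o _ _ _ b']
      at h1
    linarith

/-- The tasks on which the score is not dominated contribute little. -/
lemma bad_contribution (hE : P.GoodEvent A c0 c1 η ω o G) (hS : P.SizeConditions A C_T)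
    (hΘ : P.InParameterSpace) (hA : 1 ≤ A) (hc0 : 0 < c0) {g : ℝ} (hg : 0 < g)
    {b : Fin (P.K + 1) → Fin P.p → ℝ}
    (hb : IsMinOn (P.coTrainingObjective (c0 * √(P.logp / P.nS) * g)
      (fun _ => 8 * (P.nS / P.N) / g) ω) Set.univ b) :
    ∑ k ∈ Gᶜ, P.wt k * l1Norm (b k - (P.β k + o k) - (b 0 - (P.β 0 + o 0)))
      ≤ (3 * A ^ 2 * √P.p * η) *
        (∑ k, P.wt k * P.shift k + l2Norm (b 0 - (P.β 0 + o 0))) := by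
  have hτ := hS.tau_pos
  have ho0 : o 0 = 0 := hE.good_zero 0 hE.zero_mem
  have hlam : c0 * √(P.logp / P.nS) * g * (8 * (P.nS / P.N) / g)
      = P.nS / P.N * (8 * c0 * √(P.logp / P.nS)) := by
    field_simp
  simp only [ho0, add_zero]
  have hmin : ∀ b', recenteredObjective (fun k => Matrix.toBilin' (P.gram k ω))
      (fun k => P.score k ω) P.β P.wt (c0 * √(P.logp / P.nS) * g) (8 * c0 * √(P.logp / P.nS)) b ≤
      recenteredObjective (fun k => Matrix.toBilin' (P.gram k ω))
      (fun k => P.score k ω) P.β P.wt (c0 * √(P.logp / P.nS) * g)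
        (8 * c0 * √(P.logp / P.nS)) b' := by
    intro b'
    have h1 := isMinOn_univ_iff.1 hb b'
    rw [P.coTrainingObjective_eq hS.N_pos hlam, P.coTrainingObjective_eq hS.N_pos hlam] at h1
    linarith
  have hN2 := l2Norm_nonneg (b 0 - P.β 0)
  have key : ∀ k ∈ Gᶜ, P.wt k * l1Norm (b k - (P.β k + o k) - (b 0 - P.β 0)) ≤
      3 * A ^ 2 * √P.p * (P.wt k * P.shift k + P.wt k * l2Norm (b 0 - P.β 0)) := by
    intro k hk
    have hkG : k ∉ G := by simpa using hk
    have hk0 : k ≠ 0 := fun h => hkG (h ▸ hE.zero_mem)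
    have h1 := block_variational (fun k => P.gram_symm k ω) (by positivity) hmin hk0
      (hS.wt_pos k)
    -- The block b k - β k solves the program of o k with the penalty translated by β k - b 0, so it
    -- is no farther from o k than this translation, in the Gram form.
    have h2 := quadratic_sub_le_of_variational (P.gram_symm k ω) (P.gram_nonneg k ω)
      (x := b k - P.β k) (γ := P.β k - b 0) (hE.bad_variational k hkG)
      (fun v => by rw [sub_add_sub_cancel]; exact h1 v)
    have hRE := hE.restricted k
    have hsz : (sampleSize P.nT P.nS k : ℝ) = P.nS := by simp [sampleSize, hk0]
    rw [hsz] at hRE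
    have hdim : 2 * A ^ 2 * √(P.logp / P.nS) ^ 2 * P.p ≤ 1 := by
      rw [hS.tau_sq]; exact hE.bad_dim k hkG
    have h3 := l2Norm_le_of_quadratic_le hRE hA hdim h2
    have h4 : l2Norm (P.β k - b 0) ≤ P.shift k + l2Norm (b 0 - P.β 0) := by
      rw [show P.β k - b 0 = (P.β k - P.β 0) - (b 0 - P.β 0) by abel]
      refine (l2Norm_sub_le _ _).trans (add_le_add ?_ le_rfl)
      exact (l2Norm_le_l1Norm _).trans (l1Norm_sub_le_shift hΘ k)
    have h5 : l2Norm (b k - (P.β k + o k) - (b 0 - P.β 0)) ≤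
        3 * A ^ 2 * (P.shift k + l2Norm (b 0 - P.β 0)) := by
      rw [show b k - (P.β k + o k) = b k - P.β k - o k by abel]
      refine (l2Norm_sub_le _ _).trans ?_
      have h6 := mul_le_mul_of_nonneg_left h4 (by positivity : 0 ≤ 2 * A ^ 2)
      have h7 : 1 ≤ A ^ 2 := one_le_pow₀ hA
      have h8 := shift_nonneg hΘ k
      have h9 := mul_le_mul_of_nonneg_right h7 (by positivity :
        0 ≤ P.shift k + l2Norm (b 0 - P.β 0))
      linarith
    -- Passing to the ℓ₁ norm costs √p, to be offset by the small weight η of these tasks.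
    have h6 := (l1Norm_le_sqrt_mul (b k - (P.β k + o k) - (b 0 - P.β 0))).trans
      (mul_le_mul_of_nonneg_left h5 (Real.sqrt_nonneg _))
    refine (mul_le_mul_of_nonneg_left h6 (hS.wt_pos k).le).trans (le_of_eq ?_)
    ring
  refine (Finset.sum_le_sum key).trans ?_
  rw [← Finset.mul_sum, Finset.sum_add_distrib, ← Finset.sum_mul, P.sum_wt_mul_shift]
  have h1 := hE.bad_shift
  have h2 := mul_le_mul_of_nonneg_right hE.bad_wt hN2
  calc _ ≤ 3 * A ^ 2 * √P.p * (η * P.hbar + η * l2Norm (b 0 - P.β 0)) :=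
        mul_le_mul_of_nonneg_left (add_le_add h1 h2) (by positivity)
    _ = _ := by ring

end GoodEvent

end TransferProblem

/-! ### Error bounds on the good event -/

lemma l2NormSq_le_sq_of_l2Norm_le {p : ℕ} {v : Fin p → ℝ} {x : ℝ} (h : l2Norm v ≤ x) :
    l2NormSq v ≤ x ^ 2 := by
  rw [← l2Norm_sq]
  exact pow_le_pow_left₀ (l2Norm_nonneg v) h 2

lemma add_sq_le_two (x y : ℝ) : (x + y) ^ 2 ≤ 2 * x ^ 2 + 2 * y ^ 2 := by
  linarith [sq_nonneg (x - y), add_sq x y, sub_sq x y]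

lemma add_sq_le_three (x y z : ℝ) : (x + y + z) ^ 2 ≤ 3 * x ^ 2 + 3 * y ^ 2 + 3 * z ^ 2 := by
  nlinarith [sq_nonneg (x - y), sq_nonneg (y - z), sq_nonneg (x - z)]

namespace TransferProblem

variable {P : TransferProblem.{u}}

/-- Three sources of error: the minimizer around the shifted centers, the corrections, and the bias
from the model shifts. The last is what the debiasing step estimates. -/
lemma average_sub_eq (hN : 0 < P.N) (b o : Fin (P.K + 1) → Fin P.p → ℝ) :
    P.average b - P.β 0 = ∑ k, P.wt k • (b k - (P.β k + o k)) + ∑ k, P.wt k • o k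
      + ∑ k, P.wt k • (P.β k - P.β 0) := by
  rw [average_eq]
  have h : P.β 0 = ∑ k, P.wt k • P.β 0 := by rw [← Finset.sum_smul, P.sum_wt hN, one_smul]
  conv_lhs => rw [h]
  rw [← Finset.sum_sub_distrib, ← Finset.sum_add_distrib, ← Finset.sum_add_distrib]
  refine Finset.sum_congr rfl fun k _ => ?_
  rw [← smul_sub, ← smul_add, ← smul_add]
  congr 1
  abel

namespace GoodEvent

variable {A C_T c0 c1 η : ℝ} {ω : P.Ω} {o : Fin (P.K + 1) → Fin P.p → ℝ}
  {G : Finset (Fin (P.K + 1))}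

lemma l1Norm_average_shift_le (hS : P.SizeConditions A C_T) (hΘ : P.InParameterSpace) :
    l1Norm (∑ k, P.wt k • (P.β k - P.β 0)) ≤ P.hbar := by
  refine (l1Norm_sum_le _ _).trans ?_
  rw [← P.sum_wt_mul_shift]
  refine Finset.sum_le_sum fun k _ => ?_
  rw [l1Norm_smul, abs_of_pos (hS.wt_pos k)]
  exact mul_le_mul_of_nonneg_left (l1Norm_sub_le_shift hΘ k) (hS.wt_pos k).le

lemma correction_le (hE : P.GoodEvent A c0 c1 η ω o G) (hS : P.SizeConditions A C_T) :
    l2NormSq (∑ k, P.wt k • o k) ≤ P.s * P.logp / P.N := by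
  refine hE.correction.trans ?_
  have h1 : (1 : ℝ) ≤ P.p := by exact_mod_cast hS.p_pos
  have h2 : 1 ≤ P.s * P.logp := one_le_mul_of_one_le_of_one_le hS.one_le_s' hS.one_le_logp
  have h3 := hS.N_pos
  rw [div_le_div_iff₀ (by positivity) h3]
  have h4 : 1 ≤ P.s * P.logp * P.p := one_le_mul_of_one_le_of_one_le h2 h1
  nlinarith

/-- Error bound of the one-step method. -/
theorem one_step_bound (hE : P.GoodEvent A c0 c1 η ω o G) (hS : P.SizeConditions A C_T)
    (hΘ : P.InParameterSpace) (hA : 1 ≤ A) (hc0 : 0 < c0) (hη : 0 ≤ η)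
    (hρ : 3 * A ^ 2 * √P.p * η ≤ 1 / 24) (hρA : 32 * A ^ 4 * (3 * A ^ 2 * √P.p * η) ≤ 1)
    {b : Fin P.p → ℝ} (hb : P.IsOneStep c0 ω b) :
    l2NormSq (b - P.β 0) ≤ (4 * (2 * (94 * c0 * A ^ 2) ^ 2 + 2 * (3000 * A ^ 4) ^ 2) + 6) *
      (P.s * P.logp / P.N + P.hbar ^ 2) := by
  obtain ⟨b', hb', rfl⟩ := hb
  obtain ⟨S, hScard, hSsupp⟩ := exists_support_finset (P.β 0)
  have hcard : (S.card : ℝ) ≤ P.s := by rw [hScard]; exact_mod_cast hΘ.1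
  have hg := hS.share_pos
  rw [hS.sqrt_logp_div_N, ← mul_assoc] at hb'
  -- This is the tuning g = √(n_S / N).
  have ha : 8 * √((P.nS : ℝ) / P.N) = 8 * (P.nS / P.N) / √(P.nS / P.N) := by
    rw [mul_div_assoc, Real.div_sqrt]
  rw [ha] at hb'
  have hrec := hE.recenteredMinimizer hS hΘ hc0 le_rfl hSsupp hb'
  have hbad := hE.bad_contribution hS hΘ hA hc0 hg hb'
  have hrate := hrec.average_rate_of_small_shift hc0 hS.tau_pos hg hS.share_le_one
    hS.tau_le_share hA (by positivity) hρ hρA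
    (t := fun k => √(P.logp / sampleSize P.nT P.nS k)) (fun k => Real.sqrt_nonneg _)
    (fun k hk => by simp [sampleSize, hk])
    (by simpa [sampleSize] using hS.wt_zero_mul_le) hE.restricted hcard hS.small hbad
  rw [P.sum_wt_mul_shift] at hrate
  have h1 := l2NormSq_le_sq_of_l2Norm_le hrate
  have h2 := hE.correction_le hS
  have h3 : l2NormSq (∑ k, P.wt k • (P.β k - P.β 0)) ≤ P.hbar ^ 2 :=
    l2NormSq_le_sq_of_l2Norm_le ((l2Norm_le_l1Norm _).trans (l1Norm_average_shift_le hS hΘ))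
  have hX : (√(P.logp / P.nS) * √(P.nS / P.N) * √P.s) ^ 2 = P.s * P.logp / P.N := by
    rw [mul_pow, ← hS.sqrt_logp_div_N, Real.sq_sqrt (div_pos hS.logp_pos hS.N_pos).le,
      Real.sq_sqrt (Nat.cast_nonneg _)]
    ring
  have h4 : (94 * c0 * A ^ 2 * (√(P.logp / P.nS) * √(P.nS / P.N) * √P.s)
      + 3000 * A ^ 4 * P.hbar) ^ 2 ≤ 2 * (94 * c0 * A ^ 2) ^ 2 * (P.s * P.logp / P.N)
        + 2 * (3000 * A ^ 4) ^ 2 * P.hbar ^ 2 := by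
    refine (add_sq_le_two _ _).trans (le_of_eq ?_)
    rw [mul_pow (94 * c0 * A ^ 2), hX]
    ring
  rw [average_sub_eq hS.N_pos b' o]
  have h5 := l2NormSq_add_le (∑ k, P.wt k • (b' k - (P.β k + o k)) + ∑ k, P.wt k • o k)
    (∑ k, P.wt k • (P.β k - P.β 0))
  have h6 := l2NormSq_add_le (∑ k, P.wt k • (b' k - (P.β k + o k))) (∑ k, P.wt k • o k)
  have hX0 : 0 ≤ P.s * P.logp / P.N := by rw [← hX]; positivity
  have hY0 := sq_nonneg P.hbar
  have e1 : 0 ≤ (94 * c0 * A ^ 2) ^ 2 * P.hbar ^ 2 := by positivity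
  have e2 : 0 ≤ (3000 * A ^ 4) ^ 2 * (P.s * P.logp / P.N) := by positivity
  linarith

/-- The part of the two-step analysis common to both tunings of the first step. -/
theorem two_step_bound_aux (hE : P.GoodEvent A c0 c1 η ω o G) (hS : P.SizeConditions A C_T)
    (hΘ : P.InParameterSpace) (hA : 1 ≤ A) (hc0 : 0 < c0) (hc1 : 0 < c1) (hη : 0 ≤ η)
    (hCT : 1 ≤ C_T) (hρ : 3 * A ^ 2 * √P.p * η ≤ 1 / 24) {g X : ℝ}
    (hg : √(P.nS / P.N) ≤ g) (hg1 : g ≤ 1)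
    (hX1 : P.s * P.logp / P.N ≤ X) (hX2 : P.hbar * √(P.logp / P.nT) ≤ X) (hX3 : X ≤ 2)
    (hX4 : P.s * (√(P.logp / P.nS) * g) ^ 2 ≤ X)
    (hX5 : (√(P.logp / P.nT) * (P.hbar / g)) ^ 2 ≤ X)
    {b : Fin (P.K + 1) → Fin P.p → ℝ}
    (hb : IsMinOn (P.coTrainingObjective (c0 * √(P.logp / P.nS) * g)
      (fun _ => 8 * (P.nS / P.N) / g) ω) Set.univ b) {D : ℝ}
    (hD1 : 3 * (64 * c0 * A ^ 2) ^ 2 + 3 * (A ^ 2 * (128 * c0)) + 3 * (500 * A) ^ 2 ≤ D)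
    (hD2 : 2 * (1536 * c0 * A ^ 2) ^ 2 * C_T + 2 * 340 ^ 2 ≤ D) (hD3 : C_T ≤ D)
    {δ : Fin P.p → ℝ}
    (hδ : IsMinOn (P.debiasObjective (c1 * √(P.logp / P.nT)) ω (P.average b)) Set.univ δ) :
    l2NormSq (P.average b + δ - P.β 0) ≤
      (8 * D + 6 * A ^ 2 * (32 * A ^ 2 * D + 8 * c1 + 128 * A ^ 4 * D ^ 2 / c1 ^ 2 + 16)) * X := by
  obtain ⟨S, hScard, hSsupp⟩ := exists_support_finset (P.β 0)
  have hcard : (S.card : ℝ) ≤ P.s := by rw [hScard]; exact_mod_cast hΘ.1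
  have hgpos : 0 < g := hS.share_pos.trans_le hg
  have hτ := hS.tau_pos
  have hτT := hS.tauT_pos
  have hhb := hS.hbar_nonneg hΘ
  have hrec := hE.recenteredMinimizer hS hΘ hc0 hg hSsupp hb
  have hbad := hE.bad_contribution hS hΘ hA hc0 hgpos hb
  obtain ⟨hr2, hr1⟩ := hrec.average_rate hc0 hτ hgpos hg1 hA (by positivity) hρ
    (t := fun k => √(P.logp / sampleSize P.nT P.nS k)) (fun k => Real.sqrt_nonneg _)
    (fun k hk => by simp [sampleSize, hk])
    (by simpa [sampleSize] using hS.wt_zero_mul_le) hE.restricted hcard hS.small hbad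
  rw [P.sum_wt_mul_shift] at hr1 hr2
  have hX0 : 0 ≤ X := (sq_nonneg _).trans hX5
  have hss : √(P.s : ℝ) ^ 2 = P.s := Real.sq_sqrt (Nat.cast_nonneg _)
  set r' := ∑ k, P.wt k • (b k - (P.β k + o k)) with hr'
  set ob := ∑ k, P.wt k • o k with hob
  set τ := √(P.logp / P.nS) with hτdef
  set τT := √(P.logp / P.nT) with hτTdef
  have hττ : τ ≤ τT := hS.tau_le_tauT
  have hq : 0 ≤ P.hbar / g := by positivity
  have e2 : l2NormSq r' ≤ D * X := by
    refine (l2NormSq_le_sq_of_l2Norm_le hr2).trans ?_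
    rw [mul_add, ← add_assoc]
    refine (add_sq_le_three _ _ _).trans ?_
    have f1 : (64 * c0 * A ^ 2 * (τ * g * √P.s)) ^ 2 ≤ (64 * c0 * A ^ 2) ^ 2 * X := by
      rw [mul_pow, mul_pow (τ * g), hss]
      exact mul_le_mul_of_nonneg_left (by linarith) (by positivity)
    have f2 : (A * √(128 * c0 * (τ * P.hbar))) ^ 2 ≤ A ^ 2 * (128 * c0) * X := by
      rw [mul_pow, Real.sq_sqrt (by positivity)]
      have : τ * P.hbar ≤ X := by
        have := mul_le_mul_of_nonneg_right hττ hhb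
        linarith
      have := mul_le_mul_of_nonneg_left this (by positivity : 0 ≤ A ^ 2 * (128 * c0))
      linarith
    have f3 : (A * (500 * (τ * (P.hbar / g)))) ^ 2 ≤ (500 * A) ^ 2 * X := by
      have : (τ * (P.hbar / g)) ^ 2 ≤ X :=
        (pow_le_pow_left₀ (by positivity) (mul_le_mul_of_nonneg_right hττ hq) 2).trans hX5
      have := mul_le_mul_of_nonneg_left this (by positivity : 0 ≤ (500 * A) ^ 2)
      linarith [show (A * (500 * (τ * (P.hbar / g)))) ^ 2
        = (500 * A) ^ 2 * (τ * (P.hbar / g)) ^ 2 by ring]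
    have := mul_le_mul_of_nonneg_right hD1 hX0
    linarith
  have hτTsq : τT ^ 2 ≤ C_T := by rw [hτTdef, hS.tauT_sq]; exact hS.logp_div_nT_le
  have hsT : P.s * τT ^ 2 ≤ C_T := by
    rw [hτTdef, hS.tauT_sq, ← mul_div_assoc, div_le_iff₀ hS.nT_pos']
    exact hS.target
  -- The target Gram form has slack τT, so the ℓ₁ error of the average is needed with this factor.
  -- Here s log p ≤ C_T n_T enters.
  have e1 : τT ^ 2 * l1Norm r' ^ 2 ≤ D * X := by
    have f0 := pow_le_pow_left₀ (l1Norm_nonneg r') hr1 2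
    have f1 := mul_le_mul_of_nonneg_left (f0.trans (add_sq_le_two _ _)) (sq_nonneg τT)
    have f2 : τT ^ 2 * (1536 * c0 * A ^ 2 * (τ * g * √P.s ^ 2)) ^ 2 ≤
        (1536 * c0 * A ^ 2) ^ 2 * C_T * X := by
      have f3 : P.s * τT ^ 2 * (P.s * (τ * g) ^ 2) ≤ C_T * X :=
        mul_le_mul hsT hX4 (by positivity) (by linarith)
      have f4 := mul_le_mul_of_nonneg_left f3 (by positivity : 0 ≤ (1536 * c0 * A ^ 2) ^ 2)
      rw [hss]
      linarith [show τT ^ 2 * (1536 * c0 * A ^ 2 * (τ * g * P.s)) ^ 2 =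
        (1536 * c0 * A ^ 2) ^ 2 * (P.s * τT ^ 2 * (P.s * (τ * g) ^ 2)) by ring]
    have f5 : τT ^ 2 * (340 * (P.hbar / g)) ^ 2 ≤ 340 ^ 2 * X := by
      have := mul_le_mul_of_nonneg_left hX5 (by norm_num : (0 : ℝ) ≤ 340 ^ 2)
      linarith [show τT ^ 2 * (340 * (P.hbar / g)) ^ 2 = 340 ^ 2 * (τT * (P.hbar / g)) ^ 2 by ring]
    have := mul_le_mul_of_nonneg_right hD2 hX0
    linarith
  have e3 : l2NormSq ob ≤ D * X := by
    have := mul_le_mul_of_nonneg_right (hCT.trans hD3) hX0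
    linarith [hE.correction_le hS]
  -- The averaged correction has squared ℓ₂ norm at most 1/(pN), so its squared ℓ₁ norm is at most
  -- 1/N.
  have e4 : τT ^ 2 * l1Norm ob ^ 2 ≤ D * X := by
    have f1 : l1Norm ob ^ 2 ≤ P.p * l2NormSq ob := by
      have := pow_le_pow_left₀ (l1Norm_nonneg ob) (l1Norm_le_sqrt_mul ob) 2
      rwa [mul_pow, Real.sq_sqrt (Nat.cast_nonneg _), l2Norm_sq] at this
    have hp : (0 : ℝ) < P.p := by exact_mod_cast hS.p_pos
    have f2 : P.p * l2NormSq ob ≤ 1 / P.N := by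
      refine (mul_le_mul_of_nonneg_left hE.correction hp.le).trans (le_of_eq ?_)
      field_simp
    have f3 : 1 / P.N ≤ X := by
      refine le_trans ?_ hX1
      refine div_le_div_of_nonneg_right ?_ hS.N_pos.le
      exact one_le_mul_of_one_le_of_one_le hS.one_le_s' hS.one_le_logp
    exact mul_le_mul (hτTsq.trans hD3) (f1.trans (f2.trans f3)) (by positivity) (by linarith)
  have hD0 : 0 ≤ D := by linarith
  have er2 : l2NormSq (r' + ob) ≤ 4 * (D * X) := by
    linarith [l2NormSq_add_le r' ob]
  have er1 : τT ^ 2 * l1Norm (r' + ob) ^ 2 ≤ 4 * (D * X) := by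
    have f1 := pow_le_pow_left₀ (l1Norm_nonneg _) (l1Norm_add_le r' ob) 2
    have f2 := mul_le_mul_of_nonneg_left (f1.trans (add_sq_le_two _ _)) (sq_nonneg τT)
    linarith
  have hRE0 := hE.restricted 0
  have hsz : (sampleSize P.nT P.nS (0 : Fin (P.K + 1)) : ℝ) = P.nT := by simp [sampleSize]
  rw [hsz] at hRE0
  set Q := Matrix.toBilin' (P.gram 0 ω) with hQ
  have hQr : Q (r' + ob) (r' + ob) ≤ 8 * A ^ 2 * D * X := by
    refine (hRE0 (r' + ob)).2.trans ?_
    have := mul_le_mul_of_nonneg_left (add_le_add er2 er1) (by positivity : 0 ≤ A ^ 2)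
    linarith
  have hQ0 : 0 ≤ Q (r' + ob) (r' + ob) := P.gram_nonneg 0 ω _
  set sh := ∑ k, P.wt k • (P.β k - P.β 0) with hsh
  have hav : P.average b - P.β 0 = r' + ob + sh := average_sub_eq hS.N_pos b o
  have hobj : ∀ x, P.debiasObjective (c1 * τT) ω (P.average b) x =
      1 / 2 * Q (x + (r' + ob + sh)) (x + (r' + ob + sh))
        - P.score 0 ω ⬝ᵥ (x + (r' + ob + sh)) + c1 * τT * l1Norm x
        + 1 / (2 * (P.nT : ℝ)) * ∑ i, P.ε 0 i ω ^ 2 := by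
    intro x
    unfold debiasObjective
    have h2 : ∀ i, P.y 0 i ω - P.X 0 i ω ⬝ᵥ P.average b - P.X 0 i ω ⬝ᵥ x
        = P.ε 0 i ω - P.X 0 i ω ⬝ᵥ (x + (r' + ob + sh)) := by
      intro i; rw [← hav, y, dotProduct_add, dotProduct_sub]; ring
    simp only [h2]
    rw [sum_residual_sq (fun i => P.X 0 i ω) (fun i => P.ε 0 i ω), hQ, gram, score, hsz]
    have := hS.nT_pos'.ne'
    field_simp
    ring
  -- The comparison point -sh has ℓ₁ norm at most h̄; the rest r' + ob of the error of the average
  -- is left as misspecification.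
  have hmin := isMinOn_univ_iff.1 hδ (-sh)
  rw [hobj, hobj, l1Norm_neg] at hmin
  have hδ₀ := l1Norm_average_shift_le hS hΘ
  rw [← hsh] at hδ₀
  have hdeb := debias_rate (P.gram_symm 0 ω) (P.gram_nonneg 0 ω) (z := P.score 0 ω) (δ := δ)
    (δ₀ := -sh) (r := r' + ob) (lam := c1 * τT) (A := A) (t := τT) (hb := P.hbar) (by positivity)
    (by linarith) hτT.le hRE0 (fun j => by have := hE.target_score j; linarith)
    (by rwa [l1Norm_neg]) (by
      rw [l1Norm_neg]
      rw [show -sh + (r' + ob + sh) = r' + ob by abel] at hmin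
      rw [show δ - -sh + (r' + ob) = δ + (r' + ob + sh) by abel]
      have : P.score 0 ω ⬝ᵥ (δ + (r' + ob + sh)) =
          P.score 0 ω ⬝ᵥ (δ - -sh) + P.score 0 ω ⬝ᵥ (r' + ob) := by
        rw [← dotProduct_add]; congr 1; abel
      rw [this] at hmin
      linarith)
  have hfin := l2NormSq_le_sq_of_l2Norm_le hdeb
  have hQdiv : τT * (Q (r' + ob) (r' + ob) / (c1 * τT) + 4 * P.hbar) =
      Q (r' + ob) (r' + ob) / c1 + 4 * (P.hbar * τT) := by
    field_simp
  rw [← hQ, hQdiv, mul_pow, ← add_assoc] at hfin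
  have g1 : √(4 * Q (r' + ob) (r' + ob) + 8 * (c1 * τT * P.hbar)) ^ 2 ≤
      (32 * A ^ 2 * D + 8 * c1) * X := by
    rw [Real.sq_sqrt (by positivity)]
    have := mul_le_mul_of_nonneg_left hX2 hc1.le
    linarith
  have g2 : (Q (r' + ob) (r' + ob) / c1) ^ 2 ≤ 128 * A ^ 4 * D ^ 2 / c1 ^ 2 * X := by
    rw [div_pow, div_mul_eq_mul_div]
    refine div_le_div_of_nonneg_right ?_ (by positivity)
    refine (pow_le_pow_left₀ hQ0 hQr 2).trans ?_
    have := mul_le_mul_of_nonneg_left hX3 (by positivity : 0 ≤ 64 * A ^ 4 * D ^ 2 * X)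
    linarith [show (8 * A ^ 2 * D * X) ^ 2 = 64 * A ^ 4 * D ^ 2 * X * X by ring]
  have g3 : (4 * (P.hbar * τT)) ^ 2 ≤ 16 * X := by
    have h0 : 0 ≤ P.hbar * τT := by positivity
    have := mul_le_mul_of_nonneg_left hS.small_shift h0
    linarith [show (4 * (P.hbar * τT)) ^ 2 = 16 * (P.hbar * τT * (P.hbar * τT)) by ring]
  have g4 := mul_le_mul_of_nonneg_left (add_sq_le_three
    √(4 * Q (r' + ob) (r' + ob) + 8 * (c1 * τT * P.hbar)) (Q (r' + ob) (r' + ob) / c1)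
    (4 * (P.hbar * τT))) (by positivity : 0 ≤ A ^ 2)
  have g5 := mul_le_mul_of_nonneg_left (add_le_add (add_le_add g1 g2) g3)
    (by positivity : 0 ≤ 3 * A ^ 2)
  have hsplit : P.average b + δ - P.β 0 = (δ - -sh) + (r' + ob) := by
    rw [show P.average b + δ - P.β 0 = P.average b - P.β 0 + δ by abel, hav]; abel
  rw [hsplit]
  have g6 := l2NormSq_add_le (δ - -sh) (r' + ob)
  linarith

end GoodEvent

end TransferProblem

namespace TransferProblem

namespace GoodEvent

variable {P : TransferProblem.{u}} {A C_T c0 c1 η : ℝ} {ω : P.Ω}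
  {o : Fin (P.K + 1) → Fin P.p → ℝ} {G : Finset (Fin (P.K + 1))}

/-- Error bound of the two-step method. -/
theorem two_step_bound (hE : P.GoodEvent A c0 c1 η ω o G) (hS : P.SizeConditions A C_T)
    (hΘ : P.InParameterSpace) (hA : 1 ≤ A) (hc0 : 0 < c0) (hc1 : 0 < c1) (hη : 0 ≤ η)
    (hCT : 1 ≤ C_T) (hρ : 3 * A ^ 2 * √P.p * η ≤ 1 / 24) {D : ℝ}
    (hD1 : 3 * (64 * c0 * A ^ 2) ^ 2 + 3 * (A ^ 2 * (128 * c0)) + 3 * (500 * A) ^ 2 ≤ D)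
    (hD2 : 2 * (1536 * c0 * A ^ 2) ^ 2 * C_T + 2 * 340 ^ 2 ≤ D) (hD3 : C_T ≤ D)
    {b : Fin P.p → ℝ} (hb : P.IsTwoStep c0 c1 ω b) :
    l2NormSq (b - P.β 0) ≤
      (8 * D + 6 * A ^ 2 * (32 * A ^ 2 * D + 8 * c1 + 128 * A ^ 4 * D ^ 2 / c1 ^ 2 + 16)) *
        (P.s * P.logp / P.N + P.hbar * √(P.logp / P.nT)) := by
  obtain ⟨w, δ, ⟨b', hb', rfl⟩, hδ, rfl⟩ := hb
  have hhb := hS.hbar_nonneg hΘ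
  have hN := hS.N_pos
  have hnS := hS.nS_pos
  have hτT := hS.tauT_pos
  have hlogp := hS.logp_pos
  have hH : 0 ≤ P.hbar * √(P.logp / P.nT) := by positivity
  have hslp : 0 ≤ P.s * P.logp := mul_nonneg (Nat.cast_nonneg _) hlogp.le
  have hR : 0 ≤ P.s * P.logp / P.N := by positivity
  have hRS : P.s * P.logp / P.N ≤ P.s * P.logp / P.nS :=
    div_le_div_of_nonneg_left hslp hnS hS.nS_le_N
  have hRS1 : 2 * P.K * (P.s * P.logp / P.nS) ≤ 1 := by
    have := hS.small_K
    calc _ = 2 * (P.K * P.s * P.logp / P.nS) := by ring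
      _ ≤ 1 := this
  have hRS2 : P.s * P.logp / P.nS ≤ 1 := by
    have h0 : 0 ≤ P.s * P.logp / P.nS := by positivity
    have := mul_le_mul_of_nonneg_right hS.one_le_K' h0
    linarith
  have hX3 : P.s * P.logp / P.N + P.hbar * √(P.logp / P.nT) ≤ 2 := by
    linarith [hS.small_shift]
  by_cases hcond : P.CondA
  · rw [lam0TwoStep, weightTwoStep, if_pos hcond, if_pos hcond, hS.sqrt_logp_div_N,
      ← mul_assoc] at hb'
    have ha : 8 * √((P.nS : ℝ) / P.N) = 8 * (P.nS / P.N) / √(P.nS / P.N) := by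
      rw [mul_div_assoc, Real.div_sqrt]
    rw [ha] at hb'
    refine hE.two_step_bound_aux hS hΘ hA hc0 hc1 hη hCT hρ le_rfl hS.share_le_one
      (by linarith) (by linarith) hX3 ?_ ?_ hb' hD1 hD2 hD3 hδ
    · rw [← hS.sqrt_logp_div_N, Real.sq_sqrt (by positivity), ← mul_div_assoc]
      linarith
    -- The factor 1/g² = N/n_S ≤ 2K is paid for by `CondA` together with 2 K s log p ≤ n_S.
    · rw [← mul_div_assoc, div_pow, hS.share_sq, div_div_eq_mul_div, div_le_iff₀ hnS]
      have h1 : (√(P.logp / P.nT) * P.hbar) ^ 2 * P.N ≤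
          (√(P.logp / P.nT) * P.hbar) ^ 2 * (2 * P.K * P.nS) :=
        mul_le_mul_of_nonneg_left hS.N_le (sq_nonneg _)
      have h2 : 2 * P.K * (P.hbar * √(P.logp / P.nT)) ≤ 1 := by
        have h3 : P.hbar * √(P.logp / P.nT) ≤ P.s * P.logp / P.nS := hcond
        have := mul_le_mul_of_nonneg_left h3 (by positivity : (0 : ℝ) ≤ 2 * P.K)
        linarith
      have h3 : (√(P.logp / P.nT) * P.hbar) ^ 2 * (2 * P.K) ≤ P.hbar * √(P.logp / P.nT) := by
        have := mul_le_mul_of_nonneg_left h2 hH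
        linarith
      have h4 := mul_le_mul_of_nonneg_right h3 hnS.le
      have h5 := mul_nonneg hR hnS.le
      linarith
  · rw [lam0TwoStep, weightTwoStep, if_neg hcond, if_neg hcond] at hb'
    -- With g = 1 the sparse part of the rate is s log p / n_S, which is dominated by h̄√(log p /
    -- n_T) when `CondA` fails.
    have hcond' : P.s * P.logp / P.nS < P.hbar * √(P.logp / P.nT) := not_le.1 hcond
    rw [← mul_one (c0 * √(P.logp / P.nS)), ← div_one (8 * ((P.nS : ℝ) / P.N))] at hb'
    refine hE.two_step_bound_aux hS hΘ hA hc0 hc1 hη hCT hρ hS.share_le_one le_rfl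
      (by linarith) (by linarith) hX3 ?_ ?_ hb' hD1 hD2 hD3 hδ
    · rw [mul_one, hS.tau_sq, ← mul_div_assoc]
      linarith
    · rw [div_one]
      have := mul_le_mul_of_nonneg_left hS.small_shift hH
      linarith [show (√(P.logp / P.nT) * P.hbar) ^ 2 =
        P.hbar * √(P.logp / P.nT) * (P.hbar * √(P.logp / P.nT)) by ring]

/-- Error bound of the combined method. -/
theorem combined_bound {A C_T c0 c1 κ : ℝ} (hA : 1 ≤ A) (hc0 : 0 < c0) (hc1 : 0 < c1)
    (hCT : 1 ≤ C_T) (hκ : 0 < κ) :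
    ∃ C > (0 : ℝ), ∀ (P : TransferProblem.{u}) (η : ℝ) (ω : P.Ω)
      (o : Fin (P.K + 1) → Fin P.p → ℝ) (G : Finset (Fin (P.K + 1))),
      P.GoodEvent A c0 c1 η ω o G → P.SizeConditions A C_T → P.InParameterSpace → 0 ≤ η →
      3 * A ^ 2 * √P.p * η ≤ 1 / 24 → 32 * A ^ 4 * (3 * A ^ 2 * √P.p * η) ≤ 1 →
      ∀ b, P.IsCombined κ c0 c1 ω b → l2NormSq (b - P.β 0) ≤
        C * (P.s * P.logp / P.N + min (P.hbar * √(P.logp / P.nT)) (P.hbar ^ 2)) := by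
  set C1 := 4 * (2 * (94 * c0 * A ^ 2) ^ 2 + 2 * (3000 * A ^ 4) ^ 2) + 6 with hC1
  set D := 3 * (64 * c0 * A ^ 2) ^ 2 + 3 * (A ^ 2 * (128 * c0)) + 3 * (500 * A) ^ 2 +
    (2 * (1536 * c0 * A ^ 2) ^ 2 * C_T + 2 * 340 ^ 2) + C_T with hD
  set C2 := 8 * D + 6 * A ^ 2 * (32 * A ^ 2 * D + 8 * c1 + 128 * A ^ 4 * D ^ 2 / c1 ^ 2 + 16)
    with hC2
  have hD0 : 0 < D := by positivity
  have hC10 : 0 < C1 := by positivity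
  have hC20 : 0 < C2 := by positivity
  have hsκ : 0 < √κ := Real.sqrt_pos.2 hκ
  refine ⟨C1 * (1 + √κ) + C2 * (1 + 1 / √κ), by positivity, ?_⟩
  intro P η ω o G hE hS hΘ hη hρ hρA b hb
  have hhb := hS.hbar_nonneg hΘ
  have hτT := hS.tauT_pos
  have hR : 0 ≤ P.s * P.logp / P.N :=
    div_nonneg (mul_nonneg (Nat.cast_nonneg _) hS.logp_pos.le) hS.N_pos.le
  have hsplit : ∀ {c x : ℝ}, 0 ≤ x → 1 ≤ c →
      x ≤ c * min (P.hbar * √(P.logp / P.nT)) (P.hbar ^ 2) → P.s * P.logp / P.N + x ≤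
      c * (P.s * P.logp / P.N + min (P.hbar * √(P.logp / P.nT)) (P.hbar ^ 2)) := by
    intro c x hx hc hxc
    have := mul_le_mul_of_nonneg_right hc hR
    linarith
  have hmin0 : 0 ≤ min (P.hbar * √(P.logp / P.nT)) (P.hbar ^ 2) :=
    le_min (by positivity) (by positivity)
  have hZ : 0 ≤ P.s * P.logp / P.N + min (P.hbar * √(P.logp / P.nT)) (P.hbar ^ 2) := by
    linarith
  -- The threshold compares h̄ with √κ √(log p / n_T). Below it, h̄² exceeds the minimum by at most
  -- a factor 1 + √κ; above it, h̄√(log p / n_T) does so by at most 1 + 1/√κ.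
  rcases hb with ⟨hreg, hb⟩ | ⟨hreg, hb⟩
  · have h1 := hE.one_step_bound hS hΘ hA hc0 hη hρ hρA hb
    have h2 : P.hbar ≤ √κ * √(P.logp / P.nT) := by
      rw [← Real.sqrt_mul hκ.le]
      refine Real.le_sqrt_of_sq_le ?_
      rw [← mul_div_assoc, le_div_iff₀ hS.nT_pos']
      linarith
    have h3 : P.hbar ^ 2 ≤ (1 + √κ) * min (P.hbar * √(P.logp / P.nT)) (P.hbar ^ 2) := by
      rw [mul_min_of_nonneg _ _ (by positivity)]
      refine le_min ?_ ?_
      · have h4 := mul_le_mul_of_nonneg_left h2 hhb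
        have : 0 ≤ P.hbar * √(P.logp / P.nT) := by positivity
        linarith [sq P.hbar]
      · have : 0 ≤ √κ * P.hbar ^ 2 := by positivity
        linarith
    have h4 := hsplit (sq_nonneg _) (by linarith) h3
    have h5 := mul_le_mul_of_nonneg_left h4 hC10.le
    have h6 : 0 ≤ C2 * (1 + 1 / √κ) *
      (P.s * P.logp / P.N + min (P.hbar * √(P.logp / P.nT)) (P.hbar ^ 2)) := by positivity
    linarith
  · have h1 := hE.two_step_bound hS hΘ hA hc0 hc1 hη hCT hρ (D := D)
      (by have : 0 ≤ (1536 * c0 * A ^ 2) ^ 2 * C_T := by positivity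
          linarith)
      (by have : 0 ≤ 3 * (64 * c0 * A ^ 2) ^ 2 + 3 * (A ^ 2 * (128 * c0)) + 3 * (500 * A) ^ 2 := by
            positivity
          linarith)
      (by have : 0 ≤ 3 * (64 * c0 * A ^ 2) ^ 2 + 3 * (A ^ 2 * (128 * c0)) + 3 * (500 * A) ^ 2 +
            (2 * (1536 * c0 * A ^ 2) ^ 2 * C_T + 2 * 340 ^ 2) := by positivity
          linarith) hb
    have h2 : √κ * √(P.logp / P.nT) ≤ P.hbar := by
      rw [← Real.sqrt_mul hκ.le]
      refine Real.sqrt_le_iff.2 ⟨hhb, ?_⟩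
      rw [← mul_div_assoc, div_le_iff₀ hS.nT_pos']
      linarith
    have h3 : P.hbar * √(P.logp / P.nT) ≤
        (1 + 1 / √κ) * min (P.hbar * √(P.logp / P.nT)) (P.hbar ^ 2) := by
      rw [mul_min_of_nonneg _ _ (by positivity)]
      refine le_min ?_ ?_
      · have : 0 ≤ 1 / √κ * (P.hbar * √(P.logp / P.nT)) := by positivity
        linarith
      · have h4 : √(P.logp / P.nT) ≤ 1 / √κ * P.hbar := by
          rw [one_div, inv_mul_eq_div, le_div_iff₀ hsκ]
          linarith
        have h5 := mul_le_mul_of_nonneg_left h4 hhb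
        have : 0 ≤ P.hbar ^ 2 := by positivity
        linarith [sq P.hbar]
    have h4 := hsplit (by positivity) (by have : 0 ≤ 1 / √κ := by positivity
                                          linarith) h3
    have h5 := mul_le_mul_of_nonneg_left h4 hC20.le
    have h6 : 0 ≤ C1 * (1 + √κ) *
      (P.s * P.logp / P.N + min (P.hbar * √(P.logp / P.nT)) (P.hbar ^ 2)) := by positivity
    linarith

end GoodEvent

end TransferProblem

/-! ### Restricted eigenvalues from finitely many vectors, by Maurey's empirical method -/

section Maurey

variable {p : ℕ}

/-- `± e_j`. -/
def signedBasis (j : Fin p × Bool) : Fin p → ℝ :=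
  if j.2 then Pi.single j.1 1 else -Pi.single j.1 1

/-- A sum of signed basis vectors. -/
def signedSum {m : ℕ} (J : Fin m → Fin p × Bool) : Fin p → ℝ := ∑ i, signedBasis (J i)

lemma exists_le_of_weighted_sum_le {ι : Type*} [Fintype ι] {w f : ι → ℝ} {c : ℝ}
    (hw : ∀ i, 0 ≤ w i) (hpos : 0 < ∑ i, w i) (h : ∑ i, w i * f i ≤ (∑ i, w i) * c) :
    ∃ i, f i ≤ c := by
  by_contra hcon
  push Not at hcon
  obtain ⟨i, -, hi⟩ := Finset.exists_lt_of_sum_lt (s := Finset.univ) (f := fun _ => (0 : ℝ))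
    (g := w) (by simpa using hpos)
  have : ∑ i, w i * c < ∑ i, w i * f i :=
    Finset.sum_lt_sum (fun j _ => mul_le_mul_of_nonneg_left (hcon j).le (hw j))
      ⟨i, Finset.mem_univ i, mul_lt_mul_of_pos_left (hcon i) hi⟩
  rw [← Finset.sum_mul] at this
  linarith

lemma bilin_signedBasis (Q : LinearMap.BilinForm ℝ (Fin p → ℝ)) (j : Fin p × Bool) :
    Q (signedBasis j) (signedBasis j) = Q (Pi.single j.1 1) (Pi.single j.1 1) := by
  unfold signedBasis
  split_ifs <;> simp

lemma sum_abs_smul_signedBasis (u : Fin p → ℝ) :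
    ∑ j, |u j| • signedBasis (j, decide (0 ≤ u j)) = u := by
  conv_rhs => rw [pi_eq_sum_univ' u]
  refine Finset.sum_congr rfl fun j _ => ?_
  unfold signedBasis
  by_cases h : 0 ≤ u j
  · simp [h, abs_of_nonneg h]
  · simp [h, abs_of_neg (not_le.1 h)]

/-- Maurey's sampling, derandomized draw by draw: drawing j with probability |u_j|/‖u‖₁ gives a
signed basis vector with mean u/‖u‖₁, and some outcome is no worse than the average. The base point
x is arbitrary because each draw moves it. -/
lemma exists_signedSum_le_step {Q : LinearMap.BilinForm ℝ (Fin p → ℝ)}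
    (hs : ∀ u v, Q u v = Q v u) {u : Fin p → ℝ} (hu : 0 < l1Norm u) (t : ℝ) (k : ℕ) :
    ∀ x : Fin p → ℝ, ∃ J : Fin k → Fin p × Bool,
      Q (x + (t * l1Norm u) • signedSum J) (x + (t * l1Norm u) • signedSum J) ≤
        Q (x + (k * t) • u) (x + (k * t) • u) +
          k * t ^ 2 * (l1Norm u * ∑ j, |u j| * Q (Pi.single j 1) (Pi.single j 1) - Q u u) := by
  induction k with
  | zero => intro x; exact ⟨Fin.elim0, by simp [signedSum]⟩
  | succ k ih =>
    intro x
    set R := l1Norm u with hR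
    set y := x + (k * t) • u with hy
    have hav : ∑ j, |u j| * Q (y + (t * R) • signedBasis (j, decide (0 ≤ u j)))
        (y + (t * R) • signedBasis (j, decide (0 ≤ u j))) ≤ (∑ j, |u j|) *
        (Q y y + 2 * t * Q y u + t ^ 2 * (R * ∑ j, |u j| * Q (Pi.single j 1) (Pi.single j 1))) := by
      have h1 : ∀ j, |u j| * Q (y + (t * R) • signedBasis (j, decide (0 ≤ u j)))
          (y + (t * R) • signedBasis (j, decide (0 ≤ u j))) =
          |u j| * Q y y + 2 * (t * R) * Q y (|u j| • signedBasis (j, decide (0 ≤ u j)))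
            + (t * R) ^ 2 * (|u j| * Q (Pi.single j 1) (Pi.single j 1)) := by
        intro j
        simp only [map_add, map_smul, LinearMap.add_apply, LinearMap.smul_apply, smul_eq_mul,
          hs (signedBasis _) y, bilin_signedBasis]
        ring
      simp only [h1, Finset.sum_add_distrib, ← Finset.mul_sum, ← Finset.sum_mul, ← map_sum,
        sum_abs_smul_signedBasis]
      change _ ≤ R * _
      rw [show ∑ j, |u j| = R from rfl]
      refine le_of_eq ?_
      ring
    obtain ⟨j, hj⟩ := exists_le_of_weighted_sum_le (fun j => abs_nonneg (u j)) hu hav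
    obtain ⟨J, hJ⟩ := ih (x + (t * R) • signedBasis (j, decide (0 ≤ u j)))
    refine ⟨Fin.cons (j, decide (0 ≤ u j)) J, ?_⟩
    have e1 : x + (t * R) • signedSum (Fin.cons (j, decide (0 ≤ u j)) J : Fin (k + 1) → _) =
        x + (t * R) • signedBasis (j, decide (0 ≤ u j)) + (t * R) • signedSum J := by
      unfold signedSum
      rw [Fin.sum_univ_succ]
      simp only [Fin.cons_zero, Fin.cons_succ, smul_add]
      abel
    have e2 : x + (t * R) • signedBasis (j, decide (0 ≤ u j)) + (k * t) • u =
        y + (t * R) • signedBasis (j, decide (0 ≤ u j)) := by rw [hy]; abel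
    have e3 : x + ((k + 1 : ℕ) * t) • u = y + t • u := by
      rw [hy]; push_cast; rw [add_mul, one_mul, add_smul]; abel
    rw [e1, e3]
    rw [e2] at hJ
    refine hJ.trans ?_
    simp only [map_add, map_smul, LinearMap.add_apply, LinearMap.smul_apply, smul_eq_mul, hs u y]
      at hj ⊢
    push_cast
    linarith

/-- Maurey's lemma for quadratic forms. -/
lemma exists_signedSum_le {Q : LinearMap.BilinForm ℝ (Fin p → ℝ)}
    (hs : ∀ u v, Q u v = Q v u) {u : Fin p → ℝ} (hu : 0 < l1Norm u) {m : ℕ} (hm : 0 < m) :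
    ∃ J : Fin m → Fin p × Bool,
      (l1Norm u / m) ^ 2 * Q (signedSum J) (signedSum J) ≤ Q u u +
          (l1Norm u * ∑ j, |u j| * Q (Pi.single j 1) (Pi.single j 1) - Q u u) / m := by
  obtain ⟨J, hJ⟩ := exists_signedSum_le_step hs hu ((m : ℝ)⁻¹) m 0
  refine ⟨J, ?_⟩
  have hm' : (m : ℝ) ≠ 0 := by positivity
  simp only [zero_add, map_smul, LinearMap.smul_apply, smul_eq_mul, mul_inv_cancel₀ hm',
    one_smul] at hJ
  calc _ = (m : ℝ)⁻¹ * l1Norm u * ((m : ℝ)⁻¹ * l1Norm u * Q (signedSum J) (signedSum J)) := by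
        field_simp
    _ ≤ _ := hJ
    _ = _ := by field_simp

/-- A form that is nonnegative on sums of `m` signed basis vectors is almost nonnegative. -/
lemma neg_le_of_signedSum_nonneg {Q : LinearMap.BilinForm ℝ (Fin p → ℝ)}
    (hs : ∀ u v, Q u v = Q v u) {m : ℕ} (hm : 2 ≤ m) {B : ℝ} (hB0 : 0 ≤ B)
    (hJ : ∀ J : Fin m → Fin p × Bool, 0 ≤ Q (signedSum J) (signedSum J))
    (hB : ∀ j, Q (Pi.single j 1) (Pi.single j 1) ≤ B) (u : Fin p → ℝ) :
    -(2 * B / m * l1Norm u ^ 2) ≤ Q u u := by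
  rcases (l1Norm_nonneg u).eq_or_lt with h0 | h0
  · have hu : u = 0 := by
      ext j
      have := (Finset.sum_eq_zero_iff_of_nonneg fun j _ => abs_nonneg (u j)).1 h0.symm j
        (Finset.mem_univ j)
      simpa using this
    simp [hu, l1Norm_zero]
  · obtain ⟨J, h1⟩ := exists_signedSum_le hs h0 (m := m) (by omega)
    have hm' : (2 : ℝ) ≤ m := by exact_mod_cast hm
    have h2 : 0 ≤ (l1Norm u / m) ^ 2 * Q (signedSum J) (signedSum J) :=
      mul_nonneg (sq_nonneg _) (hJ J)
    have h3 : ∑ j, |u j| * Q (Pi.single j 1) (Pi.single j 1) ≤ l1Norm u * B := by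
      rw [l1Norm, Finset.sum_mul]
      exact Finset.sum_le_sum fun j _ => mul_le_mul_of_nonneg_left (hB j) (abs_nonneg _)
    have h4 := mul_le_mul_of_nonneg_left h3 h0.le
    have hmpos : (0 : ℝ) < m := by linarith
    -- The variance term subtracts Q u u / m, leaving the coefficient m - 1; hence the assumption m
    -- ≥ 2 and the factor 2 in the bound.
    have h5 : 0 ≤ (m - 1) * Q u u + l1Norm u ^ 2 * B := by
      have h7 : 0 ≤ m * (Q u u + (l1Norm u * ∑ j, |u j| * Q (Pi.single j 1) (Pi.single j 1)
          - Q u u) / m) := mul_nonneg hmpos.le (h2.trans h1)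
      rw [mul_add, mul_div_cancel₀ _ hmpos.ne'] at h7
      nlinarith
    rcases le_or_gt 0 (Q u u) with hq | hq
    · have : 0 ≤ 2 * B / m * l1Norm u ^ 2 := by positivity
      linarith
    · have h6 : m * Q u u + 2 * B * l1Norm u ^ 2 ≥ 0 := by nlinarith
      have h7 : Q u u + 2 * B / m * l1Norm u ^ 2 = (m * Q u u + 2 * B * l1Norm u ^ 2) / m := by
        field_simp
      have : 0 ≤ Q u u + 2 * B / m * l1Norm u ^ 2 := by rw [h7]; positivity
      linarith

/-- The form `Q - a ⟨·, ·⟩`. -/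
lemma toBilin'_one_apply (u v : Fin p → ℝ) :
    Matrix.toBilin' (1 : Matrix (Fin p) (Fin p) ℝ) u v = u ⬝ᵥ v := by
  rw [Matrix.toBilin'_apply', Matrix.one_mulVec]

/-- `neg_le_of_signedSum_nonneg` applied to Q - a⟨·,·⟩, whose diagonal is at most that of Q. -/
lemma le_add_of_signedSum_ge {Q : LinearMap.BilinForm ℝ (Fin p → ℝ)}
    (hs : ∀ u v, Q u v = Q v u) {m : ℕ} (hm : 2 ≤ m) {a B : ℝ} (ha : 0 ≤ a) (hB0 : 0 ≤ B)
    (hJ : ∀ J : Fin m → Fin p × Bool, a * l2NormSq (signedSum J) ≤ Q (signedSum J) (signedSum J))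
    (hB : ∀ j, Q (Pi.single j 1) (Pi.single j 1) ≤ B) (u : Fin p → ℝ) :
    a * l2NormSq u ≤ Q u u + 2 * B / m * l1Norm u ^ 2 := by
  have h := neg_le_of_signedSum_nonneg (Q := Q - a • Matrix.toBilin' 1) (m := m) (B := B)
    (fun u v => by simp [toBilin'_one_apply, hs u v, dotProduct_comm u v]) hm hB0
    (fun J => by
      have := hJ J
      rw [l2NormSq_eq_dotProduct] at this
      simpa [toBilin'_one_apply] using this)
    (fun j => by
      have := hB j
      have : Pi.single j (1 : ℝ) ⬝ᵥ (Pi.single j 1 : Fin p → ℝ) = 1 := by simp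
      simp only [LinearMap.sub_apply, LinearMap.smul_apply, toBilin'_one_apply, this, smul_eq_mul]
      linarith) u
  simp only [LinearMap.sub_apply, LinearMap.smul_apply, toBilin'_one_apply, smul_eq_mul,
    ← l2NormSq_eq_dotProduct] at h
  linarith

/-- `neg_le_of_signedSum_nonneg` applied to B⟨·,·⟩ - Q. -/
lemma ge_of_signedSum_le {Q : LinearMap.BilinForm ℝ (Fin p → ℝ)}
    (hs : ∀ u v, Q u v = Q v u) (hn : ∀ u, 0 ≤ Q u u) {m : ℕ} (hm : 2 ≤ m) {B : ℝ} (hB0 : 0 ≤ B)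
    (hJ : ∀ J : Fin m → Fin p × Bool, Q (signedSum J) (signedSum J) ≤ B * l2NormSq (signedSum J))
    (u : Fin p → ℝ) :
    Q u u ≤ B * l2NormSq u + 2 * B / m * l1Norm u ^ 2 := by
  have h := neg_le_of_signedSum_nonneg (Q := B • Matrix.toBilin' 1 - Q) (m := m) (B := B)
    (fun u v => by simp [toBilin'_one_apply, hs u v, dotProduct_comm u v]) hm hB0
    (fun J => by
      have := hJ J
      rw [l2NormSq_eq_dotProduct] at this
      simpa [toBilin'_one_apply] using this)
    (fun j => by
      have := hn (Pi.single j 1)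
      have h1 : Pi.single j (1 : ℝ) ⬝ᵥ (Pi.single j 1 : Fin p → ℝ) = 1 := by simp
      simp only [LinearMap.sub_apply, LinearMap.smul_apply, toBilin'_one_apply, h1, smul_eq_mul]
      linarith) u
  simp only [LinearMap.sub_apply, LinearMap.smul_apply, toBilin'_one_apply, smul_eq_mul,
    ← l2NormSq_eq_dotProduct] at h
  linarith

/-- The multiple m e_j is itself a sum of m signed basis vectors. -/
lemma diag_le_of_signedSum_le {Q : LinearMap.BilinForm ℝ (Fin p → ℝ)} {m : ℕ} (hm : 0 < m)
    {B : ℝ}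
    (hJ : ∀ J : Fin m → Fin p × Bool, Q (signedSum J) (signedSum J) ≤ B * l2NormSq (signedSum J))
    (j : Fin p) : Q (Pi.single j 1) (Pi.single j 1) ≤ B := by
  have h := hJ fun _ => (j, true)
  have h1 : signedSum (fun _ : Fin m => (j, true)) = (m : ℝ) • Pi.single j 1 := by
    simp [signedSum, signedBasis, ← Nat.cast_smul_eq_nsmul ℝ]
  rw [h1, l2NormSq_smul, l2NormSq_single] at h
  simp only [map_smul, LinearMap.smul_apply, smul_eq_mul] at h
  have hm' : (0 : ℝ) < m := by exact_mod_cast hm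
  refine le_of_mul_le_mul_left ?_ (by positivity : (0 : ℝ) < m ^ 2)
  linarith

end Maurey

/-! ### Tails of sums of squares of sub-Gaussian variables -/

section SquareTails

/-- (1 + x + x²/2)(1 - x + x²/2) = 1 + x⁴/4 ≥ 1, and the first factor is at most exp x. -/
lemma exp_neg_le_quadratic {x : ℝ} (hx : 0 ≤ x) : Real.exp (-x) ≤ 1 - x + x ^ 2 / 2 := by
  have h1 := Real.quadratic_le_exp_of_nonneg hx
  have h2 : 0 < 1 + x + x ^ 2 / 2 := by positivity
  rw [Real.exp_neg]
  refine (inv_anti₀ h2 h1).trans ?_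
  rw [inv_le_iff_one_le_mul₀ h2]
  nlinarith [sq_nonneg (x ^ 2)]

lemma pow_four_le_exp_add_exp (z : ℝ) : z ^ 4 ≤ 24 * (Real.exp (1 * z) + Real.exp (-1 * z)) := by
  have h1 := Real.pow_div_factorial_le_exp |z| (abs_nonneg z) 4
  have h2 : Real.exp |z| ≤ Real.exp (1 * z) + Real.exp (-1 * z) := by
    rcases abs_cases z with ⟨h, -⟩ | ⟨h, -⟩
    · rw [h, one_mul]; linarith [Real.exp_pos (-1 * z)]
    · rw [h, neg_one_mul]; linarith [Real.exp_pos (1 * z)]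
  have h3 : |z| ^ 4 = z ^ 4 := by rw [← abs_pow, abs_of_nonneg (by positivity)]
  rw [h3, div_le_iff₀ (by positivity)] at h1
  norm_num [Nat.factorial] at h1
  linarith

variable {Ω : Type*} {mΩ : MeasurableSpace Ω} {μ : Measure Ω} {Z : Ω → ℝ} {L : ℝ≥0}

lemma integrable_pow_four (hZ : HasSubgaussianMGF Z L μ) : Integrable (fun ω => Z ω ^ 4) μ := by
  refine (((hZ.integrable_exp_mul 1).add (hZ.integrable_exp_mul (-1))).const_mul 24).mono'
    (hZ.aestronglyMeasurable.pow 4) (ae_of_all _ fun ω => ?_)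
  rw [Real.norm_of_nonneg (by positivity)]
  exact pow_four_le_exp_add_exp (Z ω)

lemma integral_pow_four_le (hZ : HasSubgaussianMGF Z L μ) :
    ∫ ω, Z ω ^ 4 ∂μ ≤ 48 * Real.exp (L / 2) := by
  have h1 := hZ.mgf_le 1
  have h2 := hZ.mgf_le (-1)
  calc ∫ ω, Z ω ^ 4 ∂μ ≤ ∫ ω, 24 * (Real.exp (1 * Z ω) + Real.exp (-1 * Z ω)) ∂μ :=
        integral_mono (integrable_pow_four hZ)
          (((hZ.integrable_exp_mul 1).add (hZ.integrable_exp_mul (-1))).const_mul 24)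
          fun ω => pow_four_le_exp_add_exp (Z ω)
    _ = 24 * (mgf Z μ 1 + mgf Z μ (-1)) := by
        rw [integral_const_mul, integral_add (hZ.integrable_exp_mul 1) (hZ.integrable_exp_mul (-1))]
        rfl
    _ ≤ _ := by
        norm_num at h1 h2
        linarith

lemma integrable_sq [IsFiniteMeasure μ] (hZ : HasSubgaussianMGF Z L μ) :
    Integrable (fun ω => Z ω ^ 2) μ :=
  (hZ.memLp 2).integrable_sq

/-- As Z² ≥ 0, the exponential with negative parameter is bounded by its second-order expansion, so
a fourth moment suffices. -/
lemma mgf_sq_neg_le [IsProbabilityMeasure μ] (hZ : HasSubgaussianMGF Z L μ) {m lam : ℝ}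
    (hlam : 0 ≤ lam) (hm : m ≤ ∫ ω, Z ω ^ 2 ∂μ) :
    mgf (fun ω => Z ω ^ 2) μ (-lam)
      ≤ Real.exp (-lam * m + lam ^ 2 * (24 * Real.exp (L / 2))) := by
  have hpt : ∀ ω, Real.exp (-lam * Z ω ^ 2) ≤ 1 - lam * Z ω ^ 2 + lam ^ 2 / 2 * Z ω ^ 4 := by
    intro ω
    have := exp_neg_le_quadratic (by positivity : 0 ≤ lam * Z ω ^ 2)
    rw [neg_mul]
    linarith [show (lam * Z ω ^ 2) ^ 2 = lam ^ 2 * Z ω ^ 4 by ring]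
  have i1 : Integrable (fun ω => 1 - lam * Z ω ^ 2) μ :=
    (integrable_const _).sub ((integrable_sq hZ).const_mul lam)
  have i2 : Integrable (fun ω => lam ^ 2 / 2 * Z ω ^ 4) μ :=
    (integrable_pow_four hZ).const_mul _
  have i3 : Integrable (fun ω => Real.exp (-lam * Z ω ^ 2)) μ := by
    refine (integrable_const (1 : ℝ)).mono' ?_ (ae_of_all _ fun ω => ?_)
    · exact (Real.continuous_exp.comp_aestronglyMeasurable
        ((hZ.aestronglyMeasurable.pow 2).const_mul (-lam)))
    · rw [Real.norm_of_nonneg (Real.exp_pos _).le, Real.exp_le_one_iff]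
      nlinarith [sq_nonneg (Z ω)]
  have h1 : mgf (fun ω => Z ω ^ 2) μ (-lam) ≤
      ∫ ω, (1 - lam * Z ω ^ 2 + lam ^ 2 / 2 * Z ω ^ 4) ∂μ :=
    integral_mono i3 (i1.add i2) hpt
  rw [integral_add i1 i2, integral_sub (integrable_const _) ((integrable_sq hZ).const_mul lam),
    integral_const_mul, integral_const_mul] at h1
  simp only [integral_const, probReal_univ, smul_eq_mul, mul_one] at h1
  have h2 := integral_pow_four_le hZ
  have h3 := mul_le_mul_of_nonneg_left hm hlam
  have h4 := mul_le_mul_of_nonneg_left h2 (by positivity : 0 ≤ lam ^ 2 / 2)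
  have h5 := Real.add_one_le_exp (-lam * m + lam ^ 2 * (24 * Real.exp (L / 2)))
  linarith

/-- Exponential moment of the square of a sub-Gaussian variable. -/
lemma lintegral_exp_sq_le [IsProbabilityMeasure μ] (hZ : HasSubgaussianMGF Z L μ) :
    ∫⁻ ω, ENNReal.ofReal (Real.exp (1 / (2 * (L + 1)) * Z ω ^ 2)) ∂μ
      ≤ ENNReal.ofReal (√(L + 1)) := by
  set v : ℝ≥0 := 1 / (L + 1) with hv
  have hv0 : v ≠ 0 := by positivity
  have hvr : (v : ℝ) = 1 / ((L : ℝ) + 1) := by simp [hv]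
  have hL : (0 : ℝ) < (L : ℝ) + 1 := by positivity
  -- The square is linearized with an independent Gaussian g of variance 1/(L+1): exp(z²/(2(L+1))) =
  -- E exp(z g). After Fubini, the sub-Gaussian bound for Z leaves E exp(L g²/2), finite because
  -- L/(L+1) < 1.
  have h1 : ∀ z : ℝ, ENNReal.ofReal (Real.exp (1 / (2 * ((L : ℝ) + 1)) * z ^ 2)) =
      ∫⁻ g, ENNReal.ofReal (Real.exp (z * g)) ∂(gaussianReal 0 v) := by
    intro z
    rw [← ofReal_integral_eq_lintegral_ofReal (integrable_exp_mul_gaussianReal z)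
      (ae_of_all _ fun _ => (Real.exp_pos _).le)]
    congr 1
    have h2 := congrFun (mgf_fun_id_gaussianReal (μ := 0) (v := v)) z
    rw [mgf] at h2
    rw [h2, hvr]
    congr 1
    field_simp
    ring
  simp only [h1]
  rw [lintegral_lintegral_swap]
  swap
  · have hm : AEMeasurable (fun q : Ω × ℝ => Z q.1 * q.2) (μ.prod (gaussianReal 0 v)) :=
      (hZ.aemeasurable.comp_fst).mul measurable_snd.aemeasurable
    exact (Real.measurable_exp.comp_aemeasurable hm).ennreal_ofReal
  have h3 : ∀ g : ℝ, ∫⁻ ω, ENNReal.ofReal (Real.exp (Z ω * g)) ∂μ ≤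
      ENNReal.ofReal (Real.exp (L * g ^ 2 / 2)) := by
    intro g
    have hi := hZ.integrable_exp_mul g
    simp only [mul_comm (Z _) g]
    rw [← ofReal_integral_eq_lintegral_ofReal hi (ae_of_all _ fun _ => (Real.exp_pos _).le)]
    exact ENNReal.ofReal_le_ofReal (hZ.mgf_le g)
  refine (lintegral_mono h3).trans ?_
  rw [gaussianReal_of_var_ne_zero _ hv0, lintegral_withDensity_eq_lintegral_mul _
    (measurable_gaussianPDF _ _) (by fun_prop)]
  have h4 : ∀ g : ℝ, (gaussianPDF 0 v * fun g : ℝ => ENNReal.ofReal (Real.exp (L * g ^ 2 / 2))) g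
      = ENNReal.ofReal ((√(2 * Real.pi * v))⁻¹ * Real.exp (-(1 / 2) * g ^ 2)) := by
    intro g
    rw [Pi.mul_apply, gaussianPDF, ← ENNReal.ofReal_mul (gaussianPDFReal_nonneg _ _ _),
      gaussianPDFReal, mul_assoc, ← Real.exp_add, hvr]
    congr 3
    field_simp
    ring
  simp only [h4]
  rw [← ofReal_integral_eq_lintegral_ofReal
    ((integrable_exp_neg_mul_sq (by norm_num)).const_mul _) (ae_of_all _ fun _ => by positivity),
    integral_const_mul, integral_gaussian]
  refine ENNReal.ofReal_le_ofReal (le_of_eq ?_)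
  rw [hvr, ← Real.sqrt_inv, ← Real.sqrt_mul (by positivity)]
  congr 1
  have := Real.pi_pos.ne'
  field_simp

lemma integrable_exp_sq [IsProbabilityMeasure μ] (hZ : HasSubgaussianMGF Z L μ) :
    Integrable (fun ω => Real.exp (1 / (2 * (L + 1)) * Z ω ^ 2)) μ := by
  refine ⟨Real.continuous_exp.comp_aestronglyMeasurable
    ((hZ.aestronglyMeasurable.pow 2).const_mul _), ?_⟩
  rw [hasFiniteIntegral_iff_ofReal (ae_of_all _ fun _ => (Real.exp_pos _).le)]
  exact (lintegral_exp_sq_le hZ).trans_lt ENNReal.ofReal_lt_top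

lemma mgf_sq_le [IsProbabilityMeasure μ] (hZ : HasSubgaussianMGF Z L μ) :
    mgf (fun ω => Z ω ^ 2) μ (1 / (2 * (L + 1))) ≤ Real.exp (L / 2) := by
  have h1 := lintegral_exp_sq_le hZ
  rw [← ofReal_integral_eq_lintegral_ofReal (integrable_exp_sq hZ)
    (ae_of_all _ fun _ => (Real.exp_pos _).le), ENNReal.ofReal_le_ofReal_iff (by positivity)] at h1
  refine h1.trans ?_
  rw [Real.exp_half]
  exact Real.sqrt_le_sqrt (Real.add_one_le_exp _)

variable {n : ℕ} {W : Fin n → Ω → ℝ}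

lemma measureReal_sum_sq_le_le [IsProbabilityMeasure μ] (hind : iIndepFun W μ)
    (hmeas : ∀ i, Measurable (W i)) (hW : ∀ i, HasSubgaussianMGF (W i) L μ) {m lam : ℝ}
    (hlam : 0 ≤ lam) (hm : ∀ i, m ≤ ∫ ω, W i ω ^ 2 ∂μ) :
    μ.real {ω | ∑ i, W i ω ^ 2 ≤ n * (m / 2)} ≤
      Real.exp (-(n * (lam * m / 2 - lam ^ 2 * (24 * Real.exp (L / 2))))) := by
  have hmeas2 : ∀ i, Measurable fun ω => W i ω ^ 2 := fun i => (hmeas i).pow_const 2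
  have hind2 : iIndepFun (fun i ω => W i ω ^ 2) μ :=
    hind.comp (fun _ x => x ^ 2) fun _ => by fun_prop
  have hint : Integrable (fun ω => Real.exp (-lam * (∑ i, fun ω => W i ω ^ 2) ω)) μ := by
    refine (integrable_const (1 : ℝ)).mono' (by fun_prop) (ae_of_all _ fun ω => ?_)
    rw [Real.norm_of_nonneg (Real.exp_pos _).le, Real.exp_le_one_iff, Finset.sum_apply]
    have : 0 ≤ ∑ i, W i ω ^ 2 := Finset.sum_nonneg fun i _ => sq_nonneg _
    nlinarith
  have h1 := measure_le_le_exp_mul_mgf (μ := μ) (X := ∑ i, fun ω => W i ω ^ 2) (n * (m / 2))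
    (by linarith : -lam ≤ 0) hint
  rw [hind2.mgf_sum hmeas2] at h1
  simp only [Finset.sum_apply] at h1
  refine h1.trans ?_
  have h2 : ∏ i, mgf (fun ω => W i ω ^ 2) μ (-lam) ≤
      ∏ _i : Fin n, Real.exp (-lam * m + lam ^ 2 * (24 * Real.exp (L / 2))) :=
    Finset.prod_le_prod (fun i _ => mgf_nonneg) fun i _ => mgf_sq_neg_le (hW i) hlam (hm i)
  rw [Finset.prod_const, Finset.card_univ, Fintype.card_fin, ← Real.exp_nat_mul] at h2
  refine (mul_le_mul_of_nonneg_left h2 (Real.exp_pos _).le).trans (le_of_eq ?_)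
  rw [← Real.exp_add]
  congr 1
  ring

lemma measureReal_le_sum_sq_le [IsProbabilityMeasure μ] (hind : iIndepFun W μ)
    (hmeas : ∀ i, Measurable (W i)) (hW : ∀ i, HasSubgaussianMGF (W i) L μ) (B : ℝ) :
    μ.real {ω | n * B ≤ ∑ i, W i ω ^ 2} ≤
      Real.exp (-(n * (B / (2 * (L + 1)) - L / 2))) := by
  have hmeas2 : ∀ i, Measurable fun ω => W i ω ^ 2 := fun i => (hmeas i).pow_const 2
  have hind2 : iIndepFun (fun i ω => W i ω ^ 2) μ :=
    hind.comp (fun _ x => x ^ 2) fun _ => by fun_prop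
  have hint : Integrable
      (fun ω => Real.exp (1 / (2 * (L + 1)) * (∑ i, fun ω => W i ω ^ 2) ω)) μ :=
    hind2.integrable_exp_mul_sum hmeas2 fun i _ => integrable_exp_sq (hW i)
  have h1 := measure_ge_le_exp_mul_mgf (μ := μ) (X := ∑ i, fun ω => W i ω ^ 2) (n * B)
    (by positivity : (0 : ℝ) ≤ 1 / (2 * (L + 1))) hint
  rw [hind2.mgf_sum hmeas2] at h1
  simp only [Finset.sum_apply] at h1
  refine h1.trans ?_
  have h2 : ∏ i, mgf (fun ω => W i ω ^ 2) μ (1 / (2 * (L + 1))) ≤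
      ∏ _i : Fin n, Real.exp (L / 2) :=
    Finset.prod_le_prod (fun i _ => mgf_nonneg) fun i _ => mgf_sq_le (hW i)
  rw [Finset.prod_const, Finset.card_univ, Fintype.card_fin, ← Real.exp_nat_mul] at h2
  refine (mul_le_mul_of_nonneg_left h2 (Real.exp_pos _).le).trans (le_of_eq ?_)
  rw [← Real.exp_add]
  congr 1
  ring

end SquareTails

/-! ### Restricted eigenvalues of sub-Gaussian designs -/

section DesignTails

lemma Matrix.IsHermitian.le_dotProduct_mulVec {p : ℕ} {M : Matrix (Fin p) (Fin p) ℝ}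
    (hM : M.IsHermitian) {a : ℝ} (ha : ∀ j, a ≤ hM.eigenvalues j) (u : Fin p → ℝ) :
    a * l2NormSq u ≤ u ⬝ᵥ M *ᵥ u := by
  have hin : ∀ x y : EuclideanSpace ℝ (Fin p), inner ℝ x y = x.ofLp ⬝ᵥ y.ofLp := by
    intro x y
    rw [EuclideanSpace.inner_eq_star_dotProduct]
    simp [dotProduct_comm]
  have h1 := hM.eigenvectorBasis.sum_inner_mul_inner (WithLp.toLp 2 u) (WithLp.toLp 2 u)
  have h2 := hM.eigenvectorBasis.sum_inner_mul_inner (WithLp.toLp 2 u) (WithLp.toLp 2 (M *ᵥ u))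
  simp only [hin] at h1 h2
  rw [← h2, l2NormSq_eq_dotProduct, ← h1, Finset.mul_sum]
  refine Finset.sum_le_sum fun i _ => ?_
  have h3 : (hM.eigenvectorBasis i).ofLp ⬝ᵥ M *ᵥ u
      = hM.eigenvalues i * ((hM.eigenvectorBasis i).ofLp ⬝ᵥ u) := by
    have hT : Mᵀ = M := by
      rw [← Matrix.conjTranspose_eq_transpose_of_trivial]; exact hM.eq
    rw [Matrix.dotProduct_mulVec, ← Matrix.mulVec_transpose, hT, hM.mulVec_eigenvectorBasis,
      smul_dotProduct, smul_eq_mul]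
  rw [h3, dotProduct_comm u]
  have := mul_le_mul_of_nonneg_right (ha i)
    (mul_self_nonneg ((hM.eigenvectorBasis i).ofLp ⬝ᵥ u))
  linarith

variable {Ω : Type*} {mΩ : MeasurableSpace Ω} {μ : Measure Ω} {L : ℝ≥0} {n p : ℕ}

/-- The rows are centered, so the second moment in direction u is uᵀ M u, to which the spectral
bound applies. -/
lemma le_integral_dotProduct_sq [IsProbabilityMeasure μ] {Y : Ω → Fin p → ℝ}
    (hsub : ∀ u : Fin p → ℝ, l2NormSq u = 1 → HasSubgaussianMGF (fun ω => Y ω ⬝ᵥ u) L μ)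
    (hmean : ∀ j, ∫ ω, Y ω j ∂μ = 0) {M : Matrix (Fin p) (Fin p) ℝ}
    (hcov : ∀ j l, covariance (fun ω => Y ω j) (fun ω => Y ω l) μ = M j l)
    (hM : M.IsHermitian) {a : ℝ} (ha : ∀ j, a ≤ hM.eigenvalues j) {u : Fin p → ℝ}
    (hu : l2NormSq u = 1) : a ≤ ∫ ω, (Y ω ⬝ᵥ u) ^ 2 ∂μ := by
  have h2 : ∀ j, MemLp (fun ω => Y ω j) 2 μ := fun j => by
    have := (hsub (Pi.single j 1) (by rw [l2NormSq_single, one_pow])).memLp 2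
    simpa using this
  have hint : ∀ j l, Integrable (fun ω => Y ω j * Y ω l) μ := fun j l =>
    (h2 j).integrable_mul (h2 l)
  have h3 : ∫ ω, (Y ω ⬝ᵥ u) ^ 2 ∂μ = u ⬝ᵥ M *ᵥ u := by
    have h4 : ∀ ω, (Y ω ⬝ᵥ u) ^ 2 = ∑ j, ∑ l, (u j * u l) * (Y ω j * Y ω l) := by
      intro ω
      rw [sq, dotProduct, Finset.sum_mul_sum]
      exact Finset.sum_congr rfl fun j _ => Finset.sum_congr rfl fun l _ => by ring
    simp only [h4]
    rw [integral_finsetSum _ fun j _ => integrable_finsetSum _ fun l _ =>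
      (hint j l).const_mul _]
    simp only [dotProduct, Matrix.mulVec, Finset.mul_sum]
    refine Finset.sum_congr rfl fun j _ => ?_
    rw [integral_finsetSum _ fun l _ => (hint j l).const_mul _]
    refine Finset.sum_congr rfl fun l _ => ?_
    rw [integral_const_mul, ← hcov j l, covariance]
    simp only [hmean, sub_zero]
    ring
  rw [h3]
  have := hM.le_dotProduct_mulVec ha u
  rwa [hu, mul_one] at this

/-- The designs with controlled Gram forms on sums of few signed basis vectors. -/
def regularDesigns (n p m1 m2 : ℕ) (a B : ℝ) : Set (Fin n → Fin p → ℝ) :=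
  {x | (∀ J : Fin m1 → Fin p × Bool, a * l2NormSq (signedSum J)
      ≤ Matrix.toBilin' (gramMatrix x) (signedSum J) (signedSum J)) ∧
    ∀ J : Fin m2 → Fin p × Bool, Matrix.toBilin' (gramMatrix x) (signedSum J) (signedSum J)
      ≤ B * l2NormSq (signedSum J)}

lemma continuous_toBilin'_gramMatrix (u v : Fin p → ℝ) :
    Continuous fun x : Fin n → Fin p → ℝ => Matrix.toBilin' (gramMatrix x) u v := by
  simp only [toBilin'_gramMatrix, dotProduct]
  fun_prop

lemma measurableSet_regularDesigns (m1 m2 : ℕ) (a B : ℝ) :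
    MeasurableSet (regularDesigns n p m1 m2 a B) := by
  refine IsClosed.measurableSet ?_
  simp only [regularDesigns, Set.ofPred_and, Set.ofPred_forall]
  exact (isClosed_iInter fun J => isClosed_le continuous_const
    (continuous_toBilin'_gramMatrix _ _)).inter
    (isClosed_iInter fun J => isClosed_le (continuous_toBilin'_gramMatrix _ _) continuous_const)

lemma unit_vector_tails [IsProbabilityMeasure μ] {X : Fin n → Ω → Fin p → ℝ}
    (hmeas : ∀ i, Measurable (X i)) (hind : iIndepFun X μ)
    (hsub : ∀ i (u : Fin p → ℝ), l2NormSq u = 1 → HasSubgaussianMGF (fun ω => X i ω ⬝ᵥ u) L μ)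
    {a : ℝ} (ha : 0 < a)
    (hsq : ∀ i (u : Fin p → ℝ), l2NormSq u = 1 → a ≤ ∫ ω, (X i ω ⬝ᵥ u) ^ 2 ∂μ) (hn : 0 < n) (B : ℝ)
    (u : Fin p → ℝ) :
    μ.real {ω | Matrix.toBilin' (gramMatrix fun i => X i ω) u u < a / 2 * l2NormSq u} ≤
        Real.exp (-(n * (a ^ 2 / (384 * Real.exp (L / 2))))) ∧
    μ.real {ω | B * l2NormSq u < Matrix.toBilin' (gramMatrix fun i => X i ω) u u} ≤
        Real.exp (-(n * (B / (2 * (L + 1)) - L / 2))) := by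
  rcases (l2NormSq_nonneg u).eq_or_lt with h0 | h0
  · have hu : u = 0 := by
      ext j
      have := (Finset.sum_eq_zero_iff_of_nonneg fun j _ => sq_nonneg (u j)).1 h0.symm j
        (Finset.mem_univ j)
      simpa using this
    subst hu
    simp [l2NormSq, Real.exp_nonneg]
  set r := √(l2NormSq u) with hr
  have hr0 : 0 < r := Real.sqrt_pos.2 h0
  have hr2 : r ^ 2 = l2NormSq u := Real.sq_sqrt h0.le
  set e := r⁻¹ • u with he
  have he1 : l2NormSq e = 1 := by
    rw [he, l2NormSq_smul, ← hr2]; field_simp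
  have hue : u = r • e := by rw [he, smul_inv_smul₀ hr0.ne']
  have hn' : (0 : ℝ) < n := by exact_mod_cast hn
  have hm' : ∀ i, Measurable fun ω => X i ω ⬝ᵥ e := fun i => by
    simp only [dotProduct]
    exact Finset.measurable_sum _ fun j _ => ((measurable_pi_apply j).comp (hmeas i)).mul_const _
  have hind' : iIndepFun (fun i ω => X i ω ⬝ᵥ e) μ :=
    hind.comp (fun _ x => x ⬝ᵥ e) fun _ => by simp only [dotProduct]; fun_prop
  have hQ : ∀ ω, Matrix.toBilin' (gramMatrix fun i => X i ω) u u =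
      l2NormSq u * ((∑ i, (X i ω ⬝ᵥ e) ^ 2) / n) := by
    intro ω
    rw [toBilin'_gramMatrix, ← hr2]
    conv_lhs => rw [hue]
    simp only [dotProduct_smul, smul_eq_mul]
    rw [← mul_div_assoc, Finset.mul_sum]
    congr 1
    exact Finset.sum_congr rfl fun i _ => by ring
  constructor
  -- This `lam` maximizes lam a/2 - 24 lam² exp(L/2); the maximum is a²/(384 exp(L/2)).
  · have h1 := measureReal_sum_sq_le_le hind' hm' (fun i => hsub i e he1) (m := a)
      (lam := a / (96 * Real.exp (L / 2))) (by positivity) fun i => hsq i e he1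
    refine (measureReal_mono ?_).trans (h1.trans (le_of_eq ?_))
    · intro ω hω
      simp only [Set.mem_ofPred_eq, hQ] at hω ⊢
      rw [mul_comm (a / 2), mul_lt_mul_iff_right₀ h0, div_lt_iff₀ hn'] at hω
      linarith
    · congr 2
      have := (Real.exp_pos ((L : ℝ) / 2)).ne'
      field_simp
      ring
  · refine (measureReal_mono ?_).trans
      (measureReal_le_sum_sq_le hind' hm' (fun i => hsub i e he1) B)
    intro ω hω
    simp only [Set.mem_ofPred_eq, hQ] at hω ⊢
    rw [mul_comm B, mul_lt_mul_iff_right₀ h0, lt_div_iff₀ hn'] at hω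
    linarith

lemma measureReal_notMem_regularDesigns_le [IsProbabilityMeasure μ] {X : Fin n → Ω → Fin p → ℝ}
    (hmeas : ∀ i, Measurable (X i)) (hind : iIndepFun X μ)
    (hsub : ∀ i (u : Fin p → ℝ), l2NormSq u = 1 → HasSubgaussianMGF (fun ω => X i ω ⬝ᵥ u) L μ)
    {a : ℝ} (ha : 0 < a)
    (hsq : ∀ i (u : Fin p → ℝ), l2NormSq u = 1 → a ≤ ∫ ω, (X i ω ⬝ᵥ u) ^ 2 ∂μ) (hn : 0 < n) (B : ℝ)
    (m1 m2 : ℕ) :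
    μ.real {ω | (fun i => X i ω) ∉ regularDesigns n p m1 m2 (a / 2) B} ≤
      (2 * p) ^ m1 * Real.exp (-(n * (a ^ 2 / (384 * Real.exp (L / 2))))) +
      (2 * p) ^ m2 * Real.exp (-(n * (B / (2 * (L + 1)) - L / 2))) := by
  have hsubset : {ω | (fun i => X i ω) ∉ regularDesigns n p m1 m2 (a / 2) B} ⊆
      (⋃ J : Fin m1 → Fin p × Bool, {ω | Matrix.toBilin' (gramMatrix fun i => X i ω)
        (signedSum J) (signedSum J) < a / 2 * l2NormSq (signedSum J)}) ∪
      ⋃ J : Fin m2 → Fin p × Bool, {ω | B * l2NormSq (signedSum J) <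
        Matrix.toBilin' (gramMatrix fun i => X i ω) (signedSum J) (signedSum J)} := by
    intro ω hω
    simp only [regularDesigns, Set.mem_ofPred_eq, not_and_or, not_forall, not_le] at hω
    simpa only [Set.mem_union, Set.mem_iUnion, Set.mem_ofPred_eq] using hω
  have hcard : ∀ m : ℕ, (Fintype.card (Fin m → Fin p × Bool) : ℝ) = (2 * p) ^ m := by
    intro m
    simp [mul_comm]
  refine (measureReal_mono hsubset).trans ((measureReal_union_le _ _).trans (add_le_add ?_ ?_))
  · refine (measureReal_iUnion_fintype_le _).trans ?_
    refine (Finset.sum_le_sum fun J _ =>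
      (unit_vector_tails hmeas hind hsub ha hsq hn B (signedSum J)).1).trans ?_
    rw [Finset.sum_const, Finset.card_univ, nsmul_eq_mul, hcard]
  · refine (measureReal_iUnion_fintype_le _).trans ?_
    refine (Finset.sum_le_sum fun J _ =>
      (unit_vector_tails hmeas hind hsub ha hsq hn B (signedSum J)).2).trans ?_
    rw [Finset.sum_const, Finset.card_univ, nsmul_eq_mul, hcard]

lemma two_mul_pow_le_exp {p : ℕ} (hp : 1 ≤ Real.log p) (m : ℕ) :
    (2 * p : ℝ) ^ m ≤ Real.exp (2 * Real.log p * m) := by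
  have h1 : (0 : ℝ) < p := by
    rcases Nat.eq_zero_or_pos p with h | h
    · subst h; norm_num at hp
    · exact_mod_cast h
  have h2 : Real.exp 1 ≤ p := by
    rw [← Real.exp_log h1]; exact Real.exp_le_exp.2 hp
  have h3 : (2 : ℝ) ≤ p := by
    have := Real.add_one_le_exp 1
    linarith
  rw [mul_comm _ (m : ℝ), Real.exp_nat_mul]
  refine pow_le_pow_left₀ (by positivity) ?_ m
  rw [two_mul (Real.log _), Real.exp_add, Real.exp_log h1]
  nlinarith

/-- Restricted eigenvalues of sub-Gaussian designs, with high probability. -/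
theorem exists_regular_designs (L : ℝ≥0) {a C_T : ℝ} (ha : 0 < a) (hCT : 0 < C_T) :
    ∃ A ≥ (1 : ℝ), ∃ γ > (0 : ℝ), ∀ n p : ℕ, 0 < n → 1 ≤ Real.log p → Real.log p ≤ C_T * n →
      ∃ D : Set (Fin n → Fin p → ℝ), MeasurableSet D ∧
        (∀ x ∈ D, RestrictedEigenvalue A (√(Real.log p / n)) (Matrix.toBilin' (gramMatrix x))) ∧
        ∀ {Ω : Type u} {_mΩ : MeasurableSpace Ω} {μ : Measure Ω} [IsProbabilityMeasure μ]
          {X : Fin n → Ω → Fin p → ℝ}, (∀ i, Measurable (X i)) → iIndepFun X μ →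
          (∀ i (u : Fin p → ℝ), l2NormSq u = 1 →
            HasSubgaussianMGF (fun ω => X i ω ⬝ᵥ u) L μ) →
          (∀ i (u : Fin p → ℝ), l2NormSq u = 1 → a ≤ ∫ ω, (X i ω ⬝ᵥ u) ^ 2 ∂μ) →
          μ.real {ω | (fun i => X i ω) ∉ D} ≤ 2 * Real.exp (-(γ * n)) ∧
          μ.real {ω | (fun i => X i ω) ∉ D} ≤ 2 * Real.exp (-(2 * Real.log p)) := by
  set γ0 : ℝ := a ^ 2 / (384 * Real.exp (L / 2)) with hγ0
  have hγ : 0 < γ0 := by positivity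
  -- B makes the exponent rate B/(2(L+1)) - L/2 equal to 3 + 6 C_T, while the union bound costs 2
  -- log p · m2 ≤ 2n + 4 log p ≤ (2 + 4 C_T) n; the rate 1 + 2 C_T remains.
  set B : ℝ := 2 * (L + 1) * (3 + 6 * C_T + L / 2) with hB
  have hB0 : 0 < B := by positivity
  -- One summand per use: 2/a and 32B/(γ0 a) for the lower bound, 8/γ0 for the lower bound when log
  -- p is comparable with n, and 2B for the upper bound.
  set A : ℝ := 1 + 2 / a + 32 * B / (γ0 * a) + 8 / γ0 + 2 * B with hA
  have hA1 : 1 ≤ A := by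
    have : 0 ≤ 2 / a + 32 * B / (γ0 * a) + 8 / γ0 + 2 * B := by positivity
    linarith
  have hAA : A ≤ A ^ 2 := by nlinarith
  clear_value γ0 B A
  refine ⟨A, hA1, min (γ0 / 2) 1, by positivity, fun n p hn hp hpn => ?_⟩
  set ℓ := Real.log p with hℓ
  have hn' : (0 : ℝ) < n := by exact_mod_cast hn
  have hℓ0 : 0 < ℓ := by linarith
  have ht2 : √(ℓ / n) ^ 2 = ℓ / n := Real.sq_sqrt (by positivity)
  -- m2 ≥ n / log p makes the Maurey error 2B/m2 of order log p / n; the added 1 ensures m2 ≥ 2.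
  set m2 : ℕ := ⌈n / ℓ⌉₊ + 1 with hm2
  have hm2' : 2 ≤ m2 := by
    have : 0 < ⌈n / ℓ⌉₊ := Nat.ceil_pos.2 (by positivity)
    omega
  have hm2lo : n / ℓ ≤ m2 := by
    rw [hm2]; push_cast; linarith [Nat.le_ceil (n / ℓ)]
  have hm2hi : (m2 : ℝ) ≤ n / ℓ + 2 := by
    rw [hm2]; push_cast; linarith [Nat.ceil_lt_add_one (show 0 ≤ n / ℓ by positivity)]
  have hfail2 : (2 * p : ℝ) ^ m2 * Real.exp (-(n * (B / (2 * (L + 1)) - L / 2)))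
      ≤ Real.exp (-((1 + 2 * C_T) * n)) := by
    refine (mul_le_mul_of_nonneg_right (two_mul_pow_le_exp hp m2) (Real.exp_pos _).le).trans ?_
    rw [← Real.exp_add]
    refine Real.exp_le_exp.2 ?_
    have h1 : B / (2 * ((L : ℝ) + 1)) - L / 2 = 3 + 6 * C_T := by
      rw [hB]; field_simp; ring
    have h2 : 2 * ℓ * m2 ≤ 2 * n + 4 * ℓ := by
      have := mul_le_mul_of_nonneg_left hm2hi (by positivity : 0 ≤ 2 * ℓ)
      have h3 : ℓ * (n / ℓ) = n := by field_simp
      nlinarith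
    rw [h1]
    nlinarith
  have hf2a : Real.exp (-((1 + 2 * C_T) * n)) ≤ Real.exp (-(min (γ0 / 2) 1 * n)) := by
    refine Real.exp_le_exp.2 (neg_le_neg ?_)
    refine mul_le_mul_of_nonneg_right ((min_le_right _ _).trans (by linarith)) hn'.le
  have hf2b : Real.exp (-((1 + 2 * C_T) * n)) ≤ Real.exp (-(2 * ℓ)) := by
    refine Real.exp_le_exp.2 (neg_le_neg ?_)
    linarith
  have hupper : ∀ m1 x, x ∈ regularDesigns n p m1 m2 (a / 2) B → ∀ u,
      Matrix.toBilin' (gramMatrix x) u u ≤ A ^ 2 * (l2NormSq u + √(ℓ / n) ^ 2 * l1Norm u ^ 2) := by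
    intro m1 x hx u
    have h1 := ge_of_signedSum_le (toBilin'_gramMatrix_symm x) (toBilin'_gramMatrix_nonneg x) hm2'
      hB0.le hx.2 u
    have h2 : 2 * B / m2 ≤ 2 * B * (ℓ / n) := by
      rw [div_le_iff₀ (by positivity)]
      have h3 : 2 * B * (ℓ / n) * (n / ℓ) = 2 * B := by field_simp
      have := mul_le_mul_of_nonneg_left hm2lo (by positivity : 0 ≤ 2 * B * (ℓ / n))
      linarith
    have hBA : 2 * B ≤ A ^ 2 := by
      have : 0 ≤ 2 / a + 32 * B / (γ0 * a) + 8 / γ0 := by positivity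
      linarith
    rw [ht2, mul_add]
    have h4 := mul_le_mul_of_nonneg_right h2 (sq_nonneg (l1Norm u))
    have h5 := mul_le_mul_of_nonneg_right hBA (by positivity : 0 ≤ ℓ / n * l1Norm u ^ 2)
    have h6 := mul_le_mul_of_nonneg_right (by linarith : B ≤ A ^ 2) (l2NormSq_nonneg u)
    linarith
  -- When log p is of order n or more, the slack (log p / n)‖u‖₁² already dominates ‖u‖₂², so no
  -- lower bound on the Gram form is needed and m1 = 0 makes that condition trivial.
  rcases lt_or_ge (γ0 * n) (8 * ℓ) with hcase | hcase
  · refine ⟨regularDesigns n p 0 m2 (a / 2) B, measurableSet_regularDesigns _ _ _ _,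
      fun x hx u => ⟨?_, hupper 0 x hx u⟩, ?_⟩
    · have h1 := l2NormSq_le_l1Norm_sq u
      have h2 : 1 ≤ A ^ 2 * √(ℓ / n) ^ 2 := by
        have h3 : 8 / γ0 ≤ A ^ 2 := by
          have : 0 ≤ 2 / a + 32 * B / (γ0 * a) + 2 * B := by positivity
          linarith
        have h4 : γ0 / 8 ≤ ℓ / n := by
          rw [le_div_iff₀ hn']; linarith
        have h5 := mul_le_mul h3 h4 (by positivity) (by positivity)
        rw [ht2]
        refine le_trans (le_of_eq ?_) h5
        field_simp
      have h3 := mul_le_mul_of_nonneg_right h2 (sq_nonneg (l1Norm u))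
      have h4 := mul_nonneg (sq_nonneg A) (toBilin'_gramMatrix_nonneg x u)
      linarith
    · intro Ω mΩ μ _ X hmeas hind hsub hsq
      have hsub' : {ω | (fun i => X i ω) ∉ regularDesigns n p 0 m2 (a / 2) B} ⊆
          ⋃ J : Fin m2 → Fin p × Bool, {ω | B * l2NormSq (signedSum J) <
            Matrix.toBilin' (gramMatrix fun i => X i ω) (signedSum J) (signedSum J)} := by
        intro ω hω
        simp only [regularDesigns, Set.mem_ofPred_eq, not_and_or, not_forall, not_le] at hω
        rcases hω with ⟨J, hJ⟩ | hω
        · exfalso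
          simp [signedSum, l2NormSq] at hJ
        · simpa only [Set.mem_iUnion, Set.mem_ofPred_eq] using hω
      have hcard : (Fintype.card (Fin m2 → Fin p × Bool) : ℝ) = (2 * p) ^ m2 := by
        simp [mul_comm]
      have h1 : μ.real {ω | (fun i => X i ω) ∉ regularDesigns n p 0 m2 (a / 2) B}
          ≤ Real.exp (-((1 + 2 * C_T) * n)) := by
        refine ((measureReal_mono hsub').trans (measureReal_iUnion_fintype_le _)).trans ?_
        refine (Finset.sum_le_sum fun J _ =>
          (unit_vector_tails hmeas hind hsub ha hsq hn B (signedSum J)).2).trans ?_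
        rw [Finset.sum_const, Finset.card_univ, nsmul_eq_mul, hcard]
        exact hfail2
      have e1 := Real.exp_pos (-(min (γ0 / 2) 1 * (n : ℝ)))
      have e2 := Real.exp_pos (-(2 * ℓ))
      exact ⟨by linarith, by linarith⟩
  -- With this m1 the cost 2 log p · m1 of the union bound is at most half of the exponent γ0 n, and
  -- still m1 ≥ 2.
  · set m1 : ℕ := ⌊γ0 * n / (4 * ℓ)⌋₊ with hm1
    have hr : 2 ≤ γ0 * n / (4 * ℓ) := by rw [le_div_iff₀ (by positivity)]; linarith
    have hm1' : 2 ≤ m1 := Nat.le_floor (by exact_mod_cast hr)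
    have hm1lo : γ0 * n / (8 * ℓ) ≤ m1 := by
      have h1 := Nat.lt_floor_add_one (γ0 * n / (4 * ℓ))
      have h2 : γ0 * n / (8 * ℓ) = γ0 * n / (4 * ℓ) / 2 := by field_simp; ring
      rw [h2, hm1]
      linarith
    have hm1hi : (m1 : ℝ) ≤ γ0 * n / (4 * ℓ) := Nat.floor_le (by positivity)
    refine ⟨regularDesigns n p m1 m2 (a / 2) B, measurableSet_regularDesigns _ _ _ _,
      fun x hx u => ⟨?_, hupper m1 x hx u⟩, ?_⟩
    · have h1 := le_add_of_signedSum_ge (toBilin'_gramMatrix_symm x) hm1' (by positivity) hB0.le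
        hx.1 (diag_le_of_signedSum_le (by omega) hx.2) u
      have h2 : 2 * B / m1 ≤ 16 * B / γ0 * (ℓ / n) := by
        rw [div_le_iff₀ (by positivity)]
        have h3 : 16 * B / γ0 * (ℓ / n) * (γ0 * n / (8 * ℓ)) = 2 * B := by field_simp; norm_num
        have := mul_le_mul_of_nonneg_left hm1lo (by positivity : 0 ≤ 16 * B / γ0 * (ℓ / n))
        linarith
      have h4 := mul_le_mul_of_nonneg_right h2 (sq_nonneg (l1Norm u))
      have h5 : l2NormSq u ≤ 2 / a * (Matrix.toBilin' (gramMatrix x) u u)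
          + 32 * B / (γ0 * a) * (ℓ / n * l1Norm u ^ 2) := by
        have h6 : 2 / a * (a / 2 * l2NormSq u) = l2NormSq u := by field_simp
        have h7 := mul_le_mul_of_nonneg_left (h1.trans (add_le_add_right h4 _))
          (by positivity : 0 ≤ 2 / a)
        rw [h6] at h7
        refine h7.trans (le_of_eq ?_)
        field_simp
        ring
      have h8 : 2 / a ≤ A ^ 2 := by
        have : 0 ≤ 32 * B / (γ0 * a) + 8 / γ0 + 2 * B := by positivity
        linarith
      have h9 : 32 * B / (γ0 * a) ≤ A ^ 2 := by
        have : 0 ≤ 2 / a + 8 / γ0 + 2 * B := by positivity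
        linarith
      have h10 := mul_le_mul_of_nonneg_right h8 (toBilin'_gramMatrix_nonneg x u)
      have h11 := mul_le_mul_of_nonneg_right h9 (by positivity : 0 ≤ ℓ / n * l1Norm u ^ 2)
      rw [ht2]
      linarith
    · intro Ω mΩ μ _ X hmeas hind hsub hsq
      have h1 := measureReal_notMem_regularDesigns_le hmeas hind hsub ha hsq hn B m1 m2
      rw [← hγ0] at h1
      have h2 : (2 * p : ℝ) ^ m1 * Real.exp (-(n * γ0)) ≤ Real.exp (-(γ0 / 2 * n)) := by
        refine (mul_le_mul_of_nonneg_right (two_mul_pow_le_exp hp m1) (Real.exp_pos _).le).trans ?_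
        rw [← Real.exp_add]
        refine Real.exp_le_exp.2 ?_
        have h3 := mul_le_mul_of_nonneg_left hm1hi (by positivity : 0 ≤ 2 * ℓ)
        have h4 : 2 * ℓ * (γ0 * n / (4 * ℓ)) = γ0 * n / 2 := by field_simp; norm_num
        linarith
      have h3 : Real.exp (-(γ0 / 2 * n)) ≤ Real.exp (-(min (γ0 / 2) 1 * n)) :=
        Real.exp_le_exp.2 (neg_le_neg (mul_le_mul_of_nonneg_right (min_le_left _ _) hn'.le))
      have h4 : Real.exp (-(γ0 / 2 * n)) ≤ Real.exp (-(2 * ℓ)) :=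
        Real.exp_le_exp.2 (neg_le_neg (by linarith))
      exact ⟨by linarith, by linarith⟩

end DesignTails

/-! ### Linear statistics of independent Gaussian noise with random weights -/

section Noise

variable {Ω 𝓧 ι : Type*} {mΩ : MeasurableSpace Ω} [MeasurableSpace 𝓧] [Fintype ι]

/-- Independent centered Gaussian noises with variances at most `σsq`, independent of `X`. -/
structure IndepGaussianNoise (X : Ω → 𝓧) (ε : ι → Ω → ℝ) (σsq : ℝ≥0) (μ : Measure Ω) : Prop where
  measurable_design : Measurable X
  measurable : ∀ i, Measurable (ε i)
  gaussian : ∀ i, ∃ v : ℝ≥0, v ≤ σsq ∧ μ.map (ε i) = gaussianReal 0 v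
  indep : iIndepFun ε μ
  indep_design : IndepFun X (fun ω i => ε i ω) μ

namespace IndepGaussianNoise

variable {X : Ω → 𝓧} {ε : ι → Ω → ℝ} {σsq : ℝ≥0} {μ : Measure Ω} [IsProbabilityMeasure μ]
  (h : IndepGaussianNoise X ε σsq μ)

include h

omit [Fintype ι] [IsProbabilityMeasure μ] in
lemma measurable_noise : Measurable fun ω i => ε i ω := measurable_pi_lambda _ h.measurable

omit [Fintype ι] in
lemma map_prod : μ.map (fun ω => (X ω, fun i => ε i ω)) =
    (μ.map X).prod (μ.map fun ω i => ε i ω) :=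
  (indepFun_iff_map_prod_eq_prod_map_map h.measurable_design.aemeasurable
    h.measurable_noise.aemeasurable).1 h.indep_design

lemma lintegral_exp_const_le (w : ι → ℝ) :
    ∫⁻ ω, ENNReal.ofReal (Real.exp (∑ i, w i * ε i ω)) ∂μ ≤
      ENNReal.ofReal (Real.exp (σsq * (∑ i, w i ^ 2) / 2)) := by
  have hind : iIndepFun (fun i ω => w i * ε i ω) μ :=
    h.indep.comp (fun i x => w i * x) fun i => by fun_prop
  have hm : ∀ i, Measurable fun ω => w i * ε i ω := fun i => (h.measurable i).const_mul _
  have hmgf : ∀ i, mgf (fun ω => w i * ε i ω) μ 1 ≤ Real.exp (σsq * w i ^ 2 / 2) := by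
    intro i
    obtain ⟨v, hv, hmap⟩ := h.gaussian i
    have h1 := mgf_gaussianReal hmap (w i)
    have h2 : mgf (fun ω => w i * ε i ω) μ 1 = mgf (ε i) μ (w i) := by simp [mgf]
    rw [h2, h1, zero_mul, zero_add]
    have : (v : ℝ) ≤ σsq := hv
    gcongr
  have hint : ∀ i, Integrable (fun ω => Real.exp (1 * (w i * ε i ω))) μ := by
    intro i
    obtain ⟨v, hv, hmap⟩ := h.gaussian i
    have h1 := integrable_exp_mul_gaussianReal (μ := 0) (v := v) (w i)
    rw [← hmap] at h1
    simpa [Function.comp_def] using h1.comp_measurable (h.measurable i)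
  have hint2 := hind.integrable_exp_mul_sum hm (s := Finset.univ) fun i _ => hint i
  have h3 := hind.mgf_sum (t := 1) hm Finset.univ
  simp only [one_mul, Finset.sum_apply] at hint2
  rw [← ofReal_integral_eq_lintegral_ofReal hint2 (ae_of_all _ fun _ => (Real.exp_pos _).le)]
  refine ENNReal.ofReal_le_ofReal ?_
  simp only [mgf, one_mul, Finset.sum_apply] at h3
  rw [h3]
  calc _ ≤ ∏ i, Real.exp (σsq * w i ^ 2 / 2) := Finset.prod_le_prod
        (fun i _ => integral_nonneg fun _ => (Real.exp_pos _).le)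
        fun i _ => by simpa [mgf] using hmgf i
    _ = _ := by
        rw [← Real.exp_sum, Finset.mul_sum, Finset.sum_div]

variable {G : Set 𝓧} {W : 𝓧 → ι → ℝ} {V : ℝ}

/-- The joint law is a product, so the noise is integrated first with the design frozen; the
restriction to G makes the variance proxy uniform in the design. -/
lemma lintegral_exp_le (hG : MeasurableSet G) (hW : Measurable W)
    (hV : ∀ x ∈ G, ∑ i, W x i ^ 2 ≤ V) (t : ℝ) :
    ∫⁻ ω in X ⁻¹' G, ENNReal.ofReal (Real.exp (t * ∑ i, W (X ω) i * ε i ω)) ∂μ ≤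
      ENNReal.ofReal (Real.exp (t ^ 2 * (σsq * V) / 2)) := by
  have hpair : Measurable fun ω => (X ω, fun i => ε i ω) :=
    h.measurable_design.prodMk h.measurable_noise
  have hWi : ∀ i, Measurable fun q : 𝓧 × (ι → ℝ) => W q.1 i := fun i =>
    (measurable_pi_apply i).comp (hW.comp measurable_fst)
  have hf : Measurable fun q : 𝓧 × (ι → ℝ) =>
      ENNReal.ofReal (Real.exp (t * ∑ i, W q.1 i * q.2 i)) := by
    refine (Real.measurable_exp.comp (Measurable.const_mul ?_ t)).ennreal_ofReal
    exact Finset.measurable_sum _ fun i _ => (hWi i).mul (by fun_prop)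
  have h1 := setLIntegral_map (μ := μ) (s := Prod.fst ⁻¹' G) (measurable_fst hG) hf hpair
  have h2 : (fun ω => (X ω, fun i => ε i ω)) ⁻¹' (Prod.fst ⁻¹' G) = X ⁻¹' G := rfl
  rw [h2] at h1
  rw [← h1, h.map_prod, ← Set.prod_univ]
  have : IsProbabilityMeasure (μ.map X) :=
    Measure.isProbabilityMeasure_map h.measurable_design.aemeasurable
  have : IsProbabilityMeasure (μ.map fun ω i => ε i ω) :=
    Measure.isProbabilityMeasure_map h.measurable_noise.aemeasurable
  rw [← Measure.prod_restrict, Measure.restrict_univ, lintegral_prod _ hf.aemeasurable]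
  have h3 : ∀ x ∈ G, ∫⁻ e, ENNReal.ofReal (Real.exp (t * ∑ i, W x i * e i))
      ∂(μ.map fun ω i => ε i ω) ≤ ENNReal.ofReal (Real.exp (t ^ 2 * (σsq * V) / 2)) := by
    intro x hx
    rw [lintegral_map (f := fun e : ι → ℝ => ENNReal.ofReal (Real.exp (t * ∑ i, W x i * e i)))
      (by fun_prop) h.measurable_noise]
    have h4 := h.lintegral_exp_const_le fun i => t * W x i
    simp only [Finset.mul_sum, ← mul_assoc]
    refine h4.trans (ENNReal.ofReal_le_ofReal (Real.exp_le_exp.2 ?_))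
    simp only [mul_pow, ← Finset.mul_sum]
    have := mul_le_mul_of_nonneg_left (hV x hx) (by positivity : 0 ≤ t ^ 2 * (σsq : ℝ))
    linarith
  refine (lintegral_mono_ae ((ae_restrict_iff' hG).2 (ae_of_all _ h3))).trans ?_
  rw [lintegral_const, Measure.restrict_apply_univ]
  exact mul_le_of_le_one_right' prob_le_one

omit [IsProbabilityMeasure μ] in
lemma measurable_linear (hW : Measurable W) :
    Measurable fun ω => ∑ i, W (X ω) i * ε i ω :=
  Finset.measurable_sum _ fun i _ =>
    ((measurable_pi_apply i).comp (hW.comp h.measurable_design)).mul (h.measurable i)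

lemma lintegral_exp_abs_le (hG : MeasurableSet G) (hW : Measurable W)
    (hV : ∀ x ∈ G, ∑ i, W x i ^ 2 ≤ V) (t : ℝ) :
    ∫⁻ ω in X ⁻¹' G, ENNReal.ofReal (Real.exp (t * |∑ i, W (X ω) i * ε i ω|)) ∂μ ≤
      ENNReal.ofReal (2 * Real.exp (t ^ 2 * (σsq * V) / 2)) := by
  have h1 := h.lintegral_exp_le hG hW hV t
  have h2 := h.lintegral_exp_le hG hW hV (-t)
  rw [neg_sq] at h2
  rw [two_mul, ENNReal.ofReal_add (Real.exp_pos _).le (Real.exp_pos _).le]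
  refine le_trans ?_ (add_le_add h1 h2)
  have hm := h.measurable_linear hW
  rw [← lintegral_add_left (by fun_prop)]
  refine lintegral_mono fun ω => ?_
  dsimp only
  rw [← ENNReal.ofReal_add (Real.exp_pos _).le (Real.exp_pos _).le]
  refine ENNReal.ofReal_le_ofReal ?_
  rcases abs_cases (∑ i, W (X ω) i * ε i ω) with ⟨e, -⟩ | ⟨e, -⟩
  · rw [e]; linarith [Real.exp_pos (-t * ∑ i, W (X ω) i * ε i ω)]
  · rw [e, mul_neg, ← neg_mul]; linarith [Real.exp_pos (t * ∑ i, W (X ω) i * ε i ω)]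

/-- Tail bound. -/
lemma measureReal_lt_abs_le (hG : MeasurableSet G) (hW : Measurable W)
    (hV : ∀ x ∈ G, ∑ i, W x i ^ 2 ≤ V) {t : ℝ} (ht : 0 ≤ t) (θ : ℝ) :
    μ.real {ω | X ω ∈ G ∧ θ < |∑ i, W (X ω) i * ε i ω|} ≤
      2 * Real.exp (t ^ 2 * (σsq * V) / 2 - t * θ) := by
  have hm := h.measurable_linear hW
  have hs : MeasurableSet (X ⁻¹' G) := h.measurable_design hG
  have h1 := h.lintegral_exp_abs_le hG hW hV t
  have h2 : ENNReal.ofReal (Real.exp (t * θ)) *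
      μ {ω | X ω ∈ G ∧ θ < |∑ i, W (X ω) i * ε i ω|} ≤
      ∫⁻ ω in X ⁻¹' G, ENNReal.ofReal (Real.exp (t * |∑ i, W (X ω) i * ε i ω|)) ∂μ := by
    have hf : Measurable fun ω => ENNReal.ofReal (Real.exp (t * |∑ i, W (X ω) i * ε i ω|)) := by
      fun_prop
    refine le_trans ?_ (mul_meas_ge_le_lintegral₀ hf.aemeasurable
      (ENNReal.ofReal (Real.exp (t * θ))))
    refine mul_le_mul_right ?_ _
    rw [Measure.restrict_apply' hs]
    refine measure_mono fun ω hω => ⟨?_, hω.1⟩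
    exact ENNReal.ofReal_le_ofReal (Real.exp_le_exp.2 (mul_le_mul_of_nonneg_left hω.2.le ht))
  have h3 := ENNReal.toReal_mono ENNReal.ofReal_ne_top (h2.trans h1)
  rw [ENNReal.toReal_mul, ENNReal.toReal_ofReal (Real.exp_pos _).le,
    ENNReal.toReal_ofReal (by positivity)] at h3
  rw [Real.exp_sub, mul_div_assoc', le_div_iff₀ (Real.exp_pos _), mul_comm]
  exact h3

/-- Truncated second moment. -/
lemma lintegral_sq_truncated_le (hG : MeasurableSet G) (hW : Measurable W)
    (hV : ∀ x ∈ G, ∑ i, W x i ^ 2 ≤ V) {t : ℝ} (ht : 0 < t) (θ : ℝ) :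
    ∫⁻ ω in {ω | X ω ∈ G ∧ θ < |∑ i, W (X ω) i * ε i ω|},
        ENNReal.ofReal ((∑ i, W (X ω) i * ε i ω) ^ 2) ∂μ ≤
      ENNReal.ofReal (4 / t ^ 2 * Real.exp (2 * t ^ 2 * (σsq * V) - t * θ)) := by
  have hm := h.measurable_linear hW
  have hs : MeasurableSet (X ⁻¹' G) := h.measurable_design hG
  have hs2 : MeasurableSet {ω | θ < |∑ i, W (X ω) i * ε i ω|} :=
    measurableSet_lt measurable_const hm.abs
  -- One factor exp(t|z|) pays for z², and doubling the exponent gains exp(-tθ), because θ < |z|.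
  have hpt : ∀ z : ℝ, θ < |z| → z ^ 2 ≤ 2 / t ^ 2 * Real.exp (-(t * θ)) *
      Real.exp (2 * t * |z|) := by
    intro z hz
    have h1 := Real.quadratic_le_exp_of_nonneg (mul_nonneg ht.le (abs_nonneg z))
    have h2 : Real.exp (t * |z|) ≤ Real.exp (-(t * θ)) * Real.exp (2 * t * |z|) := by
      rw [← Real.exp_add]
      refine Real.exp_le_exp.2 ?_
      nlinarith
    have h3 : t ^ 2 * z ^ 2 ≤ 2 * Real.exp (t * |z|) := by
      have : (t * |z|) ^ 2 = t ^ 2 * z ^ 2 := by rw [mul_pow, sq_abs]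
      nlinarith [mul_nonneg ht.le (abs_nonneg z)]
    rw [mul_assoc, div_mul_eq_mul_div, le_div_iff₀ (by positivity)]
    linarith
  calc _ ≤ ∫⁻ ω in {ω | X ω ∈ G ∧ θ < |∑ i, W (X ω) i * ε i ω|},
        ENNReal.ofReal (2 / t ^ 2 * Real.exp (-(t * θ))) *
          ENNReal.ofReal (Real.exp (2 * t * |∑ i, W (X ω) i * ε i ω|)) ∂μ := by
        refine lintegral_mono_ae ((ae_restrict_iff' (hs.inter hs2)).2 (ae_of_all _ fun ω hω => ?_))
        rw [← ENNReal.ofReal_mul (by positivity)]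
        exact ENNReal.ofReal_le_ofReal (hpt _ hω.2)
    _ ≤ ∫⁻ ω in X ⁻¹' G, ENNReal.ofReal (2 / t ^ 2 * Real.exp (-(t * θ))) *
          ENNReal.ofReal (Real.exp (2 * t * |∑ i, W (X ω) i * ε i ω|)) ∂μ :=
        lintegral_mono_set fun ω hω => hω.1
    _ = ENNReal.ofReal (2 / t ^ 2 * Real.exp (-(t * θ))) * ∫⁻ ω in X ⁻¹' G,
          ENNReal.ofReal (Real.exp (2 * t * |∑ i, W (X ω) i * ε i ω|)) ∂μ :=
        lintegral_const_mul _ (by fun_prop)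
    _ ≤ ENNReal.ofReal (2 / t ^ 2 * Real.exp (-(t * θ))) *
          ENNReal.ofReal (2 * Real.exp ((2 * t) ^ 2 * (σsq * V) / 2)) := by
        gcongr
        exact h.lintegral_exp_abs_le hG hW hV (2 * t)
    _ = _ := by
        rw [← ENNReal.ofReal_mul (by positivity)]
        congr 1
        rw [sub_eq_add_neg, Real.exp_add]
        ring_nf

/-- Flipping signs of noises does not change the joint law. -/
lemma map_flip {s : ι → ℝ} (hs : ∀ i, s i = 1 ∨ s i = -1) :
    μ.map (fun ω => (X ω, fun i => s i * ε i ω)) = μ.map (fun ω => (X ω, fun i => ε i ω)) := by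
  have hm : ∀ i, Measurable fun ω => s i * ε i ω := fun i => (h.measurable i).const_mul _
  have hind : iIndepFun (fun i ω => s i * ε i ω) μ :=
    h.indep.comp (fun i x => s i * x) fun i => by fun_prop
  have hX : IndepFun X (fun ω i => s i * ε i ω) μ :=
    h.indep_design.comp (φ := id) (ψ := fun (e : ι → ℝ) i => s i * e i) measurable_id
      (by fun_prop)
  have hsm : ∀ i, μ.map (fun ω => s i * ε i ω) = μ.map (ε i) := by
    intro i
    obtain ⟨v, -, hmap⟩ := h.gaussian i
    have h1 := gaussianReal_map_const_mul (μ := 0) (v := v) (s i)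
    rw [← hmap, Measure.map_map (by fun_prop) (h.measurable i)] at h1
    rw [hmap]
    refine h1.trans ?_
    rw [mul_zero]
    congr 1
    ext
    rcases hs i with e | e <;> simp [e]
  rw [h.map_prod, (indepFun_iff_map_prod_eq_prod_map_map h.measurable_design.aemeasurable
    (measurable_pi_lambda _ hm).aemeasurable).1 hX,
    (iIndepFun_iff_map_fun_eq_pi_map fun i => (hm i).aemeasurable).1 hind,
    (iIndepFun_iff_map_fun_eq_pi_map fun i => (h.measurable i).aemeasurable).1 h.indep]
  simp only [hsm]

/-- A statistic that is odd under a sign flip of the noises has mean zero. -/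
lemma integral_eq_zero_of_odd {s : ι → ℝ} (hs : ∀ i, s i = 1 ∨ s i = -1)
    {F : 𝓧 × (ι → ℝ) → ℝ} (hF : Measurable F) (hodd : ∀ x e, F (x, fun i => s i * e i) = -F (x, e)) :
    ∫ ω, F (X ω, fun i => ε i ω) ∂μ = 0 := by
  have hpair : Measurable fun ω => (X ω, fun i => ε i ω) :=
    h.measurable_design.prodMk h.measurable_noise
  have hpair' : Measurable fun ω => (X ω, fun i => s i * ε i ω) :=
    h.measurable_design.prodMk (measurable_pi_lambda _ fun i => (h.measurable i).const_mul _)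
  have h1 := integral_map (μ := μ) hpair.aemeasurable hF.aestronglyMeasurable
  have h2 := integral_map (μ := μ) hpair'.aemeasurable hF.aestronglyMeasurable
  rw [h.map_flip hs, h1] at h2
  simp only [hodd, integral_neg] at h2
  linarith

end IndepGaussianNoise

end Noise

/-! ### Lasso solutions in low dimension -/

section Lasso

variable {p : ℕ}

/-- First-order characterization of the minimizers of `o ↦ ½ oᵀ M o - zᵀ o + lam ‖o‖₁`. -/
def IsLassoSolution (M : Matrix (Fin p) (Fin p) ℝ) (z : Fin p → ℝ) (lam : ℝ) (o : Fin p → ℝ) :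
    Prop :=
  ∀ v, z ⬝ᵥ v - Matrix.toBilin' M o v ≤ lam * (l1Norm (o + v) - l1Norm o)

open Classical in
/-- A lasso solution, if there is one. -/
noncomputable def lassoSolution (M : Matrix (Fin p) (Fin p) ℝ) (z : Fin p → ℝ) (lam : ℝ) :
    Fin p → ℝ :=
  if h : ∃ o, IsLassoSolution M z lam o then h.choose else 0

/-- `M` is symmetric with smallest eigenvalue at least `a`. -/
def IsPosDefAbove (a : ℝ) (M : Matrix (Fin p) (Fin p) ℝ) : Prop :=
  (∀ u v, Matrix.toBilin' M u v = Matrix.toBilin' M v u) ∧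
    ∀ u, a * l2NormSq u ≤ Matrix.toBilin' M u u

variable {M M' : Matrix (Fin p) (Fin p) ℝ} {z z' o o' : Fin p → ℝ} {lam a : ℝ}

lemma continuous_l1Norm : Continuous (l1Norm : (Fin p → ℝ) → ℝ) := by
  unfold l1Norm; fun_prop

lemma continuous_l2NormSq : Continuous (l2NormSq : (Fin p → ℝ) → ℝ) := by
  unfold l2NormSq; fun_prop

lemma norm_le_l2Norm (u : Fin p → ℝ) : ‖u‖ ≤ l2Norm u :=
  (pi_norm_le_iff_of_nonneg (l2Norm_nonneg u)).2 fun j => abs_apply_le_l2Norm u j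

/-- Outside the sup-norm ball of radius 2‖z‖₂/a the objective is nonnegative, hence at least its
value at 0, so a minimizer over the compact ball is global. -/
lemma IsPosDefAbove.exists_isLassoSolution (hM : IsPosDefAbove a M) (ha : 0 < a) (hlam : 0 ≤ lam)
    (z : Fin p → ℝ) : ∃ o, IsLassoSolution M z lam o := by
  set f : (Fin p → ℝ) → ℝ := fun u => 1 / 2 * Matrix.toBilin' M u u - z ⬝ᵥ u + lam * l1Norm u with hf
  have hcont : Continuous f := by
    simp only [hf, Matrix.toBilin'_apply, dotProduct]
    have := continuous_l1Norm (p := p)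
    fun_prop
  set R := 2 * l2Norm z / a with hR
  have hR0 : 0 ≤ R := by have := l2Norm_nonneg z; positivity
  obtain ⟨o, ho, hmin⟩ := (isCompact_closedBall (0 : Fin p → ℝ) R).exists_isMinOn
    ⟨0, Metric.mem_closedBall_self hR0⟩ hcont.continuousOn
  have hf0 : f 0 = 0 := by simp [hf, l1Norm_zero]
  have hglob : ∀ w, f o ≤ f w := by
    intro w
    by_cases hw : w ∈ Metric.closedBall (0 : Fin p → ℝ) R
    · exact hmin hw
    · rw [mem_closedBall_zero_iff, not_le] at hw
      have h1 : f o ≤ f 0 := hmin (Metric.mem_closedBall_self hR0)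
      have h2 : R < l2Norm w := hw.trans_le (norm_le_l2Norm w)
      have h3 := hM.2 w
      have h4 := (le_abs_self _).trans (abs_dotProduct_le_l2Norm z w)
      have h5 := mul_nonneg hlam (l1Norm_nonneg w)
      rw [← l2Norm_sq] at h3
      have h6 : 2 * l2Norm z ≤ a * l2Norm w := by
        rw [hR, div_lt_iff₀ ha] at h2
        linarith
      have h7 := mul_le_mul_of_nonneg_right h6 (l2Norm_nonneg w)
      have h8 : 0 ≤ f w := by simp only [hf]; nlinarith
      linarith
  refine ⟨o, fun v => ?_⟩
  have := dotProduct_sub_le_of_isMin hM.1 (R := fun w => lam * l1Norm w)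
    (fun x v t ht ht1 => by
      have h3 := mul_le_mul_of_nonneg_left (l1Norm_add_smul_le x v ht ht1) hlam
      linarith) hglob v
  linarith

lemma IsPosDefAbove.isLassoSolution (hM : IsPosDefAbove a M) (ha : 0 < a) (hlam : 0 ≤ lam)
    (z : Fin p → ℝ) : IsLassoSolution M z lam (lassoSolution M z lam) := by
  have h := hM.exists_isLassoSolution ha hlam z
  rw [lassoSolution, dif_pos h]
  exact h.choose_spec

/-- Stability of lasso solutions. -/
lemma IsLassoSolution.l2Norm_sub_le (h : IsLassoSolution M z lam o)
    (h' : IsLassoSolution M' z' lam o') (hs : ∀ u v, Matrix.toBilin' M u v = Matrix.toBilin' M v u)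
    (hM' : IsPosDefAbove a M') (ha : 0 < a) :
    l2Norm (o' - o) ≤ l2Norm (z' - z + (M *ᵥ o - M' *ᵥ o)) / a := by
  set d := o' - o with hd
  set w := z' - z + (M *ᵥ o - M' *ᵥ o) with hw
  have h1 := h d
  have h2 := h' (-d)
  rw [show o + d = o' by rw [hd]; abel] at h1
  rw [show o' + -d = o by rw [hd]; abel] at h2
  have h3 : w ⬝ᵥ d = z' ⬝ᵥ d - z ⬝ᵥ d + (Matrix.toBilin' M o d - Matrix.toBilin' M' o d) := by
    rw [hw, add_dotProduct, sub_dotProduct, sub_dotProduct,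
      Matrix.toBilin'_eq_mulVec_dotProduct _ hs, Matrix.toBilin'_eq_mulVec_dotProduct _ hM'.1]
  have h4 : Matrix.toBilin' M' d d = Matrix.toBilin' M' o' d - Matrix.toBilin' M' o d := by
    rw [← LinearMap.sub_apply, ← map_sub]
  have h5 := hM'.2 d
  simp only [dotProduct_neg, map_neg] at h2
  have h6 : a * l2NormSq d ≤ w ⬝ᵥ d := by rw [h3]; linarith
  have h7 := h6.trans ((le_abs_self _).trans (abs_dotProduct_le_l2Norm w d))
  rw [← l2Norm_sq] at h7
  rw [le_div_iff₀ ha]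
  rcases (l2Norm_nonneg d).eq_or_lt with h0 | h0
  · rw [← h0, zero_mul]; exact l2Norm_nonneg _
  · refine le_of_mul_le_mul_right ?_ h0
    linarith

lemma IsLassoSolution.eq (h : IsLassoSolution M z lam o) (h' : IsLassoSolution M z lam o')
    (hM : IsPosDefAbove a M) (ha : 0 < a) : o = o' := by
  have h1 := h.l2Norm_sub_le h' hM.1 hM ha
  rw [sub_self, sub_self, add_zero, l2Norm_zero, zero_div] at h1
  have h2 := norm_le_zero_iff.1 ((norm_le_l2Norm _).trans h1)
  exact (sub_eq_zero.1 h2).symm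

lemma IsLassoSolution.neg (h : IsLassoSolution M z lam o) : IsLassoSolution M (-z) lam (-o) := by
  intro v
  have := h (-v)
  rw [show o + -v = -(-o + v) by abel, l1Norm_neg] at this
  rw [l1Norm_neg]
  simpa using this

/-- By uniqueness the chosen solution is odd in the score. This is what makes the corrections of
different tasks uncorrelated. -/
lemma IsPosDefAbove.lassoSolution_neg (hM : IsPosDefAbove a M) (ha : 0 < a) (hlam : 0 ≤ lam)
    (z : Fin p → ℝ) : lassoSolution M (-z) lam = -lassoSolution M z lam :=
  (hM.isLassoSolution ha hlam (-z)).eq (hM.isLassoSolution ha hlam z).neg hM ha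

lemma isLassoSolution_zero (hlam : 0 ≤ lam) : IsLassoSolution M 0 lam 0 := by
  intro v
  have := mul_nonneg hlam (l1Norm_nonneg v)
  simpa [l1Norm_zero] using this

lemma IsPosDefAbove.l2Norm_lassoSolution_le (hM : IsPosDefAbove a M) (ha : 0 < a) (hlam : 0 ≤ lam)
    (z : Fin p → ℝ) : l2Norm (lassoSolution M z lam) ≤ l2Norm z / a := by
  have := (isLassoSolution_zero (M := M) hlam).l2Norm_sub_le (hM.isLassoSolution ha hlam z) hM.1 hM ha
  simpa using this

/-- The stability bound at a fixed solution o tends to 0 with the data, under a common lower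
eigenvalue bound. Serves the measurability of the corrections. -/
lemma continuousOn_lassoSolution {α : Type*} [TopologicalSpace α]
    {M : α → Matrix (Fin p) (Fin p) ℝ} {z : α → Fin p → ℝ} {S : Set α}
    (hM : ∀ x ∈ S, IsPosDefAbove a (M x)) (ha : 0 < a) (hlam : 0 ≤ lam)
    (hMc : ∀ o, Continuous fun x => M x *ᵥ o) (hz : Continuous z) :
    ContinuousOn (fun x => lassoSolution (M x) (z x) lam) S := by
  intro x0 hx0
  set o := lassoSolution (M x0) (z x0) lam with ho
  set g : α → ℝ := fun x => l2Norm (z x - z x0 + (M x0 *ᵥ o - M x *ᵥ o)) / a with hg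
  have hgc : Continuous g := by
    simp only [hg, l2Norm]
    have h1 := hMc o
    have h2 := continuous_l2NormSq (p := p)
    fun_prop
  have hg0 : g x0 = 0 := by simp [hg, l2Norm_zero]
  rw [ContinuousWithinAt, tendsto_iff_norm_sub_tendsto_zero]
  refine squeeze_zero' (Eventually.of_forall fun _ => norm_nonneg _) (g := g) ?_
    (hg0 ▸ hgc.continuousWithinAt.tendsto)
  filter_upwards [self_mem_nhdsWithin] with x hx
  exact (norm_le_l2Norm _).trans (((hM x0 hx0).isLassoSolution ha hlam _).l2Norm_sub_le
    ((hM x hx).isLassoSolution ha hlam _) (hM x0 hx0).1 (hM x hx) ha)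

end Lasso

/-! ### Corrections for the tasks whose score exceeds the penalty -/

section Correction

variable {n p : ℕ}

open Classical in
/-- The lasso solution for the score of a task, if the design is in `D` and some entry of the score
exceeds `θ`. -/
noncomputable def correction (D : Set (Fin n → Fin p → ℝ)) (θ lam : ℝ)
    (q : (Fin n → Fin p → ℝ) × (Fin n → ℝ)) : Fin p → ℝ :=
  if q.1 ∈ D ∧ ∃ j, θ < |scoreVec q.1 q.2 j| then
    lassoSolution (gramMatrix q.1) (scoreVec q.1 q.2) lam else 0

variable {D : Set (Fin n → Fin p → ℝ)} {θ lam a : ℝ}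

lemma continuous_scoreVec :
    Continuous fun q : (Fin n → Fin p → ℝ) × (Fin n → ℝ) => scoreVec q.1 q.2 := by
  unfold scoreVec; fun_prop

lemma continuous_gramMatrix_mulVec (o : Fin p → ℝ) :
    Continuous fun x : Fin n → Fin p → ℝ => gramMatrix x *ᵥ o := by
  unfold gramMatrix Matrix.mulVec dotProduct; fun_prop

lemma isPosDefAbove_gramMatrix {x : Fin n → Fin p → ℝ}
    (h : ∀ u, a * l2NormSq u ≤ Matrix.toBilin' (gramMatrix x) u u) :
    IsPosDefAbove a (gramMatrix x) :=
  ⟨toBilin'_gramMatrix_symm x, h⟩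

/-- The lasso solution is continuous on the closed set where the eigenvalue bound holds, and this
set contains the region where the correction may be nonzero. -/
lemma measurable_correction (hD : MeasurableSet D) (ha : 0 < a) (hlam : 0 ≤ lam)
    (hpos : ∀ x ∈ D, IsPosDefAbove a (gramMatrix x)) (θ : ℝ) :
    Measurable (correction D θ lam) := by
  classical
  set S : Set ((Fin n → Fin p → ℝ) × (Fin n → ℝ)) :=
    {q | ∀ u, a * l2NormSq u ≤ Matrix.toBilin' (gramMatrix q.1) u u} with hS
  have hSm : MeasurableSet S := by
    refine IsClosed.measurableSet ?_
    simp only [hS, Set.ofPred_forall]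
    exact isClosed_iInter fun u => isClosed_le continuous_const
      ((continuous_toBilin'_gramMatrix u u).comp continuous_fst)
  have h1 : ContinuousOn (fun q : (Fin n → Fin p → ℝ) × (Fin n → ℝ) =>
      lassoSolution (gramMatrix q.1) (scoreVec q.1 q.2) lam) S :=
    continuousOn_lassoSolution (fun q hq => isPosDefAbove_gramMatrix hq) ha hlam
      (fun o => (continuous_gramMatrix_mulVec o).comp continuous_fst) continuous_scoreVec
  have h2 := h1.measurable_piecewise (g := fun _ => 0) continuousOn_const hSm
  set T : Set ((Fin n → Fin p → ℝ) × (Fin n → ℝ)) :=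
    {q | q.1 ∈ D ∧ ∃ j, θ < |scoreVec q.1 q.2 j|} with hTdef
  have hT : MeasurableSet T := by
    have h3 : MeasurableSet {q : (Fin n → Fin p → ℝ) × (Fin n → ℝ) |
        ∃ j, θ < |scoreVec q.1 q.2 j|} := by
      simp only [Set.ofPred_exists]
      exact MeasurableSet.iUnion fun j => measurableSet_lt measurable_const
        (((measurable_pi_apply j).comp continuous_scoreVec.measurable).abs)
    exact (measurable_fst hD).inter h3
  have h4 : correction D θ lam = T.piecewise (S.piecewise (fun q =>
        lassoSolution (gramMatrix q.1) (scoreVec q.1 q.2) lam) fun _ => 0) fun _ => 0 := by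
    ext1 q
    by_cases hq : q ∈ T
    · have hqS : q ∈ S := (hpos q.1 hq.1).2
      rw [correction, if_pos (show q.1 ∈ D ∧ _ from hq), Set.piecewise_eq_of_mem _ _ _ hq,
        Set.piecewise_eq_of_mem _ _ _ hqS]
    · rw [correction, if_neg (show ¬(q.1 ∈ D ∧ _) from hq), Set.piecewise_eq_of_notMem _ _ _ hq]
  rw [h4]
  exact h2.piecewise hT measurable_const

lemma scoreVec_neg (x : Fin n → Fin p → ℝ) (e : Fin n → ℝ) :
    scoreVec x (fun i => -e i) = -scoreVec x e := by
  ext j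
  simp [scoreVec, neg_div]

/-- The truncation involves only absolute values of score entries, so it is invariant under a sign
change of the noise. -/
lemma correction_neg (ha : 0 < a) (hlam : 0 ≤ lam)
    (hpos : ∀ x ∈ D, IsPosDefAbove a (gramMatrix x)) (θ : ℝ) (x : Fin n → Fin p → ℝ)
    (e : Fin n → ℝ) : correction D θ lam (x, fun i => -e i) = -correction D θ lam (x, e) := by
  have hiff : (x ∈ D ∧ ∃ j, θ < |scoreVec x (fun i => -e i) j|) ↔
      x ∈ D ∧ ∃ j, θ < |scoreVec x e j| := by
    simp only [scoreVec_neg, Pi.neg_apply, abs_neg]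
  by_cases h : x ∈ D ∧ ∃ j, θ < |scoreVec x e j|
  · rw [correction, correction, if_pos h, if_pos (hiff.2 h), scoreVec_neg]
    exact (hpos x h.1).lassoSolution_neg ha hlam _
  · rw [correction, correction, if_neg h, if_neg (mt hiff.1 h), neg_zero]

/-- If some entry exceeds θ then so does the largest one, and p times its square dominates ‖z‖₂². -/
lemma l2NormSq_le_mul_sum_large {θ : ℝ} {z : Fin p → ℝ} (hz : ∃ j, θ < |z j|) :
    l2NormSq z ≤ p * ∑ j, if θ < |z j| then z j ^ 2 else 0 := by
  obtain ⟨j0, hj0⟩ := hz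
  obtain ⟨j, -, hj⟩ := Finset.exists_max_image Finset.univ (fun j => |z j|) ⟨j0, Finset.mem_univ _⟩
  have h1 : θ < |z j| := hj0.trans_le (hj j0 (Finset.mem_univ _))
  have h2 : l2NormSq z ≤ ∑ _i : Fin p, z j ^ 2 :=
    Finset.sum_le_sum fun i _ => sq_le_sq.2 (hj i (Finset.mem_univ _))
  rw [Finset.sum_const, Finset.card_univ, Fintype.card_fin, nsmul_eq_mul] at h2
  refine h2.trans (mul_le_mul_of_nonneg_left ?_ (Nat.cast_nonneg _))
  refine le_trans (le_of_eq ?_) (Finset.single_le_sum (f := fun j => if θ < |z j| then z j ^ 2 else 0)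
    (fun i _ => by split_ifs <;> positivity) (Finset.mem_univ j))
  simp [h1]

/-- The squared norm of a correction is controlled by the large entries of the score. -/
lemma l2NormSq_correction_le (ha : 0 < a) (hlam : 0 ≤ lam)
    (hpos : ∀ x ∈ D, IsPosDefAbove a (gramMatrix x)) (θ : ℝ)
    (q : (Fin n → Fin p → ℝ) × (Fin n → ℝ)) :
    l2NormSq (correction D θ lam q) ≤ p / a ^ 2 *
      ∑ j, Set.indicator {q | q.1 ∈ D ∧ θ < |scoreVec q.1 q.2 j|}
        (fun q => scoreVec q.1 q.2 j ^ 2) q := by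
  have h0 : 0 ≤ p / a ^ 2 * ∑ j, Set.indicator {q | q.1 ∈ D ∧ θ < |scoreVec q.1 q.2 j|}
        (fun q => scoreVec q.1 q.2 j ^ 2) q :=
    mul_nonneg (by positivity) (Finset.sum_nonneg fun j _ =>
      Set.indicator_nonneg (fun _ _ => sq_nonneg _) _)
  by_cases hq : q.1 ∈ D ∧ ∃ j, θ < |scoreVec q.1 q.2 j|
  · rw [correction, if_pos hq]
    have h1 := (hpos q.1 hq.1).l2Norm_lassoSolution_le ha hlam (scoreVec q.1 q.2)
    have h2 := pow_le_pow_left₀ (l2Norm_nonneg _) h1 2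
    rw [div_pow, l2Norm_sq, l2Norm_sq] at h2
    refine h2.trans ?_
    rw [div_mul_eq_mul_div]
    refine div_le_div_of_nonneg_right ?_ (sq_nonneg a)
    refine (l2NormSq_le_mul_sum_large hq.2).trans (le_of_eq ?_)
    congr 1
    refine Finset.sum_congr rfl fun j _ => ?_
    by_cases hj : θ < |scoreVec q.1 q.2 j|
    · rw [if_pos hj, Set.indicator_of_mem (show q ∈ {q | q.1 ∈ D ∧ θ < |scoreVec q.1 q.2 j|} from
        ⟨hq.1, hj⟩)]
    · rw [if_neg hj, Set.indicator_of_notMem fun h => hj h.2]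
  · rw [correction, if_neg hq]
    simpa [l2NormSq] using h0

lemma sq_gramMatrix_mulVec_le {x : Fin n → Fin p → ℝ} {b : ℝ} (hb : 0 ≤ b)
    (hx : ∀ u, Matrix.toBilin' (gramMatrix x) u u ≤ b * l2NormSq u) (o : Fin p → ℝ) (j : Fin p) :
    (gramMatrix x *ᵥ o) j ^ 2 ≤ b ^ 2 * l2NormSq o := by
  have h1 : (gramMatrix x *ᵥ o) j = Matrix.toBilin' (gramMatrix x) (Pi.single j 1) o := by
    rw [Matrix.toBilin'_apply']; simp
  have h2 := abs_bilin_le_sqrt_mul_sqrt (toBilin'_gramMatrix_symm x)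
    (toBilin'_gramMatrix_nonneg x) (Pi.single j 1) o
  rw [h1, ← sq_abs]
  refine (pow_le_pow_left₀ (abs_nonneg _) h2 2).trans ?_
  rw [mul_pow, Real.sq_sqrt (toBilin'_gramMatrix_nonneg x _),
    Real.sq_sqrt (toBilin'_gramMatrix_nonneg x _)]
  have h3 := hx (Pi.single j 1)
  rw [l2NormSq_single, one_pow, mul_one] at h3
  have := mul_le_mul h3 (hx o) (toBilin'_gramMatrix_nonneg x _) hb
  linarith

end Correction

/-! ### Markov bounds for sums over tasks -/

section Markov

variable {Ω κ : Type*} {mΩ : MeasurableSpace Ω} {μ : Measure Ω} [Fintype κ]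

lemma integral_sq_sum_of_orthogonal {g : κ → Ω → ℝ} (hg : ∀ k, MemLp (g k) 2 μ)
    (horth : ∀ k l, k ≠ l → ∫ ω, g k ω * g l ω ∂μ = 0) (α : κ → ℝ) :
    ∫ ω, (∑ k, α k * g k ω) ^ 2 ∂μ = ∑ k, α k ^ 2 * ∫ ω, g k ω ^ 2 ∂μ := by
  have h1 : ∀ ω, (∑ k, α k * g k ω) ^ 2 = ∑ k, ∑ l, (α k * α l) * (g k ω * g l ω) := by
    intro ω
    rw [sq, Finset.sum_mul_sum]
    exact Finset.sum_congr rfl fun k _ => Finset.sum_congr rfl fun l _ => by ring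
  have hint : ∀ k l, Integrable (fun ω => (α k * α l) * (g k ω * g l ω)) μ := fun k l =>
    ((hg k).integrable_mul (hg l)).const_mul _
  simp only [h1]
  rw [integral_finsetSum _ fun k _ => integrable_finsetSum _ fun l _ => hint k l]
  refine Finset.sum_congr rfl fun k _ => ?_
  rw [integral_finsetSum _ fun l _ => hint k l, Finset.sum_eq_single k]
  · rw [integral_const_mul]
    simp only [sq]
  · intro l _ hl
    rw [integral_const_mul, horth k l hl.symm, mul_zero]
  · simp

lemma measureReal_lt_abs_sum_le_of_orthogonal [IsFiniteMeasure μ] {g : κ → Ω → ℝ}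
    (hg : ∀ k, MemLp (g k) 2 μ)
    (horth : ∀ k l, k ≠ l → ∫ ω, g k ω * g l ω ∂μ = 0) (α : κ → ℝ) {B : ℝ}
    (hB : ∀ k, α k ≠ 0 → ∫ ω, g k ω ^ 2 ∂μ ≤ B) {c : ℝ} (hc : 0 < c) :
    μ.real {ω | c < |∑ k, α k * g k ω|} ≤ (∑ k, α k ^ 2) * B / c ^ 2 := by
  have hmem : MemLp (fun ω => ∑ k, α k * g k ω) 2 μ :=
    memLp_finsetSum _ fun k _ => (hg k).const_mul _
  have h1 := mul_meas_ge_le_integral_of_nonneg (μ := μ) (f := fun ω => (∑ k, α k * g k ω) ^ 2)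
    (ae_of_all _ fun _ => sq_nonneg _) hmem.integrable_sq (c ^ 2)
  rw [integral_sq_sum_of_orthogonal hg horth] at h1
  have h2 : ∑ k, α k ^ 2 * ∫ ω, g k ω ^ 2 ∂μ ≤ (∑ k, α k ^ 2) * B := by
    rw [Finset.sum_mul]
    refine Finset.sum_le_sum fun k _ => ?_
    by_cases hk : α k = 0
    · simp [hk]
    · exact mul_le_mul_of_nonneg_left (hB k hk) (sq_nonneg _)
  rw [le_div_iff₀ (by positivity), mul_comm]
  refine (mul_le_mul_of_nonneg_left (measureReal_mono fun ω hω => ?_) (by positivity)).trans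
    (h1.trans h2)
  have hω' : c < |∑ k, α k * g k ω| := hω
  change c ^ 2 ≤ (∑ k, α k * g k ω) ^ 2
  rw [← sq_abs (∑ k, _)]
  exact pow_le_pow_left₀ hc.le hω'.le 2

/-- The weight of the tasks that are hit by rare events is small. -/
lemma measureReal_lt_sum_indicator_le [IsFiniteMeasure μ] {S : κ → Set Ω}
    (hS : ∀ k, MeasurableSet (S k)) {δ : ℝ} (hδ0 : 0 ≤ δ) (hδ : ∀ k, μ.real (S k) ≤ δ) {w : κ → ℝ}
    (hw : ∀ k, 0 ≤ w k) {η : ℝ} (hη : 0 < η) :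
    μ.real {ω | η * ∑ k, w k < ∑ k, (S k).indicator (fun _ => w k) ω} ≤ δ / η := by
  have hW0 : 0 ≤ ∑ k, w k := Finset.sum_nonneg fun k _ => hw k
  rcases hW0.eq_or_lt with h0 | h0
  · have hw0 : ∀ k, w k = 0 := fun k =>
      (Finset.sum_eq_zero_iff_of_nonneg fun k _ => hw k).1 h0.symm k (Finset.mem_univ k)
    simp only [hw0, Set.indicator_zero, Finset.sum_const_zero, mul_zero, lt_self_iff_false]
    simp only [Set.ofPred_false, measureReal_empty]
    positivity
  · have hint : ∀ k, Integrable ((S k).indicator fun _ => w k) μ := fun k =>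
      (integrable_const _).indicator (hS k)
    have h1 := mul_meas_ge_le_integral_of_nonneg (μ := μ)
      (f := fun ω => ∑ k, (S k).indicator (fun _ => w k) ω)
      (ae_of_all _ fun ω => Finset.sum_nonneg fun k _ => Set.indicator_nonneg (fun _ _ => hw k) _)
      (integrable_finsetSum _ fun k _ => hint k) (η * ∑ k, w k)
    rw [integral_finsetSum _ fun k _ => hint k] at h1
    have h2 : ∑ k, ∫ ω, (S k).indicator (fun _ => w k) ω ∂μ ≤ (∑ k, w k) * δ := by
      rw [Finset.sum_mul]
      refine Finset.sum_le_sum fun k _ => ?_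
      rw [integral_indicator_const _ (hS k), smul_eq_mul, mul_comm]
      exact mul_le_mul_of_nonneg_left (hδ k) (hw k)
    have hsub : {ω | η * ∑ k, w k < ∑ k, (S k).indicator (fun _ => w k) ω} ⊆
        {ω | η * ∑ k, w k ≤ ∑ k, (S k).indicator (fun _ => w k) ω} := by
      intro ω hω
      rw [Set.mem_ofPred_eq] at hω ⊢
      exact hω.le
    have h3 : η * (∑ k, w k) * μ.real {ω | η * ∑ k, w k < ∑ k, (S k).indicator (fun _ => w k) ω} ≤
        (∑ k, w k) * δ :=
      (mul_le_mul_of_nonneg_left (measureReal_mono hsub) (by positivity)).trans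
        (h1.trans h2)
    rw [le_div_iff₀ hη]
    refine le_of_mul_le_mul_left ?_ h0
    linarith

end Markov

/-! ### Tails of the scores of a transfer problem -/

namespace TransferProblem

variable {P : TransferProblem.{u}}

/-- The index set of all noises. -/
abbrev NoiseIndex (P : TransferProblem.{u}) : Type :=
  (k : Fin (P.K + 1)) × Fin (sampleSize P.nT P.nS k)

lemma indepGaussianNoise {L σsq : ℝ≥0} {c : ℝ} (hX : P.SubGaussianDesign L c)
    (hε : P.GaussianErrors σsq) :
    IndepGaussianNoise (fun ω k i => P.X k i ω) (fun (q : P.NoiseIndex) ω => P.ε q.1 q.2 ω)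
      σsq P.μ where
  measurable_design := measurable_pi_lambda _ fun k => measurable_pi_lambda _ fun i =>
    hX.measurable k i
  measurable := fun q => hε.measurable q.1 q.2
  gaussian := fun q => hε.gaussian q.1 q.2
  indep := hε.indep
  indep_design := hε.indep_design.comp (φ := id)
    (ψ := fun (e : (k : Fin (P.K + 1)) → Fin (sampleSize P.nT P.nS k) → ℝ) (q : P.NoiseIndex) =>
      e q.1 q.2) measurable_id (measurable_pi_lambda _ fun q =>
        (measurable_pi_apply q.2).comp (measurable_pi_apply q.1))

/-- Weights of the noises in the `j`-th entry of the combination `∑ₖ αₖ zₖ` of the scores. -/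
noncomputable def noiseWeight (P : TransferProblem.{u}) (α : Fin (P.K + 1) → ℝ) (j : Fin P.p)
    (x : (k : Fin (P.K + 1)) → Fin (sampleSize P.nT P.nS k) → Fin P.p → ℝ) (q : P.NoiseIndex) : ℝ :=
  α q.1 * x q.1 q.2 j / sampleSize P.nT P.nS q.1

lemma measurable_noiseWeight (α : Fin (P.K + 1) → ℝ) (j : Fin P.p) :
    Measurable (P.noiseWeight α j) := by
  refine measurable_pi_lambda _ fun q => ?_
  unfold noiseWeight
  fun_prop

lemma sum_noiseWeight_mul (α : Fin (P.K + 1) → ℝ) (j : Fin P.p) (ω : P.Ω) :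
    ∑ q, P.noiseWeight α j (fun k i => P.X k i ω) q * P.ε q.1 q.2 ω =
      ∑ k, α k * P.score k ω j := by
  rw [Fintype.sum_sigma]
  refine Finset.sum_congr rfl fun k _ => ?_
  simp only [noiseWeight, score, scoreVec]
  rw [← mul_div_assoc, Finset.mul_sum, Finset.sum_div]
  exact Finset.sum_congr rfl fun i _ => by ring

lemma sum_noiseWeight_sq (α : Fin (P.K + 1) → ℝ) (j : Fin P.p)
    (x : (k : Fin (P.K + 1)) → Fin (sampleSize P.nT P.nS k) → Fin P.p → ℝ) :
    ∑ q, P.noiseWeight α j x q ^ 2 = ∑ k, α k ^ 2 / sampleSize P.nT P.nS k *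
      Matrix.toBilin' (gramMatrix (x k)) (Pi.single j 1) (Pi.single j 1) := by
  rw [Fintype.sum_sigma]
  refine Finset.sum_congr rfl fun k _ => ?_
  rw [toBilin'_gramMatrix]
  simp only [noiseWeight, dotProduct_single, mul_one]
  rw [Finset.sum_div, Finset.mul_sum]
  exact Finset.sum_congr rfl fun i _ => by
    rw [div_pow, mul_pow, div_mul_div_comm]; ring

section Tails

variable {L σsq : ℝ≥0} {c : ℝ} (hX : P.SubGaussianDesign L c)
  (hε : P.GaussianErrors σsq)
  {D : (k : Fin (P.K + 1)) → Set (Fin (sampleSize P.nT P.nS k) → Fin P.p → ℝ)}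
  (hD : ∀ k, MeasurableSet (D k)) {v : ℝ}
  (hv : ∀ k, ∀ x ∈ D k, ∀ j, Matrix.toBilin' (gramMatrix x) (Pi.single j 1) (Pi.single j 1) ≤ v)

lemma measurableSet_designs {D : (k : Fin (P.K + 1)) → Set (Fin (sampleSize P.nT P.nS k) →
    Fin P.p → ℝ)} (hD : ∀ k, MeasurableSet (D k)) (α : Fin (P.K + 1) → ℝ) :
    MeasurableSet {x : (k : Fin (P.K + 1)) → Fin (sampleSize P.nT P.nS k) → Fin P.p → ℝ |
      ∀ k, α k ≠ 0 → x k ∈ D k} := by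
  simp only [Set.ofPred_forall]
  exact MeasurableSet.iInter fun k => MeasurableSet.iInter fun _ => measurable_pi_apply k (hD k)

include hv in
lemma sum_noiseWeight_sq_le (α : Fin (P.K + 1) → ℝ) (j : Fin P.p)
    {x : (k : Fin (P.K + 1)) → Fin (sampleSize P.nT P.nS k) → Fin P.p → ℝ}
    (hx : ∀ k, α k ≠ 0 → x k ∈ D k) :
    ∑ q, P.noiseWeight α j x q ^ 2 ≤ (∑ k, α k ^ 2 / sampleSize P.nT P.nS k) * v := by
  rw [sum_noiseWeight_sq, Finset.sum_mul]
  refine Finset.sum_le_sum fun k _ => ?_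
  by_cases hk : α k = 0
  · simp [hk]
  · exact mul_le_mul_of_nonneg_left (hv k _ (hx k hk) j) (by positivity)

include hX hε hD hv in
-- Regular designs are asked only of the tasks with α k ≠ 0, so that `Pi.single k 1` gives the tail
-- of a single task without conditions on the others.
lemma measureReal_lt_abs_sum_score_le [IsProbabilityMeasure P.μ] (α : Fin (P.K + 1) → ℝ) (j : Fin P.p) {t : ℝ} (ht : 0 ≤ t)
    (θ : ℝ) :
    P.μ.real {ω | (∀ k, α k ≠ 0 → (fun i => P.X k i ω) ∈ D k) ∧
        θ < |∑ k, α k * P.score k ω j|} ≤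
      2 * Real.exp (t ^ 2 * (σsq * ((∑ k, α k ^ 2 / sampleSize P.nT P.nS k) * v)) / 2 - t * θ) := by
  have h := (indepGaussianNoise hX hε).measureReal_lt_abs_le (measurableSet_designs hD α)
    (measurable_noiseWeight α j) (fun x hx => sum_noiseWeight_sq_le hv α j hx) ht θ
  simp only [sum_noiseWeight_mul] at h
  exact h

include hX hε hD hv in
lemma lintegral_score_sq_truncated_le [IsProbabilityMeasure P.μ] (k : Fin (P.K + 1)) (j : Fin P.p) {t : ℝ} (ht : 0 < t)
    (θ : ℝ) :
    ∫⁻ ω in {ω | (fun i => P.X k i ω) ∈ D k ∧ θ < |P.score k ω j|},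
        ENNReal.ofReal (P.score k ω j ^ 2) ∂P.μ ≤
      ENNReal.ofReal (4 / t ^ 2 *
        Real.exp (2 * t ^ 2 * (σsq * (v / sampleSize P.nT P.nS k)) - t * θ)) := by
  have h := (indepGaussianNoise hX hε).lintegral_sq_truncated_le
    (measurableSet_designs hD (Pi.single k 1)) (measurable_noiseWeight (Pi.single k 1) j)
    (fun x hx => sum_noiseWeight_sq_le hv _ j hx) ht θ
  simp only [sum_noiseWeight_mul] at h
  have e1 : ∀ ω, ∑ l, (Pi.single k 1 : Fin (P.K + 1) → ℝ) l * P.score l ω j = P.score k ω j := by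
    intro ω
    rw [Finset.sum_eq_single k (fun l _ hl => by simp [hl]) (by simp)]
    simp
  have e2 : ∑ l, (Pi.single k 1 : Fin (P.K + 1) → ℝ) l ^ 2 / sampleSize P.nT P.nS l * v =
      v / sampleSize P.nT P.nS k := by
    rw [Finset.sum_eq_single k (fun l _ hl => by simp [hl]) (by simp)]
    simp [div_eq_inv_mul]
  rw [Finset.sum_mul] at h
  simp only [e1, e2] at h
  have e3 : {ω | (fun k i => P.X k i ω) ∈ {x : (k : Fin (P.K + 1)) →
      Fin (sampleSize P.nT P.nS k) → Fin P.p → ℝ | ∀ l, (Pi.single k 1 : Fin (P.K + 1) → ℝ) l ≠ 0 →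
        x l ∈ D l} ∧ θ < |P.score k ω j|} =
      {ω | (fun i => P.X k i ω) ∈ D k ∧ θ < |P.score k ω j|} := by
    ext ω
    refine and_congr_left fun _ => ⟨fun h => h k (by simp), fun h l hl => ?_⟩
    have : l = k := by
      by_contra hne
      exact hl (by simp [hne])
    subst this
    exact h
  rw [e3] at h
  exact h

include hX hε hD hv in
lemma measureReal_lt_abs_score_le [IsProbabilityMeasure P.μ] (k : Fin (P.K + 1)) (j : Fin P.p) {t : ℝ} (ht : 0 ≤ t)
    (θ : ℝ) :
    P.μ.real {ω | (fun i => P.X k i ω) ∈ D k ∧ θ < |P.score k ω j|} ≤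
      2 * Real.exp (t ^ 2 * (σsq * (v / sampleSize P.nT P.nS k)) / 2 - t * θ) := by
  have h := measureReal_lt_abs_sum_score_le hX hε hD hv (Pi.single k 1) j ht θ
  have e1 : ∀ ω, ∑ l, (Pi.single k 1 : Fin (P.K + 1) → ℝ) l * P.score l ω j = P.score k ω j := by
    intro ω
    rw [Finset.sum_eq_single k (fun l _ hl => by simp [hl]) (by simp)]
    simp
  have e2 : ∑ l, (Pi.single k 1 : Fin (P.K + 1) → ℝ) l ^ 2 / sampleSize P.nT P.nS l * v =
      v / sampleSize P.nT P.nS k := by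
    rw [Finset.sum_eq_single k (fun l _ hl => by simp [hl]) (by simp)]
    simp [div_eq_inv_mul]
  rw [Finset.sum_mul] at h
  simp only [e1, e2] at h
  refine (measureReal_mono fun ω hω => ?_).trans h
  refine ⟨fun l hl => ?_, hω.2⟩
  have : l = k := by
    by_contra hne
    exact hl (by simp [hne])
  subst this
  exact hω.1

end Tails

end TransferProblem

/-! ### The average of the corrections concentrates around zero -/

section

variable {n p : ℕ} {D : Set (Fin n → Fin p → ℝ)} {θ lam a : ℝ}

lemma correction_eq_zero {q : (Fin n → Fin p → ℝ) × (Fin n → ℝ)} (hq : q.1 ∉ D) :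
    correction D θ lam q = 0 := if_neg fun h => hq h.1

lemma measurable_gramMatrix_mulVec_correction (hD : MeasurableSet D) (ha : 0 < a) (hlam : 0 ≤ lam)
    (hpos : ∀ x ∈ D, IsPosDefAbove a (gramMatrix x)) (θ : ℝ) :
    Measurable fun q : (Fin n → Fin p → ℝ) × (Fin n → ℝ) =>
      gramMatrix q.1 *ᵥ correction D θ lam q := by
  have h := measurable_correction hD ha hlam hpos θ
  refine measurable_pi_lambda _ fun j => ?_
  simp only [Matrix.mulVec, dotProduct, gramMatrix]
  refine Finset.measurable_sum _ fun l _ => Measurable.mul (by fun_prop) ?_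
  exact (measurable_pi_apply l).comp h

lemma sq_gramMatrix_mulVec_correction_le {b : ℝ} (hb : 0 ≤ b)
    (hx : ∀ x ∈ D, ∀ u, Matrix.toBilin' (gramMatrix x) u u ≤ b * l2NormSq u) (j : Fin p)
    (q : (Fin n → Fin p → ℝ) × (Fin n → ℝ)) :
    (gramMatrix q.1 *ᵥ correction D θ lam q) j ^ 2 ≤ b ^ 2 * l2NormSq (correction D θ lam q) := by
  by_cases hq : q.1 ∈ D
  · exact sq_gramMatrix_mulVec_le hb (hx _ hq) _ j
  · simp [correction_eq_zero hq, l2NormSq]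

end

namespace TransferProblem

variable {P : TransferProblem.{u}}

/-- Design and noise of task `k`. -/
def taskData (P : TransferProblem.{u}) (k : Fin (P.K + 1)) (ω : P.Ω) :
    (Fin (sampleSize P.nT P.nS k) → Fin P.p → ℝ) × (Fin (sampleSize P.nT P.nS k) → ℝ) :=
  (fun i => P.X k i ω, fun i => P.ε k i ω)

variable {L σsq : ℝ≥0} {c : ℝ}

lemma measurable_taskData (hX : P.SubGaussianDesign L c) (hε : P.GaussianErrors σsq)
    (k : Fin (P.K + 1)) : Measurable (P.taskData k) :=
  (measurable_pi_lambda _ fun i => hX.measurable k i).prodMk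
    (measurable_pi_lambda _ fun i => hε.measurable k i)

/-- Flipping the noise of task k alone preserves the joint law of designs and noises and changes the
sign of the product. No independence between the designs of different tasks is required. -/
lemma integral_mul_eq_zero_of_odd [IsProbabilityMeasure P.μ] (hX : P.SubGaussianDesign L c)
    (hε : P.GaussianErrors σsq)
    {f : (k : Fin (P.K + 1)) →
      (Fin (sampleSize P.nT P.nS k) → Fin P.p → ℝ) × (Fin (sampleSize P.nT P.nS k) → ℝ) → ℝ}
    (hf : ∀ k, Measurable (f k)) (hodd : ∀ k x e, f k (x, fun i => -e i) = -f k (x, e))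
    {k l : Fin (P.K + 1)} (hkl : k ≠ l) :
    ∫ ω, f k (P.taskData k ω) * f l (P.taskData l ω) ∂P.μ = 0 := by
  refine (indepGaussianNoise hX hε).integral_eq_zero_of_odd
    (s := fun q => if q.1 = k then -1 else 1)
    (F := fun q => f k (q.1 k, fun i => q.2 ⟨k, i⟩) * f l (q.1 l, fun i => q.2 ⟨l, i⟩))
    (fun q => by by_cases h : q.1 = k <;> simp [h]) ?_ fun x e => ?_
  · refine ((hf k).comp ?_).mul ((hf l).comp ?_)
    · exact Measurable.prodMk (by fun_prop) (by fun_prop)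
    · exact Measurable.prodMk (by fun_prop) (by fun_prop)
  · simp only [if_true, if_neg hkl.symm, neg_mul, one_mul, hodd]

section Average

variable [IsProbabilityMeasure P.μ] (hX : P.SubGaussianDesign L c)
  (hε : P.GaussianErrors σsq)
  {D : (k : Fin (P.K + 1)) → Set (Fin (sampleSize P.nT P.nS k) → Fin P.p → ℝ)}
  (hD : ∀ k, MeasurableSet (D k)) {a θ lam B : ℝ} (ha : 0 < a) (hlam : 0 ≤ lam)
  (hpos : ∀ k, ∀ x ∈ D k, IsPosDefAbove a (gramMatrix x))
  (hB : ∀ k j, ∫⁻ ω in {ω | (fun i => P.X k i ω) ∈ D k ∧ θ < |P.score k ω j|},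
        ENNReal.ofReal (P.score k ω j ^ 2) ∂P.μ ≤ ENNReal.ofReal B) (hB0 : 0 ≤ B)

include hX hε hD ha hlam hpos hB hB0

omit [IsProbabilityMeasure P.μ] hB0 in
lemma lintegral_l2NormSq_correction_le (k : Fin (P.K + 1)) :
    ∫⁻ ω, ENNReal.ofReal (l2NormSq (correction (D k) θ lam (P.taskData k ω))) ∂P.μ ≤
      ENNReal.ofReal (P.p ^ 2 / a ^ 2 * B) := by
  have hscore : ∀ j, Measurable fun ω => P.score k ω j := fun j =>
    (measurable_pi_apply j).comp (continuous_scoreVec.measurable.comp (measurable_taskData hX hε k))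
  have hXk : Measurable fun ω i => P.X k i ω := measurable_pi_lambda _ fun i => hX.measurable k i
  have hS : ∀ j, MeasurableSet {ω | (fun i => P.X k i ω) ∈ D k ∧ θ < |P.score k ω j|} := fun j =>
    (hXk (hD k)).inter (measurableSet_lt measurable_const (hscore j).abs)
  have hpt : ∀ ω, ENNReal.ofReal (l2NormSq (correction (D k) θ lam (P.taskData k ω))) ≤
      ENNReal.ofReal (P.p / a ^ 2) * ∑ j,
        Set.indicator {ω | (fun i => P.X k i ω) ∈ D k ∧ θ < |P.score k ω j|}
          (fun ω => ENNReal.ofReal (P.score k ω j ^ 2)) ω := by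
    intro ω
    have h1 := l2NormSq_correction_le ha hlam (hpos k) θ (P.taskData k ω)
    refine (ENNReal.ofReal_le_ofReal h1).trans (le_of_eq ?_)
    rw [ENNReal.ofReal_mul (by positivity), ENNReal.ofReal_sum_of_nonneg fun j _ =>
      Set.indicator_nonneg (fun _ _ => sq_nonneg _) _]
    congr 1
    refine Finset.sum_congr rfl fun j _ => ?_
    by_cases h : (fun i => P.X k i ω) ∈ D k ∧ θ < |P.score k ω j|
    · rw [Set.indicator_of_mem (show P.taskData k ω ∈ {q | q.1 ∈ D k ∧ θ < |scoreVec q.1 q.2 j|}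
        from h), Set.indicator_of_mem
        (show ω ∈ {ω | (fun i => P.X k i ω) ∈ D k ∧ θ < |P.score k ω j|} from h)]
      rfl
    · rw [Set.indicator_of_notMem
        (show P.taskData k ω ∉ {q | q.1 ∈ D k ∧ θ < |scoreVec q.1 q.2 j|} from h),
        Set.indicator_of_notMem
        (show ω ∉ {ω | (fun i => P.X k i ω) ∈ D k ∧ θ < |P.score k ω j|} from h),
        ENNReal.ofReal_zero]
  refine (lintegral_mono hpt).trans ?_
  have hm : ∀ j, Measurable (Set.indicator {ω | (fun i => P.X k i ω) ∈ D k ∧ θ < |P.score k ω j|}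
          (fun ω => ENNReal.ofReal (P.score k ω j ^ 2))) := fun j =>
    Measurable.indicator ((hscore j).pow_const 2).ennreal_ofReal (hS j)
  rw [lintegral_const_mul _ (Finset.measurable_sum _ fun j _ => hm j),
    lintegral_finsetSum _ fun j _ => hm j]
  have h2 : ∑ j, ∫⁻ ω, Set.indicator {ω | (fun i => P.X k i ω) ∈ D k ∧ θ < |P.score k ω j|}
          (fun ω => ENNReal.ofReal (P.score k ω j ^ 2)) ω ∂P.μ ≤ ENNReal.ofReal (P.p * B) := by
    calc _ ≤ ∑ _j : Fin P.p, ENNReal.ofReal B := Finset.sum_le_sum fun j _ => by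
          rw [lintegral_indicator (hS j)]; exact hB k j
      _ = _ := by
          rw [Finset.sum_const, Finset.card_univ, Fintype.card_fin, nsmul_eq_mul,
            ENNReal.ofReal_mul (Nat.cast_nonneg _), ENNReal.ofReal_natCast]
  refine (mul_le_mul_right h2 _).trans (le_of_eq ?_)
  rw [← ENNReal.ofReal_mul (by positivity)]
  congr 1
  ring

/-- Averages over the tasks of odd statistics dominated by the corrections are small. -/
lemma measureReal_lt_abs_sum_odd_le
    {f : (k : Fin (P.K + 1)) →
      (Fin (sampleSize P.nT P.nS k) → Fin P.p → ℝ) × (Fin (sampleSize P.nT P.nS k) → ℝ) → ℝ}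
    (hf : ∀ k, Measurable (f k)) (hodd : ∀ k x e, f k (x, fun i => -e i) = -f k (x, e))
    {b : ℝ} (hb : 0 ≤ b)
    (hfb : ∀ k q, f k q ^ 2 ≤ b * l2NormSq (correction (D k) θ lam q)) (α : Fin (P.K + 1) → ℝ)
    {r : ℝ} (hr : 0 < r) :
    P.μ.real {ω | r < |∑ k, α k * f k (P.taskData k ω)|} ≤
      (∑ k, α k ^ 2) * (b * (P.p ^ 2 / a ^ 2 * B)) / r ^ 2 := by
  have hfm : ∀ k, Measurable fun ω => f k (P.taskData k ω) := fun k =>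
    (hf k).comp (measurable_taskData hX hε k)
  have hl : ∀ k, ∫⁻ ω, ENNReal.ofReal (f k (P.taskData k ω) ^ 2) ∂P.μ ≤
      ENNReal.ofReal (b * (P.p ^ 2 / a ^ 2 * B)) := by
    intro k
    have hcm : Measurable fun ω =>
        ENNReal.ofReal (l2NormSq (correction (D k) θ lam (P.taskData k ω))) :=
      (continuous_l2NormSq.measurable.comp ((measurable_correction (hD k) ha hlam (hpos k) θ).comp
        (measurable_taskData hX hε k))).ennreal_ofReal
    calc _ ≤ ∫⁻ ω, ENNReal.ofReal b *
          ENNReal.ofReal (l2NormSq (correction (D k) θ lam (P.taskData k ω))) ∂P.μ :=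
          lintegral_mono fun ω => by
            rw [← ENNReal.ofReal_mul hb]
            exact ENNReal.ofReal_le_ofReal (hfb k _)
      _ = ENNReal.ofReal b * _ := lintegral_const_mul _ hcm
      _ ≤ _ := by
          rw [ENNReal.ofReal_mul hb]
          exact mul_le_mul_right
            (lintegral_l2NormSq_correction_le hX hε hD ha hlam hpos hB k) _
  have hmem : ∀ k, MemLp (fun ω => f k (P.taskData k ω)) 2 P.μ := by
    intro k
    rw [memLp_two_iff_integrable_sq (hfm k).aestronglyMeasurable]
    refine ⟨((hfm k).pow_const 2).aestronglyMeasurable, ?_⟩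
    rw [hasFiniteIntegral_iff_ofReal (ae_of_all _ fun _ => sq_nonneg _)]
    exact (hl k).trans_lt ENNReal.ofReal_lt_top
  refine measureReal_lt_abs_sum_le_of_orthogonal hmem
    (fun k l hkl => integral_mul_eq_zero_of_odd hX hε hf hodd hkl) α (fun k _ => ?_) hr
  have h1 := hl k
  rw [← ofReal_integral_eq_lintegral_ofReal (hmem k).integrable_sq
    (ae_of_all _ fun _ => sq_nonneg _)] at h1
  exact (ENNReal.ofReal_le_ofReal_iff (by positivity)).1 h1

lemma measureReal_lt_abs_sum_correction_le (α : Fin (P.K + 1) → ℝ) (j : Fin P.p)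
    {r : ℝ} (hr : 0 < r) :
    P.μ.real {ω | r < |∑ k, α k * correction (D k) θ lam (P.taskData k ω) j|} ≤
      (∑ k, α k ^ 2) * (P.p ^ 2 / a ^ 2 * B) / r ^ 2 := by
  have h := measureReal_lt_abs_sum_odd_le hX hε hD ha hlam hpos hB hB0
    (f := fun k q => correction (D k) θ lam q j)
    (fun k => (measurable_pi_apply j).comp (measurable_correction (hD k) ha hlam (hpos k) θ))
    (fun k x e => by rw [correction_neg ha hlam (hpos k), Pi.neg_apply]) zero_le_one
    (fun k q => by
      rw [one_mul]
      exact Finset.single_le_sum (f := fun j => correction (D k) θ lam q j ^ 2)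
        (fun _ _ => sq_nonneg _) (Finset.mem_univ j)) α hr
  rwa [one_mul] at h

lemma measureReal_lt_abs_sum_gram_mulVec_correction_le {b : ℝ} (hb : 0 ≤ b)
    (hup : ∀ k, ∀ x ∈ D k, ∀ u, Matrix.toBilin' (gramMatrix x) u u ≤ b * l2NormSq u)
    (α : Fin (P.K + 1) → ℝ) (j : Fin P.p) {r : ℝ} (hr : 0 < r) :
    P.μ.real {ω | r < |∑ k, α k * (P.gram k ω *ᵥ correction (D k) θ lam (P.taskData k ω)) j|} ≤
      (∑ k, α k ^ 2) * (b ^ 2 * (P.p ^ 2 / a ^ 2 * B)) / r ^ 2 :=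
  measureReal_lt_abs_sum_odd_le hX hε hD ha hlam hpos hB hB0
    (f := fun k q => (gramMatrix q.1 *ᵥ correction (D k) θ lam q) j)
    (fun k => (measurable_pi_apply j).comp
      (measurable_gramMatrix_mulVec_correction (hD k) ha hlam (hpos k) θ))
    (fun k x e => by
      dsimp only
      rw [correction_neg ha hlam (hpos k), Matrix.mulVec_neg, Pi.neg_apply]) (sq_nonneg b)
    (fun k q => sq_gramMatrix_mulVec_correction_le hb (hup k) j q) α hr

end Average

end TransferProblem

/-! ### The good event has high probability -/

section

/-- Bookkeeping for the Chernoff parameter t = √(n log p): thresholds of order √(log p / n) and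
variances of order 1/n both contribute multiples of log p to the exponent. -/
lemma sqrt_mul_mul_sqrt_div {n ℓ : ℝ} (hn : 0 < n) (hℓ : 0 ≤ ℓ) (r : ℝ) :
    √(n * ℓ) * (r * √(ℓ / n)) = r * ℓ := by
  have h : √(n * ℓ) * √(ℓ / n) = ℓ := by
    rw [← Real.sqrt_mul (by positivity), show n * ℓ * (ℓ / n) = ℓ ^ 2 by field_simp,
      Real.sqrt_sq hℓ]
  calc _ = r * (√(n * ℓ) * √(ℓ / n)) := by ring
    _ = _ := by rw [h]

lemma sqrt_mul_sq_mul {n ℓ : ℝ} (hn : 0 < n) (hℓ : 0 ≤ ℓ) (x v : ℝ) :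
    √(n * ℓ) ^ 2 * (x * (v / n)) = ℓ * (x * v) := by
  rw [Real.sq_sqrt (by positivity)]
  field_simp

lemma measureReal_iUnion_le_card_mul {Ω ι : Type*} {mΩ : MeasurableSpace Ω} {μ : Measure Ω}
    [Fintype ι] {S : ι → Set Ω} {δ : ℝ} (h : ∀ j, μ.real (S j) ≤ δ) :
    μ.real (⋃ j, S j) ≤ Fintype.card ι * δ := by
  refine (measureReal_iUnion_fintype_le _).trans ((Finset.sum_le_sum fun j _ => h j).trans ?_)
  rw [Finset.sum_const, Finset.card_univ, nsmul_eq_mul]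

end

namespace TransferProblem

variable {P : TransferProblem.{u}}

section

variable {A C_T : ℝ} (hS : P.SizeConditions A C_T)

include hS

lemma SizeConditions.exp_logp : Real.exp P.logp = P.p := by
  have : (0 : ℝ) < P.p := by exact_mod_cast hS.p_pos
  exact Real.exp_log this

lemma SizeConditions.one_le_p : (1 : ℝ) ≤ P.p := by exact_mod_cast hS.p_pos

/-- All exponents are tuned to 8 log p, so that union bounds and second-moment factors up to p⁷ can
be afforded. -/
lemma SizeConditions.pow_mul_exp_le {m : ℕ} (hm : m ≤ 7) :
    (P.p : ℝ) ^ m * Real.exp (-(8 * P.logp)) ≤ Real.exp (-P.logp) := by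
  have h1 : (P.p : ℝ) ^ m ≤ Real.exp (7 * P.logp) := by
    have : Real.exp (7 * P.logp) = (P.p : ℝ) ^ 7 := by
      rw [← hS.exp_logp, ← Real.exp_nat_mul]; norm_num
    rw [this]
    exact pow_le_pow_right₀ hS.one_le_p hm
  refine (mul_le_mul_of_nonneg_right h1 (Real.exp_pos _).le).trans (le_of_eq ?_)
  rw [← Real.exp_add]
  ring_nf

lemma SizeConditions.sampleSize_pos (k : Fin (P.K + 1)) :
    (0 : ℝ) < sampleSize P.nT P.nS k := by
  by_cases hk : k = 0
  · simpa [sampleSize, hk] using hS.nT_pos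
  · have := hS.nS_pos
    simpa [sampleSize, hk] using this

lemma SizeConditions.logp_div_sampleSize_le (k : Fin (P.K + 1)) :
    P.logp / sampleSize P.nT P.nS k ≤ C_T := by
  refine le_trans ?_ hS.logp_div_nT_le
  refine div_le_div_of_nonneg_left hS.logp_pos.le hS.nT_pos' ?_
  by_cases hk : k = 0
  · simp [sampleSize, hk]
  · have := hS.nT_le
    simpa [sampleSize, hk] using this

/-- Since w_k²/n_k = w_k/N, the pooled score fluctuates like the score of one sample of size N. -/
lemma SizeConditions.sum_wt_sq_div : ∑ k, P.wt k ^ 2 / sampleSize P.nT P.nS k = 1 / P.N := by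
  rw [← P.sum_wt hS.N_pos, Finset.sum_div]
  refine Finset.sum_congr rfl fun k _ => ?_
  have h1 := (hS.sampleSize_pos k).ne'
  have h2 := hS.N_pos.ne'
  unfold wt
  field_simp

lemma SizeConditions.sum_wt_sq_le : ∑ k, P.wt k ^ 2 ≤ P.nS / P.N := by
  have h : ∀ k, P.wt k ^ 2 ≤ P.nS / P.N * P.wt k := by
    intro k
    rw [sq]
    refine mul_le_mul_of_nonneg_right ?_ (hS.wt_pos k).le
    by_cases hk : k = 0
    · rw [hk, wt_zero]
      exact div_le_div_of_nonneg_right (by exact_mod_cast hS.nT_le) hS.N_pos.le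
    · rw [P.wt_of_ne hk]
  refine (Finset.sum_le_sum fun k _ => h k).trans ?_
  rw [← Finset.mul_sum, P.sum_wt hS.N_pos, mul_one]

end

section Regimes

variable [IsProbabilityMeasure P.μ] {L σsq : ℝ≥0} {c A C_T c0 : ℝ}
  (hX : P.SubGaussianDesign L c) (hε : P.GaussianErrors σsq) (hS : P.SizeConditions A C_T)
  (hA : 1 ≤ A) (hCT : 1 ≤ C_T)
  (hc0 : 32 + 8 * (σsq * (2 * A ^ 2 * C_T)) ≤ c0)
  {D : (k : Fin (P.K + 1)) → Set (Fin (sampleSize P.nT P.nS k) → Fin P.p → ℝ)}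
  (hD : ∀ k, MeasurableSet (D k))
  (hRE : ∀ k, ∀ x ∈ D k, RestrictedEigenvalue A (√(P.logp / sampleSize P.nT P.nS k))
    (Matrix.toBilin' (gramMatrix x)))

include hS hCT hRE in
omit [IsProbabilityMeasure P.μ] in
lemma diag_le_of_restrictedEigenvalue (k : Fin (P.K + 1)) {x} (hx : x ∈ D k) (j : Fin P.p) :
    Matrix.toBilin' (gramMatrix x) (Pi.single j 1) (Pi.single j 1) ≤ 2 * A ^ 2 * C_T := by
  have h1 := (hRE k x hx (Pi.single j 1)).2
  have h2 := hS.logp_div_sampleSize_le k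
  rw [l2NormSq_single, l1Norm_single, abs_one, Real.sq_sqrt
    (div_nonneg hS.logp_pos.le (hS.sampleSize_pos k).le)] at h1
  have h3 : A ^ 2 * (1 ^ 2 + P.logp / sampleSize P.nT P.nS k * 1 ^ 2) ≤ A ^ 2 * (2 * C_T) :=
    mul_le_mul_of_nonneg_left (by linarith) (sq_nonneg A)
  linarith

include hX hε hS hCT hc0 hD hRE

lemma measureReal_pooled_score_le (j : Fin P.p) :
    P.μ.real {ω | (∀ k, (fun i => P.X k i ω) ∈ D k) ∧
      c0 / 4 * √(P.logp / P.N) < |∑ k, P.wt k * P.score k ω j|} ≤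
      2 * Real.exp (-(8 * P.logp)) := by
  have h := measureReal_lt_abs_sum_score_le hX hε hD
    (fun k x hx j => diag_le_of_restrictedEigenvalue hS hCT hRE k hx j) P.wt j
    (Real.sqrt_nonneg (P.N * P.logp)) (c0 / 4 * √(P.logp / P.N))
  refine (measureReal_mono fun ω hω => ?_).trans (h.trans ?_)
  · rw [Set.mem_ofPred_eq] at hω ⊢
    exact ⟨fun k _ => hω.1 k, hω.2⟩
  rw [hS.sum_wt_sq_div, div_mul_eq_mul_div, one_mul, sqrt_mul_sq_mul hS.N_pos hS.logp_pos.le,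
    sqrt_mul_mul_sqrt_div hS.N_pos hS.logp_pos.le]
  have h1 := hS.logp_pos
  have h2 : 0 ≤ (σsq : ℝ) * (2 * A ^ 2 * C_T) := by positivity
  gcongr
  nlinarith

lemma measureReal_task_score_le (k : Fin (P.K + 1)) (j : Fin P.p) {r : ℝ} (hr : c0 / 4 ≤ r) :
    P.μ.real {ω | (fun i => P.X k i ω) ∈ D k ∧
      r * √(P.logp / sampleSize P.nT P.nS k) < |P.score k ω j|} ≤
      2 * Real.exp (-(8 * P.logp)) := by
  have hn := hS.sampleSize_pos k
  have h := measureReal_lt_abs_score_le hX hε hD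
    (fun k x hx j => diag_le_of_restrictedEigenvalue hS hCT hRE k hx j) k j
    (Real.sqrt_nonneg (sampleSize P.nT P.nS k * P.logp))
    (r * √(P.logp / sampleSize P.nT P.nS k))
  refine h.trans ?_
  rw [sqrt_mul_sq_mul hn hS.logp_pos.le, sqrt_mul_mul_sqrt_div hn hS.logp_pos.le]
  have h1 := hS.logp_pos
  have h2 : 0 ≤ (σsq : ℝ) * (2 * A ^ 2 * C_T) := by positivity
  gcongr
  nlinarith

lemma lintegral_source_score_sq_le {k : Fin (P.K + 1)} (hk : k ≠ 0) (j : Fin P.p) :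
    ∫⁻ ω in {ω | (fun i => P.X k i ω) ∈ D k ∧ 4 * c0 * √(P.logp / P.nS) < |P.score k ω j|},
        ENNReal.ofReal (P.score k ω j ^ 2) ∂P.μ ≤
      ENNReal.ofReal (4 / P.nS * Real.exp (-(8 * P.logp))) := by
  have hn := hS.nS_pos
  have hl := hS.logp_pos
  have h := lintegral_score_sq_truncated_le hX hε hD
    (fun k x hx j => diag_le_of_restrictedEigenvalue hS hCT hRE k hx j) k j
    (t := √(P.nS * P.logp)) (Real.sqrt_pos.2 (by positivity)) (4 * c0 * √(P.logp / P.nS))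
  refine h.trans (ENNReal.ofReal_le_ofReal ?_)
  have hsz : (sampleSize P.nT P.nS k : ℝ) = P.nS := by simp [sampleSize, hk]
  rw [hsz, mul_assoc 2, sqrt_mul_sq_mul hn hl.le, sqrt_mul_mul_sqrt_div hn hl.le,
    Real.sq_sqrt (by positivity)]
  have h2 : 0 ≤ (σsq : ℝ) * (2 * A ^ 2 * C_T) := by positivity
  have h3 := hS.one_le_logp
  refine mul_le_mul ?_ (Real.exp_le_exp.2 ?_) (Real.exp_pos _).le (by positivity)
  · refine div_le_div_of_nonneg_left (by norm_num) hn ?_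
    nlinarith
  · nlinarith

/-- With few source tasks no score exceeds the penalty. -/
theorem measureReal_not_goodEvent_le_of_few_tasks (hK : P.K ≤ P.p) {η : ℝ} (hη : 0 ≤ η)
    (hΘ : P.InParameterSpace) :
    P.μ.real {ω | (∀ k, (fun i => P.X k i ω) ∈ D k) ∧
      ¬ P.GoodEvent A c0 c0 η ω (fun _ => 0) Finset.univ} ≤ 8 * Real.exp (-P.logp) := by
  set S1 : Set P.Ω := ⋃ j, {ω | (∀ k, (fun i => P.X k i ω) ∈ D k) ∧
      c0 / 4 * √(P.logp / P.N) < |∑ k, P.wt k * P.score k ω j|} with hS1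
  set S2 : Set P.Ω := ⋃ q : Fin (P.K + 1) × Fin P.p, {ω | (fun i => P.X q.1 i ω) ∈ D q.1 ∧
      c0 / 2 * √(P.logp / sampleSize P.nT P.nS q.1) < |P.score q.1 ω q.2|} with hS2
  have hc0' : 32 ≤ c0 := by
    have h2 : 0 ≤ (σsq : ℝ) * (2 * A ^ 2 * C_T) := by positivity
    linarith
  have hsub : {ω | (∀ k, (fun i => P.X k i ω) ∈ D k) ∧
      ¬ P.GoodEvent A c0 c0 η ω (fun _ => 0) Finset.univ} ⊆ S1 ∪ S2 := by
    intro ω hω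
    rw [Set.mem_ofPred_eq] at hω
    obtain ⟨hdes, hbad⟩ := hω
    by_contra hcon
    refine hbad ?_
    simp only [hS1, hS2, Set.mem_union, Set.mem_iUnion, Set.mem_ofPred_eq, not_or, not_exists,
      not_and, not_lt] at hcon
    obtain ⟨h1, h2⟩ := hcon
    exact
      { restricted := fun k => hRE k _ (hdes k)
        zero_mem := Finset.mem_univ 0
        good_zero := fun k _ => rfl
        good_score := fun k _ hk j => by
          have h3 := h2 (k, j) (hdes k)
          have hsz : (sampleSize P.nT P.nS k : ℝ) = P.nS := by simp [sampleSize, hk]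
          rw [hsz] at h3
          refine h3.trans (mul_le_mul_of_nonneg_right (by linarith) (Real.sqrt_nonneg _))
        bad_variational := fun k hk => absurd (Finset.mem_univ k) hk
        bad_dim := fun k hk => absurd (Finset.mem_univ k) hk
        bad_wt := by simpa using hη
        bad_shift := by simpa using mul_nonneg hη (hS.hbar_nonneg hΘ)
        total_score := fun j => by
          have h3 := h1 j hdes
          simp only [Matrix.mulVec_zero, sub_zero, Finset.sum_apply, Pi.smul_apply, smul_eq_mul]
          refine h3.trans (mul_le_mul_of_nonneg_right (by linarith) (Real.sqrt_nonneg _))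
        correction := by
          have := hS.N_pos
          simp only [smul_zero, Finset.sum_const_zero]
          rw [← l2Norm_sq, l2Norm_zero, zero_pow two_ne_zero]
          positivity
        target_score := fun j => by simpa [sampleSize] using h2 (0, j) (hdes 0) }
  refine (measureReal_mono hsub).trans ((measureReal_union_le _ _).trans ?_)
  have h1 : P.μ.real S1 ≤ P.p * (2 * Real.exp (-(8 * P.logp))) := by
    have := measureReal_iUnion_le_card_mul fun j =>
      measureReal_pooled_score_le hX hε hS hCT hc0 hD hRE j
    rwa [Fintype.card_fin] at this
  have h2 : P.μ.real S2 ≤ ((P.K + 1 : ℕ) * P.p : ℝ) * (2 * Real.exp (-(8 * P.logp))) := by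
    have := measureReal_iUnion_le_card_mul fun q : Fin (P.K + 1) × Fin P.p =>
      measureReal_task_score_le hX hε hS hCT hc0 hD hRE q.1 q.2 (r := c0 / 2) (by linarith)
    rwa [Fintype.card_prod, Fintype.card_fin, Fintype.card_fin, Nat.cast_mul] at this
  have hp := hS.one_le_p
  have hK' : (P.K : ℝ) ≤ P.p := by exact_mod_cast hK
  have h3 := hS.pow_mul_exp_le (m := 2) (by norm_num)
  have h4 : (P.p : ℝ) + ((P.K + 1 : ℕ) * P.p : ℝ) ≤ 4 * P.p ^ 2 := by
    push_cast
    nlinarith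
  have h5 := mul_le_mul_of_nonneg_right h4 (Real.exp_pos (-(8 * P.logp))).le
  linarith

include hA in
/-- In low dimension, the corrections take care of the tasks whose score exceeds the penalty. -/
theorem measureReal_not_goodEvent_le_of_low_dim (hdim : 2 * A ^ 2 * (P.logp / P.nS) * P.p ≤ 1)
    (hΘ : P.InParameterSpace) :
    P.μ.real {ω | (∀ k, (fun i => P.X k i ω) ∈ D k) ∧
      ¬ ∃ o G, P.GoodEvent A c0 c0 (1 / (96 * A ^ 6 * √P.p)) ω o G} ≤
      (4 + 32 * A ^ 8 + 384 * A ^ 6) * Real.exp (-P.logp) := by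
  classical
  have hn := hS.nS_pos
  have hN := hS.N_pos
  have hl := hS.logp_pos
  have hp := hS.one_le_p
  have hp0 : (0 : ℝ) < P.p := by linarith
  have hA0 : 0 < A := by linarith
  have hc0' : 32 ≤ c0 := by
    have h2 : 0 ≤ (σsq : ℝ) * (2 * A ^ 2 * C_T) := by positivity
    linarith
  set θ := 4 * c0 * √(P.logp / P.nS) with hθ
  set lam := 8 * c0 * √(P.logp / P.nS) with hlam
  have hlam0 : 0 ≤ lam := by positivity
  set a := 1 / (2 * A ^ 2) with ha
  have ha0 : 0 < a := by positivity
  -- Chosen so that 3 A² √p η = 1/(32 A⁴), which is what `combined_bound` demands of the product.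
  set η := 1 / (96 * A ^ 6 * √P.p) with hη
  have hη0 : 0 < η := by positivity
  set B := 4 / P.nS * Real.exp (-(8 * P.logp)) with hB
  have hB0 : 0 ≤ B := by positivity
  -- The design set of the target is emptied, so that its correction vanishes identically and 0
  -- always lies in G.
  set D' : (k : Fin (P.K + 1)) → Set (Fin (sampleSize P.nT P.nS k) → Fin P.p → ℝ) :=
    Function.update D 0 ∅ with hD'
  have hD'0 : D' 0 = ∅ := Function.update_self _ _ _
  have hD'ne : ∀ k, k ≠ 0 → D' k = D k := fun k hk => Function.update_of_ne hk _ _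
  have hsz : ∀ k : Fin (P.K + 1), k ≠ 0 → (sampleSize P.nT P.nS k : ℝ) = P.nS := fun k hk => by
    simp [sampleSize, hk]
  have hD'm : ∀ k, MeasurableSet (D' k) := by
    intro k
    by_cases hk : k = 0
    · subst hk; rw [hD'0]; exact MeasurableSet.empty
    · rw [hD'ne k hk]; exact hD k
  have hlow : ∀ k : Fin (P.K + 1), k ≠ 0 → 2 * A ^ 2 * √(P.logp / sampleSize P.nT P.nS k) ^ 2 * P.p ≤ 1 := by
    intro k hk
    rw [hsz k hk, Real.sq_sqrt (by positivity)]
    exact hdim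
  have hmem' : ∀ k x, x ∈ D' k → k ≠ 0 ∧ x ∈ D k := by
    intro k x hx
    by_cases hk : k = 0
    · subst hk; rw [hD'0] at hx; exact absurd hx (Set.notMem_empty _)
    · exact ⟨hk, by rwa [hD'ne k hk] at hx⟩
  have hpos : ∀ k, ∀ x ∈ D' k, IsPosDefAbove a (gramMatrix x) := by
    intro k x hx
    obtain ⟨hk, hx⟩ := hmem' k x hx
    refine isPosDefAbove_gramMatrix fun u => ?_
    have := (hRE k x hx).l2NormSq_le_of_low_dim (hlow k hk) u
    rw [ha, div_mul_eq_mul_div, one_mul, div_le_iff₀ (by positivity)]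
    linarith
  have hup : ∀ k, ∀ x ∈ D' k, ∀ u, Matrix.toBilin' (gramMatrix x) u u ≤
      2 * A ^ 2 * l2NormSq u := by
    intro k x hx u
    obtain ⟨hk, hx⟩ := hmem' k x hx
    exact (hRE k x hx).le_of_low_dim hA (hlow k hk) u
  have hBk : ∀ k j, ∫⁻ ω in {ω | (fun i => P.X k i ω) ∈ D' k ∧ θ < |P.score k ω j|},
        ENNReal.ofReal (P.score k ω j ^ 2) ∂P.μ ≤ ENNReal.ofReal B := by
    intro k j
    by_cases hk : k = 0
    · subst hk; simp [hD'0]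
    · rw [hD'ne k hk]
      exact lintegral_source_score_sq_le hX hε hS hCT hc0 hD hRE hk j
  set o : P.Ω → Fin (P.K + 1) → Fin P.p → ℝ := fun ω k => correction (D' k) θ lam (P.taskData k ω)
    with ho
  set bad : Fin (P.K + 1) → Set P.Ω := fun k =>
    {ω | (fun i => P.X k i ω) ∈ D' k ∧ ∃ j, θ < |P.score k ω j|} with hbad
  have hXk : ∀ k, Measurable fun ω i => P.X k i ω := fun k =>
    measurable_pi_lambda _ fun i => hX.measurable k i
  have hbadm : ∀ k, MeasurableSet (bad k) := by
    intro k
    have h3 : MeasurableSet {ω | ∃ j, θ < |P.score k ω j|} := by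
      simp only [Set.ofPred_exists]
      exact MeasurableSet.iUnion fun j => measurableSet_lt measurable_const
        (((measurable_pi_apply j).comp
          (continuous_scoreVec.measurable.comp (measurable_taskData hX hε k))).abs)
    exact (hXk k (hD'm k)).inter h3
  have hbadp : ∀ k, P.μ.real (bad k) ≤ P.p * (2 * Real.exp (-(8 * P.logp))) := by
    intro k
    by_cases hk : k = 0
    · have : bad k = ∅ := by
        subst hk
        ext ω
        simp [hbad, hD'0]
      rw [this, measureReal_empty]
      positivity
    · have h1 := measureReal_iUnion_le_card_mul fun j : Fin P.p =>
        measureReal_task_score_le hX hε hS hCT hc0 hD hRE k j (r := 4 * c0) (by linarith)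
      rw [Fintype.card_fin, hsz k hk] at h1
      refine (measureReal_mono fun ω hω => ?_).trans h1
      obtain ⟨hd, j, hj⟩ := hω
      rw [hD'ne k hk] at hd
      exact Set.mem_iUnion.2 ⟨j, hd, hj⟩
  have hshift : ∀ k, 0 ≤ P.wt k * P.shift k := fun k =>
    mul_nonneg (hS.wt_pos k).le (shift_nonneg hΘ k)
  -- S1 and S2 are sub-Gaussian tails of the pooled and the target score, S3 and S4 Chebyshev events
  -- for the averaged odd corrections, S5 and S6 Markov events for the weight and the shift carried
  -- by the bad tasks.
  set S1 : Set P.Ω := ⋃ j, {ω | (∀ k, (fun i => P.X k i ω) ∈ D k) ∧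
      c0 / 4 * √(P.logp / P.N) < |∑ k, P.wt k * P.score k ω j|} with hS1
  set S2 : Set P.Ω := ⋃ j, {ω | (fun i => P.X 0 i ω) ∈ D 0 ∧
      c0 / 2 * √(P.logp / sampleSize P.nT P.nS 0) < |P.score 0 ω j|} with hS2
  set S3 : Set P.Ω := ⋃ j, {ω | c0 / 4 * √(P.logp / P.N) <
    |∑ k, P.wt k * (P.gram k ω *ᵥ o ω k) j|} with hS3
  set S4 : Set P.Ω := ⋃ j, {ω | 1 / (P.p * √P.N) < |∑ k, P.wt k * o ω k j|} with hS4
  set S5 : Set P.Ω := {ω | η * ∑ k, P.wt k < ∑ k, (bad k).indicator (fun _ => P.wt k) ω} with hS5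
  set S6 : Set P.Ω := {ω | η * ∑ k, P.wt k * P.shift k <
    ∑ k, (bad k).indicator (fun _ => P.wt k * P.shift k) ω} with hS6
  have hsub : {ω | (∀ k, (fun i => P.X k i ω) ∈ D k) ∧ ¬ ∃ o G, P.GoodEvent A c0 c0 η ω o G} ⊆
      S1 ∪ S2 ∪ S3 ∪ S4 ∪ S5 ∪ S6 := by
    intro ω hω
    rw [Set.mem_ofPred_eq] at hω
    obtain ⟨hdes, hnot⟩ := hω
    by_contra hcon
    refine hnot ?_
    simp only [hS1, hS2, hS3, hS4, hS5, hS6, Set.mem_union, Set.mem_iUnion, Set.mem_ofPred_eq,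
      not_or, not_exists, not_and, not_lt] at hcon
    obtain ⟨⟨⟨⟨⟨h1, h2⟩, h3⟩, h4⟩, h5⟩, h6⟩ := hcon
    have hGc : ∀ w : Fin (P.K + 1) → ℝ, ∑ k ∈ (Finset.univ.filter fun k => ω ∉ bad k)ᶜ, w k =
        ∑ k, (bad k).indicator (fun _ => w k) ω := by
      intro w
      rw [Finset.compl_filter, Finset.sum_filter]
      refine Finset.sum_congr rfl fun k _ => ?_
      by_cases hk : ω ∈ bad k
      · rw [Set.indicator_of_mem hk, if_pos (not_not.2 hk)]
      · rw [Set.indicator_of_notMem hk, if_neg (not_not.not.2 hk)]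
    have hdes' : ∀ k, k ≠ 0 → (fun i => P.X k i ω) ∈ D' k := fun k hk => by
      rw [hD'ne k hk]; exact hdes k
    have hbad0 : ∀ k, ω ∈ bad k → k ≠ 0 := fun k hk => (hmem' k _ hk.1).1
    refine ⟨o ω, Finset.univ.filter fun k => ω ∉ bad k, ?_⟩
    exact
      { restricted := fun k => hRE k _ (hdes k)
        zero_mem := by
          rw [Finset.mem_filter]
          exact ⟨Finset.mem_univ _, fun h => hbad0 0 h rfl⟩
        good_zero := fun k hk => by
          rw [Finset.mem_filter] at hk
          exact if_neg hk.2
        good_score := fun k hk hk0 j => by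
          rw [Finset.mem_filter] at hk
          by_contra hlt
          exact hk.2 ⟨hdes' k hk0, j, not_le.1 hlt⟩
        bad_variational := fun k hk => by
          simp only [Finset.mem_filter, Finset.mem_univ, true_and, not_not] at hk
          have h7 : o ω k = lassoSolution (P.gram k ω) (P.score k ω) lam := if_pos hk
          rw [h7]
          exact (hpos k _ hk.1).isLassoSolution ha0 hlam0 _
        bad_dim := fun k _ => hdim
        bad_wt := by
          rw [hGc]
          rwa [P.sum_wt hN, mul_one] at h5
        bad_shift := by
          rw [hGc fun k => P.wt k * P.shift k]
          rwa [P.sum_wt_mul_shift] at h6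
        total_score := fun j => by
          have e : (∑ k, P.wt k • (P.score k ω - P.gram k ω *ᵥ o ω k)) j =
              ∑ k, P.wt k * P.score k ω j - ∑ k, P.wt k * (P.gram k ω *ᵥ o ω k) j := by
            simp only [Finset.sum_apply, Pi.smul_apply, Pi.sub_apply, smul_eq_mul, mul_sub,
              Finset.sum_sub_distrib]
          rw [e]
          refine (abs_sub _ _).trans ?_
          linarith [h1 j hdes, h3 j]
        correction := by
          have e : ∀ j, (∑ k, P.wt k • o ω k) j ^ 2 ≤ (1 / (P.p * √P.N)) ^ 2 := by
            intro j
            simp only [Finset.sum_apply, Pi.smul_apply, smul_eq_mul]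
            rw [← sq_abs]
            exact pow_le_pow_left₀ (abs_nonneg _) (h4 j) 2
          refine (Finset.sum_le_sum fun j _ => e j).trans (le_of_eq ?_)
          rw [Finset.sum_const, Finset.card_univ, Fintype.card_fin, nsmul_eq_mul, div_pow, mul_pow,
            Real.sq_sqrt hN.le]
          field_simp
        target_score := fun j => by simpa [sampleSize] using h2 j (hdes 0) }
  have hexp := Real.exp_pos (-(8 * P.logp))
  have hwt2 := hS.sum_wt_sq_le
  have hwtB : (∑ k, P.wt k ^ 2) * B ≤ 4 / P.N * Real.exp (-(8 * P.logp)) := by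
    refine (mul_le_mul_of_nonneg_right hwt2 hB0).trans (le_of_eq ?_)
    rw [hB]
    field_simp
  have hainv : 1 / a ^ 2 = 4 * A ^ 4 := by rw [ha]; field_simp; norm_num
  have m1 : P.μ.real S1 ≤ P.p * (2 * Real.exp (-(8 * P.logp))) := by
    have := measureReal_iUnion_le_card_mul fun j =>
      measureReal_pooled_score_le hX hε hS hCT hc0 hD hRE j
    rwa [Fintype.card_fin] at this
  have m2 : P.μ.real S2 ≤ P.p * (2 * Real.exp (-(8 * P.logp))) := by
    have := measureReal_iUnion_le_card_mul fun j : Fin P.p =>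
      measureReal_task_score_le hX hε hS hCT hc0 hD hRE 0 j (r := c0 / 2) (by linarith)
    rwa [Fintype.card_fin] at this
  have m3 : P.μ.real S3 ≤ P.p * (16 * A ^ 8 * P.p ^ 2 * Real.exp (-(8 * P.logp))) := by
    have h : ∀ j, P.μ.real {ω | c0 / 4 * √(P.logp / P.N) <
        |∑ k, P.wt k * (P.gram k ω *ᵥ o ω k) j|} ≤
        16 * A ^ 8 * P.p ^ 2 * Real.exp (-(8 * P.logp)) := by
      intro j
      refine (measureReal_lt_abs_sum_gram_mulVec_correction_le hX hε hD'm ha0 hlam0 hpos hBk hB0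
        (by positivity : 0 ≤ 2 * A ^ 2) hup P.wt j (by positivity)).trans ?_
      rw [mul_pow (c0 / 4), Real.sq_sqrt (by positivity), div_le_iff₀ (by positivity)]
      calc _ = (2 * A ^ 2) ^ 2 * P.p ^ 2 * (1 / a ^ 2) * ((∑ k, P.wt k ^ 2) * B) := by ring
        _ ≤ (2 * A ^ 2) ^ 2 * P.p ^ 2 * (1 / a ^ 2) * (4 / P.N * Real.exp (-(8 * P.logp))) :=
            mul_le_mul_of_nonneg_left hwtB (by positivity)
        _ = 16 * A ^ 8 * P.p ^ 2 * Real.exp (-(8 * P.logp)) * (4 * (1 / P.N)) := by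
            rw [hainv]; ring
        _ ≤ 16 * A ^ 8 * P.p ^ 2 * Real.exp (-(8 * P.logp)) * ((c0 / 4) ^ 2 * (P.logp / P.N)) := by
            refine mul_le_mul_of_nonneg_left ?_ (by positivity)
            have h1 : (4 : ℝ) ≤ (c0 / 4) ^ 2 := by nlinarith
            exact mul_le_mul h1 (div_le_div_of_nonneg_right hS.one_le_logp hN.le) (by positivity)
              (by positivity)
    have := measureReal_iUnion_le_card_mul h
    rwa [Fintype.card_fin] at this
  have m4 : P.μ.real S4 ≤ P.p * (16 * A ^ 4 * P.p ^ 4 * Real.exp (-(8 * P.logp))) := by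
    have h : ∀ j, P.μ.real {ω | 1 / (P.p * √P.N) < |∑ k, P.wt k * o ω k j|} ≤
        16 * A ^ 4 * P.p ^ 4 * Real.exp (-(8 * P.logp)) := by
      intro j
      refine (measureReal_lt_abs_sum_correction_le hX hε hD'm ha0 hlam0 hpos hBk hB0 P.wt j
        (by positivity)).trans ?_
      rw [div_pow 1 (P.p * √P.N), mul_pow (P.p : ℝ), Real.sq_sqrt hN.le, div_le_iff₀ (by positivity)]
      calc _ = P.p ^ 2 * (1 / a ^ 2) * ((∑ k, P.wt k ^ 2) * B) := by ring
        _ ≤ P.p ^ 2 * (1 / a ^ 2) * (4 / P.N * Real.exp (-(8 * P.logp))) :=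
            mul_le_mul_of_nonneg_left hwtB (by positivity)
        _ = _ := by
            rw [hainv]; field_simp; ring
    have := measureReal_iUnion_le_card_mul h
    rwa [Fintype.card_fin] at this
  have hδη : P.p * (2 * Real.exp (-(8 * P.logp))) / η ≤
      192 * A ^ 6 * P.p ^ 2 * Real.exp (-(8 * P.logp)) := by
    have h1 : √P.p ≤ P.p := Real.sqrt_le_iff.2 ⟨hp0.le, by nlinarith⟩
    rw [hη, div_div_eq_mul_div, div_one]
    calc _ = 192 * A ^ 6 * P.p * Real.exp (-(8 * P.logp)) * √P.p := by ring
      _ ≤ 192 * A ^ 6 * P.p * Real.exp (-(8 * P.logp)) * P.p :=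
          mul_le_mul_of_nonneg_left h1 (by positivity)
      _ = _ := by ring
  have m5 : P.μ.real S5 ≤ 192 * A ^ 6 * P.p ^ 2 * Real.exp (-(8 * P.logp)) :=
    (measureReal_lt_sum_indicator_le hbadm (by positivity) hbadp (fun k => (hS.wt_pos k).le)
      hη0).trans hδη
  have m6 : P.μ.real S6 ≤ 192 * A ^ 6 * P.p ^ 2 * Real.exp (-(8 * P.logp)) :=
    (measureReal_lt_sum_indicator_le hbadm (by positivity) hbadp hshift hη0).trans hδη
  have hunion : P.μ.real (S1 ∪ S2 ∪ S3 ∪ S4 ∪ S5 ∪ S6) ≤ P.μ.real S1 + P.μ.real S2 +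
      P.μ.real S3 + P.μ.real S4 + P.μ.real S5 + P.μ.real S6 := by
    refine (measureReal_union_le _ _).trans (add_le_add_left ?_ _)
    refine (measureReal_union_le _ _).trans (add_le_add_left ?_ _)
    refine (measureReal_union_le _ _).trans (add_le_add_left ?_ _)
    refine (measureReal_union_le _ _).trans (add_le_add_left ?_ _)
    exact measureReal_union_le _ _
  refine (measureReal_mono hsub).trans (hunion.trans ?_)
  have q1 := hS.pow_mul_exp_le (m := 1) (by norm_num)
  have q2 := hS.pow_mul_exp_le (m := 2) (by norm_num)
  have q3 := hS.pow_mul_exp_le (m := 3) (by norm_num)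
  have q5 := hS.pow_mul_exp_le (m := 5) (by norm_num)
  rw [pow_one] at q1
  have r2 := mul_le_mul_of_nonneg_left q2 (by positivity : 0 ≤ 384 * A ^ 6)
  have r3 := mul_le_mul_of_nonneg_left q3 (by positivity : 0 ≤ 16 * A ^ 8)
  have r5 := mul_le_mul_of_nonneg_left q5 (by positivity : 0 ≤ 16 * A ^ 4)
  have hA48 : A ^ 4 ≤ A ^ 8 := pow_le_pow_right₀ hA (by norm_num)
  have r6 := mul_le_mul_of_nonneg_right hA48 (Real.exp_pos (-P.logp)).le
  linarith

end Regimes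

end TransferProblem

/-! ### Conclusion -/

namespace TransferProblem

variable {P : TransferProblem.{u}}

lemma SizeConditions.le_of_many_tasks {A C_T C_S : ℝ} (hS : P.SizeConditions A C_T)
    (hCS : P.K ^ 2 * P.s * P.logp ≤ C_S * P.nS) :
    (P.K : ℝ) ^ 2 * P.logp ≤ C_S * P.nS := by
  refine le_trans ?_ hCS
  have h1 := mul_le_mul_of_nonneg_left hS.one_le_s' (sq_nonneg (P.K : ℝ))
  rw [mul_one] at h1
  exact mul_le_mul_of_nonneg_right h1 hS.logp_pos.le

/-- The designs of all tasks are regular with high probability. -/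
lemma measureReal_exists_notMem_le [IsProbabilityMeasure P.μ] {A C_T C_S γ : ℝ}
    (hS : P.SizeConditions A C_T) (hγ : 0 < γ) (hCS1 : 1 ≤ C_S)
    (hCS : P.K ^ 2 * P.s * P.logp ≤ C_S * P.nS)
    {D : (k : Fin (P.K + 1)) → Set (Fin (sampleSize P.nT P.nS k) → Fin P.p → ℝ)}
    (h1 : ∀ k, P.μ.real {ω | (fun i => P.X k i ω) ∉ D k} ≤
      2 * Real.exp (-(γ * sampleSize P.nT P.nS k)))
    (h2 : ∀ k, P.μ.real {ω | (fun i => P.X k i ω) ∉ D k} ≤ 2 * Real.exp (-(2 * P.logp))) :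
    P.μ.real {ω | ¬ ∀ k, (fun i => P.X k i ω) ∈ D k} ≤
      (4 + 4 * C_S ^ 2 / γ ^ 2) * Real.exp (-P.logp) := by
  have hn := hS.nS_pos
  have hl := hS.logp_pos
  have hp := hS.one_le_p
  have hsub : {ω | ¬ ∀ k, (fun i => P.X k i ω) ∈ D k} ⊆
      ⋃ k, {ω | (fun i => P.X k i ω) ∉ D k} := by
    intro ω hω
    rw [Set.mem_ofPred_eq, not_forall] at hω
    obtain ⟨k, hk⟩ := hω
    exact Set.mem_iUnion.2 ⟨k, hk⟩
  refine (measureReal_mono hsub).trans ((measureReal_iUnion_fintype_le _).trans ?_)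
  rw [Fin.sum_univ_succ]
  have e2 : Real.exp (-(2 * P.logp)) = Real.exp (-P.logp) * Real.exp (-P.logp) := by
    rw [← Real.exp_add]; ring_nf
  have e1 : P.p * Real.exp (-P.logp) = 1 := by
    rw [← hS.exp_logp, ← Real.exp_add, add_neg_cancel, Real.exp_zero]
  have e0 := Real.exp_pos (-P.logp)
  have e3 : Real.exp (-P.logp) ≤ 1 := Real.exp_le_one_iff.2 (by linarith)
  have h0 := h2 0
  have hCS0 : 0 ≤ 4 * C_S ^ 2 / γ ^ 2 * Real.exp (-P.logp) := by positivity
  have hone : Real.exp (-(2 * P.logp)) ≤ Real.exp (-P.logp) := by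
    rw [e2]; exact mul_le_of_le_one_right e0.le e3
  -- For K ≤ p the bound p⁻² per task survives the union over the tasks. For K > p the bound exp(-γ
  -- n_S) is used, with K² ≤ C_S n_S.
  rcases le_or_gt P.K P.p with hK | hK
  · have h3 : ∑ k : Fin P.K, P.μ.real {ω | (fun i => P.X k.succ i ω) ∉ D k.succ} ≤
        P.K * (2 * Real.exp (-(2 * P.logp))) := by
      refine (Finset.sum_le_sum fun k _ => h2 k.succ).trans (le_of_eq ?_)
      rw [Finset.sum_const, Finset.card_univ, Fintype.card_fin, nsmul_eq_mul]
    have hK' : (P.K : ℝ) ≤ P.p := by exact_mod_cast hK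
    have h4 : P.K * (2 * Real.exp (-(2 * P.logp))) ≤ 2 * Real.exp (-P.logp) := by
      refine (mul_le_mul_of_nonneg_right hK' (by positivity)).trans (le_of_eq ?_)
      rw [e2]
      linear_combination 2 * Real.exp (-P.logp) * e1
    linarith
  · have h3 : ∑ k : Fin P.K, P.μ.real {ω | (fun i => P.X k.succ i ω) ∉ D k.succ} ≤
        P.K * (2 * Real.exp (-(γ * P.nS))) := by
      refine (Finset.sum_le_sum (g := fun _ => 2 * Real.exp (-(γ * P.nS))) fun k _ => ?_).trans
        (le_of_eq ?_)
      · have := h1 k.succ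
        simpa [sampleSize, Fin.succ_ne_zero] using this
      · rw [Finset.sum_const, Finset.card_univ, Fintype.card_fin, nsmul_eq_mul]
    have hK' : (P.p : ℝ) ≤ P.K := by exact_mod_cast hK.le
    have h5 := hS.le_of_many_tasks hCS
    have h6 : (P.K : ℝ) ^ 2 ≤ C_S * P.nS :=
      (le_mul_of_one_le_right (sq_nonneg _) hS.one_le_logp).trans h5
    have h7 : Real.exp (-(γ * P.nS)) ≤ 2 / (γ * P.nS) ^ 2 := by
      have hx : 0 < γ * P.nS := by positivity
      have := Real.quadratic_le_exp_of_nonneg hx.le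
      rw [Real.exp_neg, inv_le_comm₀ (Real.exp_pos _) (by positivity), inv_div]
      linarith
    have h8 : P.K * (2 * Real.exp (-(γ * P.nS))) ≤ 4 * C_S ^ 2 / γ ^ 2 * Real.exp (-P.logp) := by
      have hK1 := hS.one_le_K'
      have e4 : Real.exp (-P.logp) = 1 / P.p := by
        rw [eq_div_iff (by linarith), mul_comm]; exact e1
      have h9 : P.K * P.p ≤ C_S * P.nS :=
        le_trans (by rw [sq]; exact mul_le_mul_of_nonneg_left hK' (by linarith)) h6
      rw [e4]
      calc P.K * (2 * Real.exp (-(γ * P.nS))) ≤ P.K * (2 * (2 / (γ * P.nS) ^ 2)) := by gcongr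
        _ = 4 / γ ^ 2 * (P.K / P.nS ^ 2) := by field_simp; norm_num
        _ ≤ 4 / γ ^ 2 * (C_S ^ 2 * (1 / P.p)) := by
            refine mul_le_mul_of_nonneg_left ?_ (by positivity)
            rw [← mul_div_assoc, mul_one, div_le_div_iff₀ (by positivity) (by linarith)]
            refine h9.trans ?_
            have hq : 1 ≤ C_S * P.nS := le_trans (by nlinarith) h6
            nlinarith
        _ = _ := by ring
    linarith

/-- The good event of a single problem. -/
theorem exists_event [IsProbabilityMeasure P.μ] {L σsq : ℝ≥0} {c A C_T C_S γ c0 : ℝ}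
    (hX : P.SubGaussianDesign L c) (hε : P.GaussianErrors σsq) (hS : P.SizeConditions A C_T)
    (hΘ : P.InParameterSpace) (hA : 1 ≤ A) (hCT : 1 ≤ C_T) (hγ : 0 < γ) (hCS1 : 1 ≤ C_S)
    (hCS : P.K ^ 2 * P.s * P.logp ≤ C_S * P.nS) (hp : 2 * A ^ 2 * C_S ≤ P.p)
    (hc0 : 32 + 8 * (σsq * (2 * A ^ 2 * C_T)) ≤ c0)
    {D : (k : Fin (P.K + 1)) → Set (Fin (sampleSize P.nT P.nS k) → Fin P.p → ℝ)}
    (hD : ∀ k, MeasurableSet (D k))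
    (hRE : ∀ k, ∀ x ∈ D k, RestrictedEigenvalue A (√(P.logp / sampleSize P.nT P.nS k))
      (Matrix.toBilin' (gramMatrix x)))
    (h1 : ∀ k, P.μ.real {ω | (fun i => P.X k i ω) ∉ D k} ≤
      2 * Real.exp (-(γ * sampleSize P.nT P.nS k)))
    (h2 : ∀ k, P.μ.real {ω | (fun i => P.X k i ω) ∉ D k} ≤ 2 * Real.exp (-(2 * P.logp))) :
    ∃ E : Set P.Ω, MeasurableSet E ∧
      1 - (16 + 4 * C_S ^ 2 / γ ^ 2 + 32 * A ^ 8 + 384 * A ^ 6) * Real.exp (-P.logp) ≤ P.μ.real E ∧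
      ∀ ω ∈ E, ∃ o G, P.GoodEvent A c0 c0 (1 / (96 * A ^ 6 * √P.p)) ω o G := by
  set η := 1 / (96 * A ^ 6 * √P.p) with hη
  set bad : Set P.Ω := {ω | ¬ ∃ o G, P.GoodEvent A c0 c0 η ω o G} with hbad
  have hn := hS.nS_pos
  have e0 := Real.exp_pos (-P.logp)
  have hA6 : 0 ≤ A ^ 6 * Real.exp (-P.logp) := by positivity
  have hA8 : 0 ≤ A ^ 8 * Real.exp (-P.logp) := by positivity
  have hnoise : P.μ.real {ω | (∀ k, (fun i => P.X k i ω) ∈ D k) ∧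
      ¬ ∃ o G, P.GoodEvent A c0 c0 η ω o G} ≤
      (12 + 32 * A ^ 8 + 384 * A ^ 6) * Real.exp (-P.logp) := by
    rcases le_or_gt P.K P.p with hK | hK
    · have h3 := measureReal_not_goodEvent_le_of_few_tasks hX hε hS hCT hc0 hD hRE hK
        (η := η) (by positivity) hΘ
      refine (measureReal_mono fun ω hω => ?_).trans (h3.trans (by linarith))
      rw [Set.mem_ofPred_eq] at hω ⊢
      exact ⟨hω.1, fun h => hω.2 ⟨_, _, h⟩⟩
    · have hp0 := hS.one_le_p
      have hK' : (P.p : ℝ) ≤ P.K := by exact_mod_cast hK.le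
      -- K > p gives p² log p ≤ C_S n_S, and p ≥ 2 A² C_S trades one factor p for the constant.
      have hdim : 2 * A ^ 2 * (P.logp / P.nS) * P.p ≤ 1 := by
        have h5 := hS.le_of_many_tasks hCS
        have h6 : (P.p : ℝ) ^ 2 * P.logp ≤ C_S * P.nS :=
          (mul_le_mul_of_nonneg_right (pow_le_pow_left₀ (by linarith) hK' 2)
            hS.logp_pos.le).trans h5
        rw [mul_div_assoc', div_mul_eq_mul_div, div_le_one hn]
        have h7 := mul_le_mul_of_nonneg_right hp (mul_nonneg (by linarith : (0 : ℝ) ≤ P.p)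
          hS.logp_pos.le)
        have h8 : C_S * (2 * A ^ 2 * P.logp * P.p) ≤ C_S * P.nS := by
          refine le_trans (le_of_eq ?_) (h7.trans (le_trans (le_of_eq ?_) h6)) <;> ring
        exact le_of_mul_le_mul_left h8 (by linarith)
      have h3 := measureReal_not_goodEvent_le_of_low_dim hX hε hS hA hCT hc0 hD hRE hdim hΘ
      exact h3.trans (mul_le_mul_of_nonneg_right (by linarith) e0.le)
  have hdes := measureReal_exists_notMem_le hS hγ hCS1 hCS h1 h2
  have hbadle : P.μ.real bad ≤
      (16 + 4 * C_S ^ 2 / γ ^ 2 + 32 * A ^ 8 + 384 * A ^ 6) * Real.exp (-P.logp) := by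
    have hsub : bad ⊆ {ω | ¬ ∀ k, (fun i => P.X k i ω) ∈ D k} ∪
        {ω | (∀ k, (fun i => P.X k i ω) ∈ D k) ∧ ¬ ∃ o G, P.GoodEvent A c0 c0 η ω o G} := by
      intro ω hω
      by_cases h : ∀ k, (fun i => P.X k i ω) ∈ D k
      · exact Or.inr ⟨h, hω⟩
      · exact Or.inl h
    refine (measureReal_mono hsub).trans ((measureReal_union_le _ _).trans ?_)
    linarith
  -- The existence of o and G need not define a measurable event, so the bad set is replaced with a
  -- measurable hull of the same measure.
  refine ⟨(toMeasurable P.μ bad)ᶜ, (measurableSet_toMeasurable _ _).compl, ?_, fun ω hω => ?_⟩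
  · rw [probReal_compl_eq_one_sub (measurableSet_toMeasurable _ _), measureReal_def,
      measure_toMeasurable, ← measureReal_def]
    linarith
  · by_contra hcon
    exact hω (subset_toMeasurable P.μ bad hcon)

lemma hbar_nonneg_of_inParameterSpace (hΘ : P.InParameterSpace) : 0 ≤ P.hbar := by
  have : 0 ≤ P.N := by unfold N; positivity
  exact mul_nonneg (by positivity) (Finset.sum_nonneg fun k _ => (l1Norm_nonneg _).trans (hΘ.2 k))

end TransferProblem

open TransferProblem in
theorem corollary1 (L σsq : ℝ≥0) (c C_T C_S : ℝ) (hc : 0 < c) :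
    ∃ c0 > (0 : ℝ), ∃ c1 > (0 : ℝ), ∀ κ > (0 : ℝ),
      ∃ C > (0 : ℝ), ∃ c2 > (0 : ℝ), ∃ c3 > (0 : ℝ),
      ∀ P : ℕ → TransferProblem.{u},
        (∀ m, IsProbabilityMeasure (P m).μ) →
        (∀ m, (P m).SubGaussianDesign L c) →
        (∀ m, (P m).GaussianErrors σsq) →
        (∀ m, (P m).InParameterSpace) →
        (∀ m, 1 ≤ (P m).K ∧ 1 ≤ (P m).s ∧ (P m).nT ≤ (P m).nS) →
        Tendsto (fun m => (P m).s * (P m).logp / (P m).nS) atTop (𝓝 0) →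
        (∀ᶠ m in atTop, (P m).s * (P m).logp ≤ C_T * (P m).nT) →
        (∀ᶠ m in atTop, (P m).K ^ 2 * (P m).s * (P m).logp ≤ C_S * (P m).nS) →
        Tendsto (fun m => (P m).hbar * √((P m).logp / (P m).nT)
          + (P m).K * (P m).s * (P m).logp / (P m).nS) atTop (𝓝 0) →
        ∀ᶠ m in atTop, ∃ E : Set (P m).Ω, MeasurableSet E ∧
          1 - c2 * Real.exp (-c3 * (P m).logp) ≤ (P m).μ.real E ∧
          ∀ ω ∈ E, ∀ b : Fin (P m).p → ℝ, (P m).IsCombined κ c0 c1 ω b →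
            l2NormSq (b - (P m).β 0) ≤
              C * ((P m).s * (P m).logp / (P m).N
                + min ((P m).hbar * √((P m).logp / (P m).nT)) ((P m).hbar ^ 2)) := by
  set C_T' := max 1 C_T with hCT'
  set C_S' := max 1 C_S with hCS'
  have hCT1 : 1 ≤ C_T' := le_max_left _ _
  have hCS1 : 1 ≤ C_S' := le_max_left _ _
  obtain ⟨A, hA, γ, hγ, hdesign⟩ := exists_regular_designs.{u} L (one_div_pos.2 hc)
    (one_pos.trans_le hCT1)
  -- 2 A² C_T' bounds the diagonal of the Gram matrices. With this c0 every Chernoff exponent is at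
  -- least 8 log p, and the same constant serves as c1.
  set c0 := 32 + 8 * (σsq * (2 * A ^ 2 * C_T')) with hc0
  have hc0pos : 0 < c0 := by positivity
  refine ⟨c0, hc0pos, c0, hc0pos, fun κ hκ => ?_⟩
  obtain ⟨C, hC, hbound⟩ := GoodEvent.combined_bound.{u} hA hc0pos hc0pos hCT1 hκ
  -- For p < p0 the probability bound is vacuous because exp(log p) ≤ c2 + p0. For p ≥ p0 one has
  -- log p ≥ 1, from p ≥ 3, and p ≥ 2 A² C_S', as needed in the low-dimensional regime.
  set p0 : ℝ := 3 + 2 * A ^ 2 * C_S' with hp0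
  set c2 : ℝ := 16 + 4 * C_S' ^ 2 / γ ^ 2 + 32 * A ^ 8 + 384 * A ^ 6 with hc2
  have hA0 : 0 < A := by linarith
  have hp0pos : 3 ≤ p0 := by
    have : 0 ≤ 2 * A ^ 2 * C_S' := by positivity
    linarith
  have hc2pos : 0 < c2 := by positivity
  refine ⟨C, hC, c2 + p0, by linarith, 1, one_pos, ?_⟩
  intro P hprob hX hε hΘ hsize hlim1 hT hSS hlim2
  have hev1 := hlim1.eventually_le_const (show (0 : ℝ) < 1 / (88 * A) ^ 2 by positivity)
  have hev2 := hlim2.eventually_le_const (show (0 : ℝ) < 1 / 2 by norm_num)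
  filter_upwards [hev1, hT, hSS, hev2] with m h1 h2 h3 h4
  have := hprob m
  obtain ⟨hK, hs, hTS⟩ := hsize m
  rw [neg_one_mul]
  rcases lt_or_ge ((P m).p : ℝ) p0 with hp | hp
  · refine ⟨∅, MeasurableSet.empty, ?_, fun ω hω => absurd hω (Set.notMem_empty _)⟩
    have h5 : Real.exp (P m).logp ≤ c2 + p0 := by
      rcases Nat.eq_zero_or_pos (P m).p with h | h
      · rw [logp, h, Nat.cast_zero, Real.log_zero, Real.exp_zero]; linarith
      · rw [logp, Real.exp_log (by exact_mod_cast h)]; linarith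
    have h6 := mul_le_mul_of_nonneg_right h5 (Real.exp_pos (-(P m).logp)).le
    rw [← Real.exp_add, add_neg_cancel, Real.exp_zero] at h6
    rw [measureReal_empty]
    linarith
  · have hs' : (1 : ℝ) ≤ (P m).s := by exact_mod_cast hs
    have hlogp : 1 ≤ (P m).logp := by
      have : Real.exp 1 ≤ (P m).p := by
        have := Real.exp_one_lt_d9
        linarith
      exact (Real.le_log_iff_exp_le (by linarith)).2 this
    have hsl : 1 ≤ (P m).s * (P m).logp := by nlinarith
    have hnT : 0 < (P m).nT := by
      rcases Nat.eq_zero_or_pos (P m).nT with h | h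
      · rw [h, Nat.cast_zero, mul_zero] at h2; linarith
      · exact h
    have hT' : (P m).s * (P m).logp ≤ C_T' * (P m).nT :=
      h2.trans (mul_le_mul_of_nonneg_right (le_max_right _ _) (Nat.cast_nonneg _))
    have hS' : (P m).K ^ 2 * (P m).s * (P m).logp ≤ C_S' * (P m).nS :=
      h3.trans (mul_le_mul_of_nonneg_right (le_max_right _ _) (Nat.cast_nonneg _))
    have hh : 0 ≤ (P m).hbar * √((P m).logp / (P m).nT) :=
      mul_nonneg (hbar_nonneg_of_inParameterSpace (hΘ m)) (Real.sqrt_nonneg _)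
    have hk : 0 ≤ (P m).K * (P m).s * (P m).logp / (P m).nS := by positivity
    have hS : (P m).SizeConditions A C_T' :=
      { one_le_logp := hlogp
        nT_pos := hnT
        nT_le := hTS
        one_le_K := hK
        one_le_s := hs
        small := by
          rw [mul_assoc, ← Real.sqrt_mul (by positivity), ← mul_div_assoc]
          refine (mul_le_mul_of_nonneg_left (Real.sqrt_le_sqrt h1) (by positivity)).trans
            (le_of_eq ?_)
          rw [Real.sqrt_div zero_le_one, Real.sqrt_one, Real.sqrt_sq (by positivity)]
          field_simp
        small_K := by linarith
        target := hT'
        small_shift := by linarith }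
    have hlogp_le : ∀ k, Real.log (P m).p ≤ C_T' * sampleSize (P m).nT (P m).nS k := fun k =>
      (div_le_iff₀ (hS.sampleSize_pos k)).1 (hS.logp_div_sampleSize_le k)
    choose D hD hRE hfail using fun k =>
      hdesign (sampleSize (P m).nT (P m).nS k) (P m).p
        (by exact_mod_cast hS.sampleSize_pos k) hlogp (hlogp_le k)
    have hfail' := fun k => hfail k (X := (P m).X k) (μ := (P m).μ) ((hX m).measurable k)
      ((hX m).indep k) ((hX m).subGaussian k) fun i u hu => by
        obtain ⟨hM, heig⟩ := (hX m).eigenvalues k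
        exact le_integral_dotProduct_sq ((hX m).subGaussian k i) ((hX m).mean_zero k i)
          ((hX m).covariance k i) hM (fun j => (heig j).1) hu
    obtain ⟨E, hE, hEp, hgood⟩ := exists_event (hX m) (hε m) hS (hΘ m) hA hCT1 hγ hCS1 hS'
      (by linarith) le_rfl hD hRE (fun k => (hfail' k).1) fun k => (hfail' k).2
    have hexp := Real.exp_pos (-(P m).logp)
    refine ⟨E, hE, ?_, fun ω hω b hb => ?_⟩
    · have : 0 ≤ p0 * Real.exp (-(P m).logp) := by positivity
      linarith
    · obtain ⟨o, G, hG⟩ := hgood ω hω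
      have hpp : 0 < √((P m).p : ℝ) := Real.sqrt_pos.2 (by linarith)
      have hη : 3 * A ^ 2 * √(P m).p * (1 / (96 * A ^ 6 * √(P m).p)) = 1 / (32 * A ^ 4) := by
        field_simp
        norm_num
      refine hbound (P m) _ ω o G hG hS (hΘ m) (by positivity) ?_ ?_ b hb
      · rw [hη]
        have : 1 ≤ A ^ 4 := one_le_pow₀ hA
        rw [div_le_div_iff₀ (by positivity) (by norm_num)]
        linarith
      · rw [hη]
        refine le_of_eq ?_
        field_simp
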